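/- **Setting.** Let $(W,\lambda)$ be a Liouville domain of dimension $2n\ge 2$: a compact connected smooth manifold with boundary with a smooth one-form $\lambda$ such that $\omega=d\lambda$ is non-degenerate and the vector field $Y$ given by $\omega(Y,\cdot)=\lambda$ is transverse to $\partial W$ and points outwards. Let $\alpha=\lambda|_{\partial W}$, and let $\hat W=W\cup_{\partial W}(\partial W\times[1,+\infty))$ be its completion, with the Liouville form, still denoted by $\lambda$, extended by $\rho\,\alpha$ on $\partial W\times[1,+\infty)$, where $\rho$ is the coordinate on the second factor, and with $\omega=d\lambda$. The flow of $Y$ identifies $\partial W\times(0,+\infty)$, with the one-form $\rho\,\alpha$, with an open subset of $\hat W$. Put $\mathbb T=\mathbb R/\mathbb Z$. For $F\in C^\infty(\hat W)$ let $X_F$ be defined by $\omega(X_F,\cdot)=-dF$. Let $J_t$, $t\in\mathbb T$, be a smooth loop of almost complex structures on $\hat W$ such that $\langle\cdot,\cdot\rangle_t=\omega(J_t\cdot,\cdot)$ is a Riemannian metric for every $t$, and write $|\cdot|_t$ for its norm. For $x\in C^\infty(\mathbb T,\hat W)$ and $\eta\in\mathbb R$ let $$\mathbb A_F(x,\eta)=\int_{\mathbb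 T}x^*\lambda-\eta\int_{\mathbb T}F(x(t))\,dt .$$ Its gradient with respect to the product of the $L^2$-metric on loops induced by $\langle\cdot,\cdot\rangle_t$ and of the standard metric of $\mathbb R$ is $$\nabla\mathbb A_F(x,\eta)=\Bigl(J_t(x)\bigl(x'-\eta X_F(x)\bigr),\,-\int_{\mathbb T}F(x)\,dt\Bigr),\quad \|\nabla\mathbb A_F(x,\eta)\|^2=\int_{\mathbb T}\bigl|J_t(x)(x'-\eta X_F(x))\bigr|_t^2\,dt+\Bigl(\int_{\mathbb T}F(x)\,dt\Bigr)^2 .$$ **Proposition.** Let $\rho_0>0$, and assume that $J_t$ is of contact type on $\partial W\times[\rho_0,+\infty)$, that is, $d\rho\circ J_t=\lambda$ there for every $t\in\mathbb T$. Let $\{H_s\}_{s\in\mathbb R}$ be a smooth family of Hamiltonians on $\hat W$ such that * $H_s=H_0$ for all $s\le 0$ and $H_s=H_1$ for all $s\ge1$; * for some $\theta>0$: $\lambda(X_{H_s}(w))-H_s(w)\ge\theta$ for all $s\in\mathbb R$ and all $w\in\hat W$ with $H_s(w)=0$; * $H_s(x,\rho)=h(s,\rho)$ for all $s\in\mathbb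 R$ and $(x,\rho)\in\partial W\times[\rho_0,+\infty)$, where $h:\mathbb R\times[\rho_0,+\infty)\to\mathbb R$ is a smooth function for which there are constants $\kappa>0$, $\gamma>0$ such that for all $(s,\rho)\in\mathbb R\times[\rho_0,+\infty)$ - (a) $\dfrac{\partial h}{\partial\rho}(s,\rho)\ge0$, - (b) $h(s,\rho)\ge\rho/\kappa$, - (c) $\Bigl|\dfrac{\partial^2h}{\partial\rho^2}(s,\rho)\Bigr|\le\kappa\rho^\gamma$ and $\Bigl|\dfrac{\partial^2h}{\partial s\,\partial\rho}(s,\rho)\Bigr|\le\kappa\rho^\gamma$. Then for every pair of real numbers $A,E$ there is a compact set $K=K(A,E)\subset\hat W$ such that, for every smooth solution $v=(u,\eta)$, $u:\mathbb R\times\mathbb T\to\hat W$, $\eta:\mathbb R\to\mathbb R$, of $$\frac{\partial u}{\partial s}+J_t(u)\Bigl(\frac{\partial u}{\partial t}-\eta\,X_{H_s}(u)\Bigr)=0,\qquad \frac{d\eta}{ds}=\int_{\mathbb T}H_s(u(s,t))\,dt$$ with $$\sup_{s\in\mathbb R}|\mathbb A_{H_s}(v(s))|\le A\qquad\text{and}\qquad\int_{-\infty}^{+\infty}\|\nabla\mathbb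 A_{H_s}(v(s))\|^2\,ds\le E,$$ where $v(s)=(u(s,\cdot),\eta(s))$, one has $u(s,t)\in K$ for all $(s,t)\in\mathbb R\times\mathbb T$. -/

import Mathlib

open Set MeasureTheory Bundle
open scoped Manifold ContDiff Topology

noncomputable section

namespace RabinowitzFloer

/-! ### One-forms on manifolds, exterior derivative, Hamiltonian vector fields -/

section Forms

variable {E : Type*} [NormedAddCommGroup E] [NormedSpace ℝ E]
  {H : Type*} [TopologicalSpace H] (I : ModelWithCorners ℝ E H)
  {M : Type*} [TopologicalSpace M] [ChartedSpace H M]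

/-- Smoothness of a one-form, as a section of the cotangent bundle. -/
def IsSmoothOneForm [IsManifold I ∞ M] (θ : ∀ x : M, TangentSpace I x →L[ℝ] ℝ) : Prop :=
  ContMDiff I (I.prod 𝓘(ℝ, E →L[ℝ] ℝ)) ∞
    (fun x ↦ TotalSpace.mk' (E →L[ℝ] ℝ) (E := fun x : M ↦ TangentSpace I x →L[ℝ] ℝ) x (θ x))

/-- The expression of a one-form in the preferred chart at `x₀`, i.e. its pull-back by the inverse
of that chart. It is a map from (a subset of) the model vector space to its dual. -/
def oneFormInChart (θ : ∀ x : M, TangentSpace I x →L[ℝ] ℝ) (x₀ : M) (y : E) : E →L[ℝ] ℝ :=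
  (θ ((extChartAt I x₀).symm y)).comp
    (mfderivWithin 𝓘(ℝ, E) I (extChartAt I x₀).symm (range I) y)

/-- The exterior derivative `dθ` of a one-form at `x₀`, computed in the preferred chart at `x₀`
(which is the chart used to identify `TangentSpace I x₀` with the model vector space):
`dθ (v, w) = (D_v θ) w - (D_w θ) v`. -/
def extDerivOneForm (θ : ∀ x : M, TangentSpace I x →L[ℝ] ℝ) (x₀ : M) :
    TangentSpace I x₀ →L[ℝ] TangentSpace I x₀ →L[ℝ] ℝ :=
  letI D : E →L[ℝ] E →L[ℝ] ℝ :=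
    fderivWithin ℝ (oneFormInChart I θ x₀) (range I) (extChartAt I x₀ x₀)
  D - D.flip

/-- `dθ` is non-degenerate at every point. -/
def HasNondegenerateDeriv (θ : ∀ x : M, TangentSpace I x →L[ℝ] ℝ) : Prop :=
  ∀ (x : M) (v : TangentSpace I x), (∀ w, extDerivOneForm I θ x v w = 0) → v = 0

end Forms

section Dual

variable {V : Type*} [AddCommGroup V] [Module ℝ V] [TopologicalSpace V]

open Classical in
/-- The vector `X` such that `Ω (X, ·) = ℓ`; it exists and is unique when the form `Ω` is
non-degenerate on a finite dimensional space. -/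
def dualVector (Ω : V →L[ℝ] V →L[ℝ] ℝ) (ℓ : V →L[ℝ] ℝ) : V :=
  if h : ∃ X : V, ∀ v, Ω X v = ℓ v then h.choose else 0

theorem dualVector_spec [FiniteDimensional ℝ V] (Ω : V →L[ℝ] V →L[ℝ] ℝ)
    (hΩ : ∀ v, (∀ w, Ω v w = 0) → v = 0) (ℓ : V →L[ℝ] ℝ) (v : V) :
    Ω (dualVector Ω ℓ) v = ℓ v := by
  have h : ∃ X : V, ∀ v, Ω X v = ℓ v := by
    let B : V →ₗ[ℝ] Module.Dual ℝ V :=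
      { toFun := fun v ↦ (Ω v).toLinearMap
        map_add' := fun a b ↦ by ext; simp
        map_smul' := fun a b ↦ by ext; simp }
    have hinj : Function.Injective B := by
      rw [← LinearMap.ker_eq_bot, LinearMap.ker_eq_bot']
      intro m hm
      exact hΩ m fun w ↦ congrArg (fun f : Module.Dual ℝ V ↦ f w) hm
    have hsurj : Function.Surjective B :=
      (LinearMap.injective_iff_surjective_of_finrank_eq_finrank
        (Subspace.dual_finrank_eq (K := ℝ) (V := V)).symm).1 hinj
    obtain ⟨X, hX⟩ := hsurj ℓ.toLinearMap
    exact ⟨X, fun v ↦ congrArg (fun f : Module.Dual ℝ V ↦ f v) hX⟩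
  rw [dualVector, dif_pos h]
  exact h.choose_spec v

end Dual

/-! ### Liouville domains and their completions -/

/-- A Liouville domain `(W, λ)` of dimension `2 n`: a compact connected manifold with boundary with
a one-form `λ` such that `ω = dλ` is non-degenerate and such that the Liouville vector field `Y`,
given by `ω (Y, ·) = λ`, is transverse to the boundary and points outwards. -/
structure LiouvilleDomain (n : ℕ) [NeZero n] (W : Type*) [TopologicalSpace W]
    [ChartedSpace (EuclideanHalfSpace (2 * n)) W] [IsManifold (𝓡∂ (2 * n)) ∞ W]
    [T2Space W] [CompactSpace W] [ConnectedSpace W] where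
  /-- the Liouville form -/
  lam : ∀ x : W, TangentSpace (𝓡∂ (2 * n)) x →L[ℝ] ℝ
  smooth : IsSmoothOneForm (𝓡∂ (2 * n)) lam
  nondegenerate : HasNondegenerateDeriv (𝓡∂ (2 * n)) lam
  /-- In the preferred chart at a boundary point, which takes values in `{y | 0 ≤ y 0}`, a tangent
  vector is transverse to the boundary and points outwards iff its component `0` is negative. -/
  outward : ∀ x ∈ (𝓡∂ (2 * n)).boundary W,
    (dualVector (extDerivOneForm (𝓡∂ (2 * n)) lam x) (lam x) :
      EuclideanSpace ℝ (Fin (2 * n))) 0 < 0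

/-- `What` is the completion `W ∪ (∂W × [1, ∞))` of the Liouville domain `D` on `W`, where the
closed manifold `N` is the boundary of `W`. The smooth structure of the completion is the one for
which the symplectization `N × (0, ∞)`, with Liouville form `ρ α`, `α = λ|_{∂W}`, is embedded as an
open subset which extends the end `N × [1, ∞)`. -/
structure LiouvilleCompletion {n : ℕ} [NeZero n] {W : Type*} [TopologicalSpace W]
    [ChartedSpace (EuclideanHalfSpace (2 * n)) W] [IsManifold (𝓡∂ (2 * n)) ∞ W]
    [T2Space W] [CompactSpace W] [ConnectedSpace W] (D : LiouvilleDomain n W)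
    (N : Type*) [TopologicalSpace N] [ChartedSpace (EuclideanSpace ℝ (Fin (2 * n - 1))) N]
    [IsManifold (𝓡 (2 * n - 1)) ∞ N]
    (What : Type*) [TopologicalSpace What] [ChartedSpace (EuclideanSpace ℝ (Fin (2 * n))) What]
    [IsManifold (𝓡 (2 * n)) ∞ What] [T2Space What] where
  /-- the inclusion of `N = ∂W` into `W` -/
  bd : N → W
  bd_smooth : ContMDiff (𝓡 (2 * n - 1)) (𝓡∂ (2 * n)) ∞ bd
  bd_isEmbedding : Topology.IsEmbedding bd
  bd_immersion : ∀ x, Function.Injective (mfderiv (𝓡 (2 * n - 1)) (𝓡∂ (2 * n)) bd x)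
  range_bd : range bd = (𝓡∂ (2 * n)).boundary W
  /-- the extended Liouville form on the completion -/
  lam : ∀ w : What, TangentSpace (𝓡 (2 * n)) w →L[ℝ] ℝ
  smooth : IsSmoothOneForm (𝓡 (2 * n)) lam
  nondegenerate : HasNondegenerateDeriv (𝓡 (2 * n)) lam
  /-- the inclusion of `W` into the completion -/
  incl : W → What
  incl_smooth : ContMDiff (𝓡∂ (2 * n)) (𝓡 (2 * n)) ∞ incl
  incl_isEmbedding : Topology.IsEmbedding incl
  incl_immersion : ∀ x, Function.Injective (mfderiv (𝓡∂ (2 * n)) (𝓡 (2 * n)) incl x)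
  incl_pullback : ∀ (x : W) (v : TangentSpace (𝓡∂ (2 * n)) x),
    lam (incl x) (mfderiv (𝓡∂ (2 * n)) (𝓡 (2 * n)) incl x v) = D.lam x v
  /-- the embedding of the symplectization `N × (0, ∞)` as an open subset of the completion -/
  collar : OpenPartialHomeomorph (N × ℝ) What
  collar_source : collar.source = univ ×ˢ Ioi 0
  collar_smooth : ContMDiffOn ((𝓡 (2 * n - 1)).prod 𝓘(ℝ, ℝ)) (𝓡 (2 * n)) ∞ collar collar.source
  collar_symm_smooth :
    ContMDiffOn (𝓡 (2 * n)) ((𝓡 (2 * n - 1)).prod 𝓘(ℝ, ℝ)) ∞ collar.symm collar.target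
  /-- the end is glued to `W` along the boundary by identifying `(x, 1)` with `x` -/
  collar_one : ∀ x : N, collar (x, 1) = incl (bd x)
  /-- the completion is the disjoint union of `W` and of `N × (1, ∞)` -/
  range_incl : range incl = (collar '' (univ ×ˢ Ioi 1))ᶜ
  collar_pullback : ∀ (x : N) (ρ : ℝ), 0 < ρ →
    ∀ (ξ : TangentSpace (𝓡 (2 * n - 1)) x) (r : ℝ),
      lam (collar (x, ρ))
          (mfderiv ((𝓡 (2 * n - 1)).prod 𝓘(ℝ, ℝ)) (𝓡 (2 * n)) collar (x, ρ) (ξ, r)) =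
        ρ * D.lam (bd x) (mfderiv (𝓡 (2 * n - 1)) (𝓡∂ (2 * n)) bd x ξ)

/-! ### The Rabinowitz action functional and the Rabinowitz-Floer equation

In this section `M` is a manifold without boundary with a one-form `lam`, and `ω = d lam`. The
circle is `ℝ / ℤ`, and loops are `1`-periodic maps on the real line. -/

section Floer

variable {m : ℕ} {M : Type*} [TopologicalSpace M] [ChartedSpace (EuclideanSpace ℝ (Fin m)) M]

/-- The Hamiltonian vector field `X` of the function `F`, given by `ω (X, ·) = - dF`. -/
def hamiltonianVF (lam : ∀ w : M, TangentSpace (𝓡 m) w →L[ℝ] ℝ) (F : M → ℝ) (w : M) :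
    TangentSpace (𝓡 m) w :=
  letI dF : TangentSpace (𝓡 m) w →L[ℝ] ℝ := mfderiv (𝓡 m) 𝓘(ℝ, ℝ) F w
  dualVector (extDerivOneForm (𝓡 m) lam w) (-dF)

/-- The velocity of a curve. -/
def velocity (x : ℝ → M) (t : ℝ) : TangentSpace (𝓡 m) (x t) :=
  mfderiv 𝓘(ℝ, ℝ) (𝓡 m) x t (1 : ℝ)

/-- A smooth loop `J t`, `t ∈ ℝ / ℤ`, of almost complex structures such that `ω (J t ·, ·)` is a
loop of Riemannian metrics. -/
structure IsCompatibleLoop [IsManifold (𝓡 m) ∞ M] (lam : ∀ w : M, TangentSpace (𝓡 m) w →L[ℝ] ℝ)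
    (J : ℝ → ∀ w : M, TangentSpace (𝓡 m) w →L[ℝ] TangentSpace (𝓡 m) w) : Prop where
  smooth : ContMDiff (𝓘(ℝ, ℝ).prod (𝓡 m))
    ((𝓡 m).prod 𝓘(ℝ, EuclideanSpace ℝ (Fin m) →L[ℝ] EuclideanSpace ℝ (Fin m))) ∞
    (fun p : ℝ × M ↦
      TotalSpace.mk' (EuclideanSpace ℝ (Fin m) →L[ℝ] EuclideanSpace ℝ (Fin m))
        (E := fun w : M ↦ TangentSpace (𝓡 m) w →L[ℝ] TangentSpace (𝓡 m) w) p.2 (J p.1 p.2))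
  periodic : ∀ t, J (t + 1) = J t
  sq : ∀ t w v, J t w (J t w v) = -v
  symm : ∀ t w v v', extDerivOneForm (𝓡 m) lam w (J t w v) v' =
    extDerivOneForm (𝓡 m) lam w (J t w v') v
  pos : ∀ t w v, v ≠ 0 → 0 < extDerivOneForm (𝓡 m) lam w (J t w v) v

/-- The Rabinowitz action functional `𝔸_F (x, η) = ∫ x^* lam - η ∫ F (x t) dt`. -/
def action (lam : ∀ w : M, TangentSpace (𝓡 m) w →L[ℝ] ℝ) (F : M → ℝ) (x : ℝ → M) (η : ℝ) : ℝ :=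
  (∫ t in (0 : ℝ)..1, lam (x t) (velocity x t)) - η * ∫ t in (0 : ℝ)..1, F (x t)

/-- The first component `J_t (x) (x' - η X_F (x))` of the gradient of the Rabinowitz action
functional with respect to the product of the `L²` metric on loops induced by
`⟨v, w⟩_t = ω (J_t v, w)` and of the standard metric of `ℝ`. -/
def gradLoop (lam : ∀ w : M, TangentSpace (𝓡 m) w →L[ℝ] ℝ)
    (J : ℝ → ∀ w : M, TangentSpace (𝓡 m) w →L[ℝ] TangentSpace (𝓡 m) w)
    (F : M → ℝ) (x : ℝ → M) (η : ℝ) (t : ℝ) : TangentSpace (𝓡 m) (x t) :=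
  J t (x t) (velocity x t - η • hamiltonianVF lam F (x t))

/-- The second component `- ∫ F (x t) dt` of the gradient of the Rabinowitz action functional. -/
def gradReal (F : M → ℝ) (x : ℝ → M) : ℝ := -∫ t in (0 : ℝ)..1, F (x t)

/-- The squared norm `‖∇𝔸_F (x, η)‖²` of the gradient of the Rabinowitz action functional. -/
def gradNormSq (lam : ∀ w : M, TangentSpace (𝓡 m) w →L[ℝ] ℝ)
    (J : ℝ → ∀ w : M, TangentSpace (𝓡 m) w →L[ℝ] TangentSpace (𝓡 m) w)
    (F : M → ℝ) (x : ℝ → M) (η : ℝ) : ℝ :=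
  (∫ t in (0 : ℝ)..1, extDerivOneForm (𝓡 m) lam (x t)
    (J t (x t) (gradLoop lam J F x η t)) (gradLoop lam J F x η t)) + gradReal F x ^ 2

/-- A (smooth) solution `(u, η)`, `u : ℝ × ℝ/ℤ → M`, `η : ℝ → ℝ`, of the Rabinowitz-Floer equation
associated to the family of Hamiltonians `H s`. -/
structure IsRFSolution (lam : ∀ w : M, TangentSpace (𝓡 m) w →L[ℝ] ℝ)
    (J : ℝ → ∀ w : M, TangentSpace (𝓡 m) w →L[ℝ] TangentSpace (𝓡 m) w)
    (H : ℝ → M → ℝ) (u : ℝ → ℝ → M) (η : ℝ → ℝ) : Prop where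
  smooth_u : ContMDiff 𝓘(ℝ, ℝ × ℝ) (𝓡 m) ∞ (fun p : ℝ × ℝ ↦ u p.1 p.2)
  periodic_u : ∀ s t, u s (t + 1) = u s t
  smooth_η : ContDiff ℝ ∞ η
  eq_u : ∀ s t, velocity (fun σ ↦ u σ t) s +
    J t (u s t) (velocity (u s) t - η s • hamiltonianVF lam (H s) (u s t)) = 0
  eq_η : ∀ s, deriv η s = ∫ t in (0 : ℝ)..1, H s (u s t)

end Floer

section ContactType

variable {n : ℕ} [NeZero n] {W : Type*} [TopologicalSpace W]
  [ChartedSpace (EuclideanHalfSpace (2 * n)) W] [IsManifold (𝓡∂ (2 * n)) ∞ W]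
  [T2Space W] [CompactSpace W] [ConnectedSpace W] {D : LiouvilleDomain n W}
  {N : Type*} [TopologicalSpace N] [ChartedSpace (EuclideanSpace ℝ (Fin (2 * n - 1))) N]
  [IsManifold (𝓡 (2 * n - 1)) ∞ N]
  {What : Type*} [TopologicalSpace What] [ChartedSpace (EuclideanSpace ℝ (Fin (2 * n))) What]
  [IsManifold (𝓡 (2 * n)) ∞ What] [T2Space What]

/-- The coordinate `ρ` on the image of the symplectization `N × (0, ∞)` in the completion (the
values elsewhere are irrelevant). -/
def LiouvilleCompletion.radius (C : LiouvilleCompletion D N What) (w : What) : ℝ :=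
  (C.collar.symm w).2

/-- `J` is of contact type on `N × [ρ₀, ∞)`: there, `dρ ∘ J t = lam`. -/
def LiouvilleCompletion.IsContactType (C : LiouvilleCompletion D N What) (ρ₀ : ℝ)
    (J : ℝ → ∀ w : What, TangentSpace (𝓡 (2 * n)) w →L[ℝ] TangentSpace (𝓡 (2 * n)) w) : Prop :=
  ∀ (t : ℝ) (x : N) (ρ : ℝ), ρ₀ ≤ ρ → ∀ v : TangentSpace (𝓡 (2 * n)) (C.collar (x, ρ)),
    mfderiv (𝓡 (2 * n)) 𝓘(ℝ, ℝ) C.radius (C.collar (x, ρ)) (J t (C.collar (x, ρ)) v) =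
      C.lam (C.collar (x, ρ)) v

end ContactType

end RabinowitzFloer

end

noncomputable section

namespace RabinowitzFloer

/-! ### A mean value inequality on discs in the plane -/

section MeanValue

open intervalIntegral Real

/-! The difficulty is the absence of a maximum principle: a solution may reach far into the end,
where the growth of `h` is only polynomially controlled. The proof replaces the maximum principle by
a subsolution estimate for a power of the radius `r = ρ ∘ u`, fed by integral bounds that come from
the energy.

The multiplier is bounded first. If the gradient at time `s` is small, the Hamiltonian is nearly
constant along the loop and its mean is nearly zero, so the loop lies in a compact neighbourhood of
the zero levels, where λ(X_H) - H ≥ θ/2. Writing the action as ∫ λ(J ∂_s u) + η ∫ (λ(X_H) - H) then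
bounds η (`IsRFSolution.abs_multiplier_le`). Since the energy is finite, every time window of a
fixed length contains such a moment, and between two moments η moves by a controlled amount
(`exists_forall_abs_multiplier_le`).

On the end, dρ ∘ J = λ and Y = ρ ∂_ρ turn the equation into formulas for the two partial derivatives
of r. They give |∂r|² ≤ r e in each coordinate direction, where e = |∂_s u|², and Δr = e + η' r h' +
η r (∂_s h' + r_s h''), with h' the radial derivative (`planeLaplacian_radius`). Here η' is bounded
below because H is, h' ≥ 0, and the term with r_s is absorbed by e. Hence Δr is bounded below by
minus a polynomial in r.

Let q be a smoothed square root of r, constant away from the end (`LiouvilleCompletion.barrier`).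
Its gradient is square integrable on unit squares, because |∂√r|² ≤ e/4. It is itself square
integrable there, because q² is at most affine in H and the mean of H over a loop is η'. In
dimension two these bounds control all moments of q on unit squares, by iterating Ladyzhenskaya's
inequality (`exists_boxIntegral_pow_le`). Finally q⁸, a C² convex function of r, has Laplacian
bounded below by minus a power of q, so `mean_value_le` turns the moments into a pointwise bound on
q (`exists_forall_le_of_planeLaplacian`), hence on r. -/

theorem intervalIntegral_swap_of_continuous {F : ℝ → ℝ → ℝ} (hF : Continuous (Function.uncurry F))
    (a b c d : ℝ) : ∫ x in a..b, ∫ y in c..d, F x y = ∫ y in c..d, ∫ x in a..b, F x y := by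
  apply intervalIntegral_intervalIntegral_swap
  exact (hF.continuousOn.integrableOn_compact (isCompact_uIcc.prod isCompact_uIcc)).mono_set
    (prod_mono uIoc_subset_uIcc uIoc_subset_uIcc)

theorem continuous_intervalIntegral_of_continuous {F : ℝ → ℝ → ℝ}
    (hF : Continuous (Function.uncurry F)) (a b : ℝ) :
    Continuous fun x ↦ ∫ y in a..b, F x y :=
  intervalIntegral.continuous_parametric_intervalIntegral_of_continuous' hF a b

/-- The unit vector of angle `θ`. -/
def circleVec (θ : ℝ) : ℝ × ℝ := (cos θ, sin θ)

/-- The derivative of `circleVec`. -/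
def circleTan (θ : ℝ) : ℝ × ℝ := (-sin θ, cos θ)

theorem hasDerivAt_circleVec (θ : ℝ) : HasDerivAt circleVec (circleTan θ) θ :=
  (hasDerivAt_cos θ).prodMk (hasDerivAt_sin θ)

theorem hasDerivAt_circleTan (θ : ℝ) : HasDerivAt circleTan (-circleVec θ) θ := by
  have := (hasDerivAt_sin θ).neg.prodMk (hasDerivAt_cos θ)
  exact this

@[fun_prop]
theorem continuous_circleVec : Continuous circleVec := by unfold circleVec; fun_prop

@[fun_prop]
theorem continuous_circleTan : Continuous circleTan := by unfold circleTan; fun_prop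

/-- The Laplacian of a function on the plane. -/
def planeLaplacian (f : ℝ × ℝ → ℝ) (p : ℝ × ℝ) : ℝ :=
  fderiv ℝ (fderiv ℝ f) p (1, 0) (1, 0) + fderiv ℝ (fderiv ℝ f) p (0, 1) (0, 1)

/-- The trace of a bilinear form is the same in every orthonormal frame, in particular in the
rotating frame of polar coordinates. -/
theorem bilin_circleVec_add_circleTan (B : ℝ × ℝ →L[ℝ] ℝ × ℝ →L[ℝ] ℝ) (θ : ℝ) :
    B (circleVec θ) (circleVec θ) + B (circleTan θ) (circleTan θ) =
      B (1, 0) (1, 0) + B (0, 1) (0, 1) := by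
  have h1 : circleVec θ = cos θ • ((1, 0) : ℝ × ℝ) + sin θ • ((0, 1) : ℝ × ℝ) := by
    simp [circleVec]
  have h2 : circleTan θ = (-sin θ) • ((1, 0) : ℝ × ℝ) + cos θ • ((0, 1) : ℝ × ℝ) := by
    simp [circleTan]
  rw [h1, h2]
  simp only [map_add, map_smul, add_apply, smul_apply, smul_eq_mul]
  linear_combination (B (1, 0) (1, 0) + B (0, 1) (0, 1)) * (sin_sq_add_cos_sq θ)

variable {f : ℝ × ℝ → ℝ}

/-- The divergence theorem on a disc, done by hand in polar coordinates: `e1` is the fundamental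
theorem of calculus for σ ∂_σ f along a ray, and `e2` is the vanishing of the integral of an angular
derivative over a full turn. Their difference contains exactly the trace of the Hessian. -/
theorem radial_deriv_integral (hf : ContDiff ℝ 2 f) (p : ℝ × ℝ) (r : ℝ) :
    r * ∫ θ in (-π)..π, fderiv ℝ f (p + r • circleVec θ) (circleVec θ) =
      ∫ σ in (0 : ℝ)..r, ∫ θ in (-π)..π, σ * planeLaplacian f (p + σ • circleVec θ) := by
  have hD : ContDiff ℝ 1 (fderiv ℝ f) := hf.fderiv_right (by norm_num)
  have hD0 : Continuous (fderiv ℝ f) := hD.continuous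
  have hDD : Continuous (fderiv ℝ (fderiv ℝ f)) := hD.continuous_fderiv (by norm_num)
  have hDx : ∀ x, HasFDerivAt (fderiv ℝ f) (fderiv ℝ (fderiv ℝ f) x) x := fun x ↦
    (hD.differentiable (by norm_num) x).hasFDerivAt
  have e1 : ∀ θ, r * fderiv ℝ f (p + r • circleVec θ) (circleVec θ) =
      ∫ σ in (0 : ℝ)..r, (fderiv ℝ f (p + σ • circleVec θ) (circleVec θ) +
        σ * fderiv ℝ (fderiv ℝ f) (p + σ • circleVec θ) (circleVec θ) (circleVec θ)) := by
    intro θ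
    rw [integral_eq_sub_of_hasDerivAt
      (f := fun σ ↦ σ * fderiv ℝ f (p + σ • circleVec θ) (circleVec θ))]
    · simp
    · intro σ _
      have h1 : HasDerivAt (fun σ : ℝ ↦ p + σ • circleVec θ) (circleVec θ) σ := by
        simpa using ((hasDerivAt_id σ).smul_const (circleVec θ)).const_add p
      have h2 := ((hDx _).comp_hasDerivAt σ h1).clm_apply (hasDerivAt_const σ (circleVec θ))
      have h3 := (hasDerivAt_id σ).mul h2
      exact h3.congr_deriv (by simp)
    · apply Continuous.intervalIntegrable
      fun_prop
  have e2 : ∀ σ, ∫ θ in (-π)..π, (fderiv ℝ f (p + σ • circleVec θ) (circleVec θ) -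
        σ * fderiv ℝ (fderiv ℝ f) (p + σ • circleVec θ) (circleTan θ) (circleTan θ)) = 0 := by
    intro σ
    rw [integral_eq_sub_of_hasDerivAt
      (f := fun θ ↦ - fderiv ℝ f (p + σ • circleVec θ) (circleTan θ))]
    · simp [circleVec, circleTan]
    · intro θ _
      have h1 : HasDerivAt (fun θ : ℝ ↦ p + σ • circleVec θ) (σ • circleTan θ) θ :=
        ((hasDerivAt_circleVec θ).const_smul σ).const_add p
      have h2 := (((hDx _).comp_hasDerivAt θ h1).clm_apply (hasDerivAt_circleTan θ)).neg
      exact h2.congr_deriv (by simp; ring)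
    · apply Continuous.intervalIntegrable
      fun_prop
  rw [← intervalIntegral.integral_const_mul]
  simp_rw [e1]
  rw [intervalIntegral_swap_of_continuous (by fun_prop)]
  congr 1
  ext σ
  have : ∀ θ, σ * planeLaplacian f (p + σ • circleVec θ) =
      (fderiv ℝ f (p + σ • circleVec θ) (circleVec θ) +
        σ * fderiv ℝ (fderiv ℝ f) (p + σ • circleVec θ) (circleVec θ) (circleVec θ)) -
      (fderiv ℝ f (p + σ • circleVec θ) (circleVec θ) -
        σ * fderiv ℝ (fderiv ℝ f) (p + σ • circleVec θ) (circleTan θ) (circleTan θ)) := by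
    intro θ
    rw [planeLaplacian, ← bilin_circleVec_add_circleTan _ θ]
    ring
  simp_rw [this]
  rw [intervalIntegral.integral_sub, e2, sub_zero] <;>
  · apply Continuous.intervalIntegrable
    fun_prop

theorem continuous_planeLaplacian (hf : ContDiff ℝ 2 f) : Continuous (planeLaplacian f) := by
  have hD : ContDiff ℝ 1 (fderiv ℝ f) := hf.fderiv_right (by norm_num)
  have hDD : Continuous (fderiv ℝ (fderiv ℝ f)) := hD.continuous_fderiv (by norm_num)
  unfold planeLaplacian
  fun_prop

/-- A mean value inequality for functions with Laplacian bounded from below by a square integrable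
function. -/
theorem mean_value_le (hf : ContDiff ℝ 2 f) {F : ℝ × ℝ → ℝ} (hF : Continuous F)
    (hfF : ∀ x, -F x ≤ planeLaplacian f x) (p : ℝ × ℝ) :
    π * f p ≤ (∫ r in (0 : ℝ)..1, ∫ θ in (-π)..π, r * f (p + r • circleVec θ)) +
      (π + ∫ r in (0 : ℝ)..1, ∫ θ in (-π)..π, r * F (p + r • circleVec θ) ^ 2) / 4 := by
  set I := ∫ r in (0 : ℝ)..1, ∫ θ in (-π)..π, r * F (p + r • circleVec θ) ^ 2 with hI
  have hD : ContDiff ℝ 1 (fderiv ℝ f) := hf.fderiv_right (by norm_num)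
  have hD0 : Continuous (fderiv ℝ f) := hD.continuous
  have hf0 : Continuous f := hf.continuous
  have hL := continuous_planeLaplacian hf
  have hπ : -π ≤ π := by linarith [pi_pos]
  set m1 : ℝ → ℝ := fun r ↦ ∫ θ in (-π)..π, fderiv ℝ f (p + r • circleVec θ) (circleVec θ)
    with hm1
  have hcI : Continuous fun r ↦ ∫ θ in (-π)..π, r * F (p + r • circleVec θ) ^ 2 :=
    continuous_intervalIntegral_of_continuous (by fun_prop) _ _
  have step : ∀ r, 0 < r → r ≤ 1 → -((π + I) / 2) ≤ m1 r := by
    intro r hr hr1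
    have h1 : r * m1 r = _ := radial_deriv_integral hf p r
    have h2 : ∫ σ in (0 : ℝ)..r, ∫ θ in (-π)..π,
        (-(1 / 2)) * (σ * r⁻¹ + r * (σ * F (p + σ • circleVec θ) ^ 2)) ≤ r * m1 r := by
      rw [h1]
      refine integral_mono_on hr.le ?_ ?_ fun σ hσ ↦ ?_
      · exact (continuous_intervalIntegral_of_continuous (by fun_prop) _ _).intervalIntegrable _ _
      · exact (continuous_intervalIntegral_of_continuous (by fun_prop) _ _).intervalIntegrable _ _
      refine integral_mono_on hπ ?_ ?_ fun θ _ ↦ ?_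
      · exact Continuous.intervalIntegrable (by fun_prop) _ _
      · exact Continuous.intervalIntegrable (by fun_prop) _ _
      have h3 := hfF (p + σ • circleVec θ)
      set y := F (p + σ • circleVec θ)
      -- Young's inequality with weight r. Integrated over the disc of radius r, the constant part
      -- gives π r and the square part at most r I, so both carry the factor r of `r * m1 r` and the
      -- bound on `m1 r` is uniform as r tends to 0.
      have h4 : y ≤ (r⁻¹ + r * y ^ 2) / 2 := by
        have : 0 ≤ r⁻¹ * (1 - r * y) ^ 2 := by positivity
        have h5 : r⁻¹ * (1 - r * y) ^ 2 = r⁻¹ - 2 * y + r * y ^ 2 := by field_simp; ring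
        linarith
      have := mul_le_mul_of_nonneg_left (h3.trans' (neg_le_neg h4)) hσ.1
      linarith
    have h6 : ∫ σ in (0 : ℝ)..r, ∫ θ in (-π)..π,
        (-(1 / 2)) * (σ * r⁻¹ + r * (σ * F (p + σ • circleVec θ) ^ 2)) =
        (-(1 / 2)) * (π * r + r * ∫ σ in (0 : ℝ)..r, ∫ θ in (-π)..π,
          σ * F (p + σ • circleVec θ) ^ 2) := by
      have : ∀ σ, ∫ θ in (-π)..π,
        (-(1 / 2)) * (σ * r⁻¹ + r * (σ * F (p + σ • circleVec θ) ^ 2)) =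
        (-(1 / 2)) * (2 * π * r⁻¹ * σ + r * ∫ θ in (-π)..π,
          σ * F (p + σ • circleVec θ) ^ 2) := by
        intro σ
        rw [intervalIntegral.integral_const_mul, intervalIntegral.integral_add,
          intervalIntegral.integral_const_mul (r : ℝ)]
        · simp only [intervalIntegral.integral_const, smul_eq_mul]
          ring
        · exact Continuous.intervalIntegrable (by fun_prop) _ _
        · exact Continuous.intervalIntegrable (by fun_prop) _ _
      simp_rw [this]
      rw [intervalIntegral.integral_const_mul, intervalIntegral.integral_add,
          intervalIntegral.integral_const_mul, intervalIntegral.integral_const_mul, integral_id]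
      · field_simp
        ring
      · exact Continuous.intervalIntegrable (by fun_prop) _ _
      · exact (hcI.const_mul r).intervalIntegrable _ _
    have h7 : ∫ σ in (0 : ℝ)..r, ∫ θ in (-π)..π, σ * F (p + σ • circleVec θ) ^ 2 ≤ I := by
      rw [hI, ← integral_add_adjacent_intervals (hcI.intervalIntegrable 0 r)
        (hcI.intervalIntegrable r 1)]
      have : 0 ≤ ∫ σ in r..1, ∫ θ in (-π)..π, σ * F (p + σ • circleVec θ) ^ 2 := by
        refine intervalIntegral.integral_nonneg hr1 fun σ hσ ↦ ?_
        refine intervalIntegral.integral_nonneg hπ fun θ _ ↦ ?_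
        have : 0 ≤ σ := hr.le.trans hσ.1
        positivity
      linarith
    rw [h6] at h2
    have h8 := mul_le_mul_of_nonneg_left h7 hr.le
    have : r * (-((π + I) / 2)) ≤ r * m1 r := by linarith
    exact le_of_mul_le_mul_left this hr
  have hm1c : Continuous m1 := continuous_intervalIntegral_of_continuous (by fun_prop) _ _
  -- `m1` is the radial derivative of the integral of f over circles, so its lower bound compares
  -- the circle of radius R with the centre.
  have hdiff : ∀ R, 0 ≤ R → R ≤ 1 →
      2 * π * f p ≤ (∫ θ in (-π)..π, f (p + R • circleVec θ)) + (π + I) / 2 * R := by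
    intro R hR hR1
    have h1 : ∫ r in (0 : ℝ)..R, m1 r = (∫ θ in (-π)..π, f (p + R • circleVec θ)) -
        2 * π * f p := by
      rw [hm1, intervalIntegral_swap_of_continuous (by fun_prop)]
      have : ∀ θ, ∫ r in (0 : ℝ)..R, fderiv ℝ f (p + r • circleVec θ) (circleVec θ) =
          f (p + R • circleVec θ) - f p := by
        intro θ
        rw [integral_eq_sub_of_hasDerivAt (f := fun r : ℝ ↦ f (p + r • circleVec θ))]
        · simp
        · intro r _
          have h1 : HasDerivAt (fun σ : ℝ ↦ p + σ • circleVec θ) (circleVec θ) r := by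
            simpa using ((hasDerivAt_id r).smul_const (circleVec θ)).const_add p
          exact ((hf.differentiable (by norm_num) _).hasFDerivAt).comp_hasDerivAt r h1
        · exact Continuous.intervalIntegrable (by fun_prop) _ _
      simp_rw [this]
      rw [intervalIntegral.integral_sub]
      · simp only [intervalIntegral.integral_const, smul_eq_mul]
        ring
      · exact Continuous.intervalIntegrable (by fun_prop) _ _
      · exact Continuous.intervalIntegrable (by fun_prop) _ _
    have h2 : ∫ r in (0 : ℝ)..R, -((π + I) / 2) ≤ ∫ r in (0 : ℝ)..R, m1 r := by
      refine integral_mono_on_of_le_Ioo hR (by simp) (hm1c.intervalIntegrable _ _) fun r hr ↦ ?_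
      exact step r hr.1 (hr.2.le.trans hR1)
    rw [h1] at h2
    simp only [intervalIntegral.integral_const, smul_eq_mul, sub_zero] at h2
    linarith
  have hI0 : 0 ≤ (π + I) / 2 := by
    have : 0 ≤ I := by
      refine intervalIntegral.integral_nonneg zero_le_one fun σ hσ ↦ ?_
      refine intervalIntegral.integral_nonneg hπ fun θ _ ↦ ?_
      have : 0 ≤ σ := hσ.1
      positivity
    have := pi_pos
    positivity
  -- Weighting by r and integrating over the radii turns the circle estimates into one over the unit
  -- disc, which can be compared with integrals over squares.
  have hfin : ∫ r in (0 : ℝ)..1, r * (2 * π * f p) ≤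
      ∫ r in (0 : ℝ)..1, ((∫ θ in (-π)..π, r * f (p + r • circleVec θ)) + (π + I) / 2 * r) := by
    refine integral_mono_on zero_le_one ?_ ?_ fun r hr ↦ ?_
    · exact Continuous.intervalIntegrable (by fun_prop) _ _
    · exact ((continuous_intervalIntegral_of_continuous (by fun_prop) _ _).add
        (by fun_prop)).intervalIntegrable _ _
    · rw [intervalIntegral.integral_const_mul]
      have h1 := mul_le_mul_of_nonneg_left (hdiff r hr.1 hr.2) hr.1
      have h2 : r * ((π + I) / 2 * r) ≤ (π + I) / 2 * r := by
        have := mul_nonneg hI0 hr.1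
        nlinarith [hr.2]
      linarith
  rw [intervalIntegral.integral_mul_const, integral_id, intervalIntegral.integral_add,
    intervalIntegral.integral_const_mul, integral_id] at hfin
  · linarith
  · exact (continuous_intervalIntegral_of_continuous (by fun_prop) _ _).intervalIntegrable _ _
  · exact Continuous.intervalIntegrable (by fun_prop) _ _

/-- The integral in polar coordinates over a disc is bounded by the integral over a square. -/
theorem polar_integral_le {g : ℝ × ℝ → ℝ} (hg : Continuous g) (hg0 : ∀ x, 0 ≤ g x) (p : ℝ × ℝ) :
    ∫ r in (0 : ℝ)..1, ∫ θ in (-π)..π, r * g (p + r • circleVec θ) ≤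
      ∫ x in (p.1 - 1)..(p.1 + 1), ∫ y in (p.2 - 1)..(p.2 + 1), g (x, y) := by
  set B : Set (ℝ × ℝ) := Icc (-1) 1 ×ˢ Icc (-1) 1 with hB
  have hBc : IsCompact B := isCompact_Icc.prod isCompact_Icc
  have hmap := integral_comp_polarCoord_symm (B.indicator fun x ↦ g (p + x))
  have hR : ∫ x, (B.indicator fun x ↦ g (p + x)) x =
      ∫ x in (p.1 - 1)..(p.1 + 1), ∫ y in (p.2 - 1)..(p.2 + 1), g (x, y) := by
    rw [MeasureTheory.integral_indicator hBc.measurableSet, hB, Measure.volume_eq_prod,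
      setIntegral_prod]
    · rw [integral_Icc_eq_integral_Ioc, ← intervalIntegral.integral_of_le (by norm_num)]
      have : ∀ x : ℝ, ∫ y in Icc (-1 : ℝ) 1, g (p + (x, y)) =
          ∫ y in (p.2 - 1)..(p.2 + 1), g (p.1 + x, y) := by
        intro x
        rw [integral_Icc_eq_integral_Ioc, ← intervalIntegral.integral_of_le (by norm_num)]
        have := intervalIntegral.integral_comp_add_left (a := (-1 : ℝ)) (b := 1)
          (fun y ↦ g (p.1 + x, y)) p.2
        rw [← sub_eq_add_neg] at this
        rw [← this]
        rfl
      simp_rw [this]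
      have := intervalIntegral.integral_comp_add_left (a := (-1 : ℝ)) (b := 1)
          (fun x ↦ ∫ y in (p.2 - 1)..(p.2 + 1), g (x, y)) p.1
      rw [← sub_eq_add_neg] at this
      exact this
    · exact (by fun_prop : Continuous fun x ↦ g (p + x)).continuousOn.integrableOn_compact hBc
  rw [← hR, ← hmap]
  set S : Set (ℝ × ℝ) := Ioc 0 1 ×ˢ Ioo (-π) π with hS
  have hST : S ⊆ polarCoord.target := by
    rw [polarCoord_target]
    exact prod_mono (fun x hx ↦ hx.1) le_rfl
  have hπ : -π ≤ π := by linarith [pi_pos]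
  have hcont : Continuous fun q : ℝ × ℝ ↦ q.1 * g (p + q.1 • circleVec q.2) := by fun_prop
  have hSint : IntegrableOn (fun q : ℝ × ℝ ↦ q.1 * g (p + q.1 • circleVec q.2)) S :=
    (hcont.continuousOn.integrableOn_compact
      ((isCompact_Icc (a := (0 : ℝ)) (b := 1)).prod (isCompact_Icc (a := -π) (b := π)))).mono_set
      (prod_mono Ioc_subset_Icc_self Ioo_subset_Icc_self)
  have hL : ∫ r in (0 : ℝ)..1, ∫ θ in (-π)..π, r * g (p + r • circleVec θ) =
      ∫ q in S, q.1 * g (p + q.1 • circleVec q.2) := by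
    rw [hS, Measure.volume_eq_prod, setIntegral_prod _ hSint,
      ← intervalIntegral.integral_of_le zero_le_one]
    congr 1
    ext r
    rw [← integral_Ioc_eq_integral_Ioo, ← intervalIntegral.integral_of_le hπ]
  have hmem : ∀ q : ℝ × ℝ, 0 ≤ q.1 → q.1 ≤ 1 → polarCoord.symm q ∈ B := by
    intro q h0 h1
    simp only [polarCoord_symm_apply, hB, mem_prod, mem_Icc, ← abs_le, abs_mul, abs_of_nonneg h0]
    exact ⟨mul_le_one₀ h1 (abs_nonneg _) (abs_cos_le_one _),
      mul_le_one₀ h1 (abs_nonneg _) (abs_sin_le_one _)⟩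
  have hS2 : ∫ q in S, q.1 * g (p + q.1 • circleVec q.2) =
      ∫ q in S, q.1 • (B.indicator fun x ↦ g (p + x)) (polarCoord.symm q) := by
    refine setIntegral_congr_fun (measurableSet_Ioc.prod measurableSet_Ioo) fun q hq ↦ ?_
    simp only [indicator_of_mem (hmem q hq.1.1.le hq.1.2), smul_eq_mul]
    congr 3
  rw [hL, hS2]
  refine setIntegral_mono_set ?_ ?_ hST.eventuallyLE
  -- Integrability is required on the whole unbounded target of `polarCoord`. The square lies in the
  -- disc of radius √2, so the integrand vanishes for r > 2 and a compact rectangle suffices.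
  · have hbig : IntegrableOn (fun q : ℝ × ℝ ↦ q.1 * g (p + q.1 • circleVec q.2))
        (Icc 0 2 ×ˢ Icc (-π) π) :=
      hcont.continuousOn.integrableOn_compact (isCompact_Icc.prod isCompact_Icc)
    have hsymm : Continuous fun q : ℝ × ℝ ↦ polarCoord.symm q := by
      simp only [polarCoord_symm_apply]; fun_prop
    set T : Set (ℝ × ℝ) := (fun q : ℝ × ℝ ↦ polarCoord.symm q) ⁻¹' B with hT
    have hTm : MeasurableSet T := hsymm.measurable hBc.measurableSet
    have e : (fun q : ℝ × ℝ ↦ q.1 • (B.indicator fun x ↦ g (p + x)) (polarCoord.symm q)) =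
        T.indicator fun q ↦ q.1 * g (p + q.1 • circleVec q.2) := by
      ext q
      by_cases hq : q ∈ T
      · rw [indicator_of_mem hq, indicator_of_mem (show polarCoord.symm q ∈ B from hq)]
        rfl
      · rw [indicator_of_notMem hq, indicator_of_notMem (show polarCoord.symm q ∉ B from hq),
          smul_zero]
    rw [e, integrableOn_indicator_iff hTm]
    refine hbig.mono_set ?_
    rintro ⟨r, θ⟩ ⟨hqT, hq⟩
    rw [polarCoord_target] at hq
    refine ⟨⟨hq.1.le, ?_⟩, hq.2.1.le, hq.2.2.le⟩
    have h1 : polarCoord.symm (r, θ) ∈ B := hqT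
    simp only [polarCoord_symm_apply, hB, mem_prod, mem_Icc, ← abs_le] at h1
    have h2 := sq_le_one_iff_abs_le_one _ |>.2 h1.1
    have h3 := sq_le_one_iff_abs_le_one _ |>.2 h1.2
    have h4 : r ^ 2 ≤ 2 := by
      have := sin_sq_add_cos_sq θ
      calc r ^ 2 = r ^ 2 * (sin θ ^ 2 + cos θ ^ 2) := by rw [this, mul_one]
        _ ≤ 2 := by linarith
    show r ≤ 2
    nlinarith
  · refine (ae_restrict_iff' polarCoord.open_target.measurableSet).2 (ae_of_all _ fun q hq ↦ ?_)
    rw [polarCoord_target] at hq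
    refine mul_nonneg (le_of_lt hq.1) (indicator_nonneg (fun x _ ↦ hg0 _) _)

end MeanValue

/-! ### Moment bounds on unit squares and the resulting pointwise bound -/

section BoxIntegrals

/-- The integral over the unit square with lower left corner `(a, b)`. -/
def boxIntegral (g : ℝ × ℝ → ℝ) (a b : ℝ) : ℝ := ∫ s in a..(a + 1), ∫ t in b..(b + 1), g (s, t)

variable {g g' : ℝ × ℝ → ℝ} {a b : ℝ}

theorem intervalIntegrable_inner (hg : Continuous g) (a b c d : ℝ) :
    IntervalIntegrable (fun s ↦ ∫ t in c..d, g (s, t)) volume a b :=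
  (continuous_intervalIntegral_of_continuous (F := fun s t ↦ g (s, t)) hg c d).intervalIntegrable _ _

theorem boxIntegral_mono (hg : Continuous g) (hg' : Continuous g') (h : ∀ p, g p ≤ g' p) :
    boxIntegral g a b ≤ boxIntegral g' a b := by
  refine intervalIntegral.integral_mono_on (by linarith) (intervalIntegrable_inner hg _ _ _ _)
    (intervalIntegrable_inner hg' _ _ _ _) fun s _ ↦ ?_
  refine intervalIntegral.integral_mono_on (by linarith) ?_ ?_ fun t _ ↦ h _
  · exact Continuous.intervalIntegrable (by fun_prop) _ _
  · exact Continuous.intervalIntegrable (by fun_prop) _ _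

theorem boxIntegral_add (hg : Continuous g) (hg' : Continuous g') :
    boxIntegral (fun p ↦ g p + g' p) a b = boxIntegral g a b + boxIntegral g' a b := by
  unfold boxIntegral
  rw [← intervalIntegral.integral_add (intervalIntegrable_inner hg _ _ _ _)
    (intervalIntegrable_inner hg' _ _ _ _)]
  congr 1
  ext s
  rw [intervalIntegral.integral_add]
  · exact Continuous.intervalIntegrable (by fun_prop) _ _
  · exact Continuous.intervalIntegrable (by fun_prop) _ _

theorem boxIntegral_const_mul (c : ℝ) :
    boxIntegral (fun p ↦ c * g p) a b = c * boxIntegral g a b := by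
  simp [boxIntegral, intervalIntegral.integral_const_mul]

theorem boxIntegral_nonneg (h : ∀ p, 0 ≤ g p) : 0 ≤ boxIntegral g a b :=
  intervalIntegral.integral_nonneg (by linarith) fun _ _ ↦
    intervalIntegral.integral_nonneg (by linarith) fun _ _ ↦ h _

/-- The one-dimensional Sobolev inequality on a unit interval: φ exceeds its mean by at most its
total variation. -/
theorem le_integral_abs_deriv_add {φ φ' : ℝ → ℝ} (hφ : ∀ x, HasDerivAt φ (φ' x) x)
    (hφ' : Continuous φ') {x : ℝ} (hx : x ∈ Icc a (a + 1)) :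
    φ x ≤ ∫ y in a..(a + 1), (|φ' y| + φ y) := by
  have hc : Continuous φ := continuous_iff_continuousAt.2 fun y ↦ (hφ y).continuousAt
  have hle : a ≤ a + 1 := by linarith
  have key : ∀ y ∈ Icc a (a + 1), φ x - (∫ z in a..(a + 1), |φ' z|) ≤ φ y := by
    intro y hy
    have h1 : ∫ z in y..x, φ' z = φ x - φ y :=
      intervalIntegral.integral_eq_sub_of_hasDerivAt (fun z _ ↦ hφ z)
        (hφ'.intervalIntegrable _ _)
    have h2 : |∫ z in y..x, φ' z| ≤ ∫ z in a..(a + 1), |φ' z| := by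
      refine (intervalIntegral.norm_integral_le_integral_norm_uIoc (f := φ')).trans ?_
      simp only [Real.norm_eq_abs]
      rw [intervalIntegral.integral_of_le hle]
      refine setIntegral_mono_set ?_ (ae_of_all _ fun z ↦ abs_nonneg _) ?_
      · exact (hφ'.abs.continuousOn.integrableOn_compact isCompact_Icc).mono_set Ioc_subset_Icc_self
      · exact LE.le.eventuallyLE (Ioc_subset_Ioc (le_min hy.1 hx.1) (max_le hy.2 hx.2))
    have := le_abs_self (∫ z in y..x, φ' z)
    linarith
  have h3 := intervalIntegral.integral_mono_on hle
    (_root_.intervalIntegrable_const (μ := volume)) (hc.intervalIntegrable _ _) key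
  simp only [intervalIntegral.integral_const, add_sub_cancel_left, one_smul] at h3
  rw [intervalIntegral.integral_add (hφ'.abs.intervalIntegrable _ _) (hc.intervalIntegrable _ _)]
  linarith

/-- Ladyzhenskaya's inequality on a unit square. -/
theorem boxIntegral_sq_le (hg : ContDiff ℝ 1 g) (hg0 : ∀ p, 0 ≤ g p) (a b : ℝ) :
    boxIntegral (fun p ↦ g p ^ 2) a b ≤
      boxIntegral (fun p ↦ |fderiv ℝ g p (1, 0)| + g p) a b *
        boxIntegral (fun p ↦ |fderiv ℝ g p (0, 1)| + g p) a b := by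
  have hD : Continuous (fderiv ℝ g) := hg.continuous_fderiv (by norm_num)
  have hc : Continuous g := hg.continuous
  have hgx : ∀ p, HasFDerivAt g (fderiv ℝ g p) p := fun p ↦
    (hg.differentiable (by norm_num) p).hasFDerivAt
  set α : ℝ → ℝ := fun s ↦ ∫ t in b..(b + 1), (|fderiv ℝ g (s, t) (0, 1)| + g (s, t)) with hα
  set β : ℝ → ℝ := fun t ↦ ∫ s in a..(a + 1), (|fderiv ℝ g (s, t) (1, 0)| + g (s, t)) with hβ
  have hαc : Continuous α := continuous_intervalIntegral_of_continuous (by fun_prop) _ _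
  have hβc : Continuous β := continuous_intervalIntegral_of_continuous (by fun_prop) _ _
  have h1 : ∀ s t, t ∈ Icc b (b + 1) → g (s, t) ≤ α s := by
    intro s t ht
    refine le_integral_abs_deriv_add (φ := fun t ↦ g (s, t)) (fun y ↦ ?_) (by fun_prop) ht
    exact (hgx (s, y)).comp_hasDerivAt y ((hasDerivAt_const y s).prodMk (hasDerivAt_id y))
  have h2 : ∀ s t, s ∈ Icc a (a + 1) → g (s, t) ≤ β t := by
    intro s t hs
    refine le_integral_abs_deriv_add (φ := fun s ↦ g (s, t)) (fun y ↦ ?_) (by fun_prop) hs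
    exact (hgx (y, t)).comp_hasDerivAt y ((hasDerivAt_id y).prodMk (hasDerivAt_const y t))
  -- Bounding one factor of g² along the vertical line by α(s) and the other along the horizontal
  -- line by β(t) gives a majorant whose double integral is a product.
  have h3 : boxIntegral (fun p ↦ g p ^ 2) a b ≤
      ∫ s in a..(a + 1), ∫ t in b..(b + 1), α s * β t := by
    refine intervalIntegral.integral_mono_on (by linarith)
      (intervalIntegrable_inner (g := fun p ↦ g p ^ 2) (by fun_prop) _ _ _ _)
      (intervalIntegrable_inner (g := fun p ↦ α p.1 * β p.2) (by fun_prop) _ _ _ _) fun s hs ↦ ?_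
    refine intervalIntegral.integral_mono_on (by linarith)
      (Continuous.intervalIntegrable (by fun_prop) _ _)
      (Continuous.intervalIntegrable (by fun_prop) _ _) fun t ht ↦ ?_
    simp only [pow_two]
    exact mul_le_mul (h1 s t ht) (h2 s t hs) (hg0 _) ((hg0 _).trans (h1 s t ht))
  refine h3.trans_eq ?_
  simp_rw [intervalIntegral.integral_const_mul, intervalIntegral.integral_mul_const]
  rw [mul_comm]
  congr 1
  simp only [hβ, boxIntegral]
  rw [intervalIntegral_swap_of_continuous]
  fun_prop

/-- Uniform bounds of all moments on unit squares, for functions with gradient bounded in `L²`. -/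
theorem exists_boxIntegral_pow_le (C : ℝ) (k : ℕ) : ∃ B : ℝ, ∀ q e : ℝ × ℝ → ℝ,
    ContDiff ℝ 1 q → Continuous e → (∀ p, 1 ≤ q p) →
    (∀ p, fderiv ℝ q p (1, 0) ^ 2 ≤ e p) → (∀ p, fderiv ℝ q p (0, 1) ^ 2 ≤ e p) →
    (∀ a b, boxIntegral e a b ≤ C) → (∀ a b, boxIntegral (fun p ↦ q p ^ 2) a b ≤ C) →
    ∀ a b, boxIntegral (fun p ↦ q p ^ (2 * k)) a b ≤ B := by
  rcases k with _ | k
  -- Exponent 0 is treated apart; the induction starts from the square, which is the given L² bound.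
  · exact ⟨1, fun q e _ _ _ _ _ _ _ a b ↦ by simp [boxIntegral]⟩
  induction k with
  | zero => exact ⟨C, fun q e _ _ _ _ _ _ h a b ↦ by simpa using h a b⟩
  | succ k ih =>
    obtain ⟨B, hB⟩ := ih
    -- Ladyzhenskaya's inequality applied to q^(k+2). Its partial derivatives are (k+2) q^(k+1) ∂q,
    -- at most (k+2)/2 (q^(2(k+1)) + e) in absolute value, so the previous moment and the energy
    -- bound each of the two factors.
    refine ⟨(((k : ℝ) + 2) / 2 * (B + C) + B) ^ 2, fun q e hq he hq1 hs ht hE hQ a b ↦ ?_⟩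
    have hb := hB q e hq he hq1 hs ht hE hQ a b
    have hqc : Continuous q := hq.continuous
    have hq0 : ∀ p, 0 < q p := fun p ↦ one_pos.trans_le (hq1 p)
    have hg : ContDiff ℝ 1 fun p ↦ q p ^ (k + 2) := hq.pow _
    have hgD : Continuous (fderiv ℝ fun p ↦ q p ^ (k + 2)) :=
      hg.continuous_fderiv (by norm_num)
    have hder : ∀ p v, fderiv ℝ q p v ^ 2 ≤ e p →
        |fderiv ℝ (fun p ↦ q p ^ (k + 2)) p v| + q p ^ (k + 2) ≤
          ((k : ℝ) + 2) / 2 * (q p ^ (2 * (k + 1)) + e p) + q p ^ (2 * (k + 1)) := by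
      intro p v hv
      have h1 : fderiv ℝ (fun p ↦ q p ^ (k + 2)) p v =
          ((k : ℝ) + 2) * (q p ^ (k + 1) * fderiv ℝ q p v) := by
        have := ((hq.differentiable (by norm_num) p).hasFDerivAt.pow (k + 2)).fderiv
        rw [this]
        simp
        ring
      -- Since q ≥ 1, the zeroth order term is also absorbed by the previous moment.
      have h2 : q p ^ (k + 2) ≤ q p ^ (2 * (k + 1)) := pow_le_pow_right₀ (hq1 p) (by lia)
      have h3 : |q p ^ (k + 1) * fderiv ℝ q p v| ≤ (q p ^ (2 * (k + 1)) + e p) / 2 := by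
        have h4 : q p ^ (2 * (k + 1)) = (q p ^ (k + 1)) ^ 2 := by ring
        rw [h4, abs_le]
        constructor <;> nlinarith [sq_nonneg (q p ^ (k + 1) + fderiv ℝ q p v),
          sq_nonneg (q p ^ (k + 1) - fderiv ℝ q p v)]
      rw [h1, abs_mul, abs_of_nonneg (by positivity : (0 : ℝ) ≤ (k : ℝ) + 2)]
      have := mul_le_mul_of_nonneg_left h3 (by positivity : (0 : ℝ) ≤ (k : ℝ) + 2)
      linarith
    have hbound : ∀ v : ℝ × ℝ, (∀ p, fderiv ℝ q p v ^ 2 ≤ e p) →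
        boxIntegral (fun p ↦ |fderiv ℝ (fun p ↦ q p ^ (k + 2)) p v| + q p ^ (k + 2)) a b ≤
          ((k : ℝ) + 2) / 2 * (B + C) + B := by
      intro v hv
      refine (boxIntegral_mono (by fun_prop) (by fun_prop) fun p ↦ hder p v (hv p)).trans ?_
      rw [boxIntegral_add (by fun_prop) (by fun_prop), boxIntegral_const_mul,
        boxIntegral_add (by fun_prop) (by fun_prop)]
      have := mul_le_mul_of_nonneg_left (add_le_add hb (hE a b))
        (by positivity : (0 : ℝ) ≤ ((k : ℝ) + 2) / 2)
      linarith
    have hmain := boxIntegral_sq_le hg (fun p ↦ (pow_pos (hq0 p) _).le) a b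
    have h5 : (fun p ↦ q p ^ (2 * (k + 1 + 1))) = fun p ↦ (q p ^ (k + 2)) ^ 2 := by
      ext p; ring
    rw [h5, pow_two (((k : ℝ) + 2) / 2 * (B + C) + B)]
    have hnn : ∀ v : ℝ × ℝ, 0 ≤
        boxIntegral (fun p ↦ |fderiv ℝ (fun p ↦ q p ^ (k + 2)) p v| + q p ^ (k + 2)) a b :=
      fun v ↦ boxIntegral_nonneg fun p ↦ add_nonneg (abs_nonneg _) (pow_pos (hq0 p) _).le
    exact hmain.trans (mul_le_mul (hbound _ hs) (hbound _ ht) (hnn _) ((hnn _).trans (hbound _ hs)))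

theorem integral_square_eq_boxIntegrals (hg : Continuous g) (p : ℝ × ℝ) :
    ∫ x in (p.1 - 1)..(p.1 + 1), ∫ y in (p.2 - 1)..(p.2 + 1), g (x, y) =
      boxIntegral g (p.1 - 1) (p.2 - 1) + boxIntegral g (p.1 - 1) p.2 +
        (boxIntegral g p.1 (p.2 - 1) + boxIntegral g p.1 p.2) := by
  have h1 : ∀ x, ∫ y in (p.2 - 1)..(p.2 + 1), g (x, y) =
      (∫ y in (p.2 - 1)..(p.2 - 1 + 1), g (x, y)) + ∫ y in p.2..(p.2 + 1), g (x, y) := by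
    intro x
    rw [sub_add_cancel, intervalIntegral.integral_add_adjacent_intervals] <;>
    exact Continuous.intervalIntegrable (by fun_prop) _ _
  have h2 : ∀ c d, ∫ x in c..d, ∫ y in (p.2 - 1)..(p.2 + 1), g (x, y) =
      (∫ x in c..d, ∫ y in (p.2 - 1)..(p.2 - 1 + 1), g (x, y)) +
        ∫ x in c..d, ∫ y in p.2..(p.2 + 1), g (x, y) := by
    intro c d
    simp_rw [h1]
    rw [intervalIntegral.integral_add (intervalIntegrable_inner hg _ _ _ _)
      (intervalIntegrable_inner hg _ _ _ _)]
  rw [← intervalIntegral.integral_add_adjacent_intervals (b := p.1)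
    (intervalIntegrable_inner hg _ _ _ _) (intervalIntegrable_inner hg _ _ _ _), h2, h2]
  simp [boxIntegral]

/-- A function with gradient bounded in `L²` on unit squares and with Laplacian bounded from below
by a polynomial of the function is bounded. -/
theorem exists_forall_le_of_planeLaplacian (C : ℝ) (m : ℕ) : ∃ B : ℝ, ∀ q e : ℝ × ℝ → ℝ,
    ContDiff ℝ 2 q → Continuous e → (∀ p, 1 ≤ q p) →
    (∀ p, fderiv ℝ q p (1, 0) ^ 2 ≤ e p) → (∀ p, fderiv ℝ q p (0, 1) ^ 2 ≤ e p) →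
    (∀ a b, boxIntegral e a b ≤ C) → (∀ a b, boxIntegral (fun p ↦ q p ^ 2) a b ≤ C) →
    (∀ p, -(C * q p ^ m) ≤ planeLaplacian (fun p ↦ q p ^ 8) p) → ∀ p, q p ≤ B := by
  obtain ⟨B₁, hB₁⟩ := exists_boxIntegral_pow_le C 4
  obtain ⟨B₂, hB₂⟩ := exists_boxIntegral_pow_le C m
  -- The unit disc about p sits in a square made of four unit squares, whence the factors 4. `B₁`
  -- bounds the mean of q⁸ and `B₂` the square of the lower bound C q^m on the Laplacian.
  refine ⟨4 * B₁ + (Real.pi + C ^ 2 * (4 * B₂)) / 4, fun q e hq he hq1 hs ht hE hQ hL p ↦ ?_⟩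
  have hq' : ContDiff ℝ 1 q := hq.of_le (by norm_num)
  have hqc : Continuous q := hq.continuous
  have h1 := hB₁ q e hq' he hq1 hs ht hE hQ
  have h2 := hB₂ q e hq' he hq1 hs ht hE hQ
  have hq0 : ∀ p, 0 < q p := fun p ↦ one_pos.trans_le (hq1 p)
  have hmv := mean_value_le (f := fun p ↦ q p ^ 8) (F := fun p ↦ C * q p ^ m) (hq.pow 8)
    (by fun_prop) hL p
  have hp1 := polar_integral_le (g := fun p ↦ q p ^ 8) (by fun_prop)
    (fun x ↦ (pow_pos (hq0 x) _).le) p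
  have hp2 := polar_integral_le (g := fun p ↦ (C * q p ^ m) ^ 2) (by fun_prop)
    (fun x ↦ sq_nonneg _) p
  rw [integral_square_eq_boxIntegrals (g := fun p ↦ q p ^ 8) (by fun_prop)] at hp1
  rw [integral_square_eq_boxIntegrals (g := fun p ↦ (C * q p ^ m) ^ 2) (by fun_prop)] at hp2
  have e1 : (fun p ↦ (C * q p ^ m) ^ 2) = fun p ↦ C ^ 2 * q p ^ (2 * m) := by
    ext p; ring
  rw [e1] at hp2
  simp only [boxIntegral_const_mul] at hp2
  have hh1 : ∀ a b, boxIntegral (fun p ↦ q p ^ 8) a b ≤ B₁ := h1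
  have a1 := hh1 (p.1 - 1) (p.2 - 1)
  have a2 := hh1 (p.1 - 1) p.2
  have a3 := hh1 p.1 (p.2 - 1)
  have a4 := hh1 p.1 p.2
  have hh2 : ∀ a b, C ^ 2 * boxIntegral (fun p ↦ q p ^ (2 * m)) a b ≤ C ^ 2 * B₂ :=
    fun a b ↦ mul_le_mul_of_nonneg_left (h2 a b) (sq_nonneg _)
  have b1 := hh2 (p.1 - 1) (p.2 - 1)
  have b2 := hh2 (p.1 - 1) p.2
  have b3 := hh2 p.1 (p.2 - 1)
  have b4 := hh2 p.1 p.2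
  have hle : q p ≤ q p ^ 8 := le_self_pow₀ (hq1 p) (by norm_num)
  have hπ : q p ≤ Real.pi * q p ^ 8 := by
    have := Real.pi_gt_three
    nlinarith [pow_pos (hq0 p) 8]
  linarith

end BoxIntegrals

/-! ### One-variable estimates: continuity arguments and energy windows -/

section RealLemmas

open Filter

/-- A function whose derivative is controlled as long as the function is small stays small. -/
theorem abs_le_of_sq_deriv_le {g g' e : ℝ → ℝ} {a ε c : ℝ} (hε : 0 < ε) (hc : 0 < c)
    (hg : ∀ t, HasDerivAt g (g' t) t) (he : Continuous e) (he0 : ∀ t, 0 ≤ e t)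
    (hb : ∀ t ∈ Icc a (a + 1), |g t| ≤ ε → g' t ^ 2 ≤ c ^ 2 * e t) (h0 : |g a| ≤ ε / 2)
    (hint : ∫ t in a..(a + 1), e t ≤ (ε / (4 * c)) ^ 2) :
    ∀ t ∈ Icc a (a + 1), |g t| ≤ ε := by
  -- The comparison function starts at ε/2 and has slope c (e/μ + μ), which strictly exceeds c √e.
  -- Its total increase is at most 2 c μ = ε/2, so it never passes ε.
  set μ := ε / (4 * c) with hμ
  have hμ0 : 0 < μ := by positivity
  have hcμ : c * μ = ε / 4 := by rw [hμ]; field_simp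
  have hB : ∀ t, HasDerivAt (fun t ↦ ε / 2 + c * ∫ x in a..t, (e x / μ + μ))
      (c * (e t / μ + μ)) t := fun t ↦
    ((intervalIntegral.integral_hasDerivAt_right (Continuous.intervalIntegrable (by fun_prop) _ _)
      (Continuous.stronglyMeasurableAtFilter (by fun_prop) _ _)
      (Continuous.continuousAt (by fun_prop))).const_mul c).const_add _
  have hBle : ∀ t ∈ Icc a (a + 1), ε / 2 + c * ∫ x in a..t, (e x / μ + μ) ≤ ε := by
    intro t ht
    have h1 : ∫ x in a..t, (e x / μ + μ) ≤ ∫ x in a..(a + 1), (e x / μ + μ) := by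
      rw [← intervalIntegral.integral_add_adjacent_intervals (b := t) (c := a + 1)
        (Continuous.intervalIntegrable (by fun_prop) _ _)
        (Continuous.intervalIntegrable (by fun_prop) _ _)]
      have : 0 ≤ ∫ x in t..(a + 1), (e x / μ + μ) :=
        intervalIntegral.integral_nonneg ht.2 fun x _ ↦ by have := he0 x; positivity
      linarith
    have h2 : ∫ x in a..(a + 1), (e x / μ + μ) = (∫ x in a..(a + 1), e x) / μ + μ := by
      rw [intervalIntegral.integral_add (Continuous.intervalIntegrable (by fun_prop) _ _)
        (Continuous.intervalIntegrable (by fun_prop) _ _), intervalIntegral.integral_div]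
      simp
    have h3 : (∫ x in a..(a + 1), e x) / μ ≤ μ := by
      rw [div_le_iff₀ hμ0, ← pow_two]; exact hint
    have h4 : c * ∫ x in a..t, (e x / μ + μ) ≤ c * (2 * μ) :=
      mul_le_mul_of_nonneg_left (by linarith) hc.le
    linarith
  intro t ht
  refine le_trans ?_ (hBle t ht)
  refine image_norm_le_of_norm_deriv_right_lt_deriv_boundary' (f := g) (f' := g')
    (B := fun t ↦ ε / 2 + c * ∫ x in a..t, (e x / μ + μ)) (B' := fun t ↦ c * (e t / μ + μ))
    (fun x _ ↦ (hg x).continuousAt.continuousWithinAt) (fun x _ ↦ (hg x).hasDerivWithinAt)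
    (by simpa using h0) (fun x _ ↦ (hB x).continuousAt.continuousWithinAt)
    (fun x _ ↦ (hB x).hasDerivWithinAt) (fun x hx hxB ↦ ?_) ht
  have hx' : x ∈ Icc a (a + 1) := ⟨hx.1, hx.2.le⟩
  -- The derivative bound is available only while |g| ≤ ε. The fencing argument asks for it only at
  -- points where |g| meets the comparison function, and there |g| ≤ ε.
  have h5 := hb x hx' (by rw [← Real.norm_eq_abs, hxB]; exact hBle x hx')
  have h6 := he0 x
  rw [Real.norm_eq_abs]
  refine abs_lt_of_sq_lt_sq ?_ (by positivity)
  refine h5.trans_lt ?_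
  rw [mul_pow]
  refine mul_lt_mul_of_pos_left ?_ (by positivity)
  have h7 : (e x / μ + μ) ^ 2 = (e x / μ) ^ 2 + 2 * e x + μ ^ 2 := by field_simp; ring
  rw [h7]
  have : 0 < μ ^ 2 := by positivity
  nlinarith [sq_nonneg (e x / μ)]

theorem exists_abs_le_of_abs_integral_le {g : ℝ → ℝ} (hg : Continuous g) {ε : ℝ}
    (h : |∫ t in (0 : ℝ)..1, g t| ≤ ε) : ∃ t ∈ Icc (0 : ℝ) 1, |g t| ≤ ε := by
  obtain ⟨c, hc, h1⟩ := exists_eq_interval_average (a := (0 : ℝ)) (b := 1) (by norm_num)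
    hg.continuousOn
  refine ⟨c, ?_, ?_⟩
  · rw [uIoo_of_le zero_le_one] at hc; exact Ioo_subset_Icc_self hc
  · rw [h1, interval_average_eq]
    simpa using h

/-- Chebyshev's argument: G ≥ d on the whole window would cost d L > E. -/
theorem exists_lt_of_integral_le {G : ℝ → ℝ} (hG : Integrable G) (hG0 : ∀ s, 0 ≤ G s) {E d L : ℝ}
    (hE : ∫ s, G s ≤ E) (hL0 : 0 ≤ L) (hL : E < d * L) (s : ℝ) :
    ∃ s' ∈ Icc s (s + L), G s' < d := by
  by_contra! hcon
  have h1 : ∫ _ in s..(s + L), d ≤ ∫ x in s..(s + L), G x :=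
    intervalIntegral.integral_mono_on (by linarith) (by simp) hG.intervalIntegrable hcon
  have h2 : ∫ x in s..(s + L), G x ≤ ∫ x, G x := by
    rw [intervalIntegral.integral_of_le (by linarith)]
    exact setIntegral_le_integral hG (ae_of_all _ hG0)
  simp only [intervalIntegral.integral_const, smul_eq_mul, add_sub_cancel_left] at h1
  linarith

theorem intervalIntegral_le_of_le_integrable {f G : ℝ → ℝ} (hf : Continuous f)
    (hG : Integrable G) (hfG : ∀ s, f s ≤ G s) (hG0 : ∀ s, 0 ≤ G s) {E a b : ℝ}
    (hE : ∫ s, G s ≤ E) (hab : a ≤ b) : ∫ s in a..b, f s ≤ E := by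
  refine (intervalIntegral.integral_mono_on hab (hf.intervalIntegrable _ _) hG.intervalIntegrable
    fun x _ ↦ hfG x).trans ?_
  rw [intervalIntegral.integral_of_le hab]
  exact (setIntegral_le_integral hG (ae_of_all _ hG0)).trans hE

/-- The pointwise inequality |η'| ≤ 1 + η'² splits the variation into the elapsed time and the
energy, with no square roots. -/
theorem abs_sub_le_of_sq_deriv_le {η G : ℝ → ℝ} (hη : ContDiff ℝ 1 η) (hG : Integrable G)
    (hηG : ∀ s, deriv η s ^ 2 ≤ G s) {E a b : ℝ} (hE : ∫ s, G s ≤ E) (hab : a ≤ b) :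
    |η b - η a| ≤ b - a + E := by
  have hd : Continuous (deriv η) := hη.continuous_deriv le_rfl
  have h1 : ∫ s in a..b, deriv η s = η b - η a :=
    intervalIntegral.integral_deriv_eq_sub (fun x _ ↦ hη.differentiable (by norm_num) x)
      (hd.intervalIntegrable _ _)
  rw [← h1]
  refine (intervalIntegral.abs_integral_le_integral_abs hab).trans ?_
  have h2 : ∫ s in a..b, |deriv η s| ≤ ∫ s in a..b, (1 + deriv η s ^ 2) := by
    refine intervalIntegral.integral_mono_on hab (Continuous.intervalIntegrable (by fun_prop) _ _)
      (Continuous.intervalIntegrable (by fun_prop) _ _) fun x _ ↦ ?_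
    rw [abs_le]
    constructor <;> nlinarith [sq_nonneg (deriv η x - 1), sq_nonneg (deriv η x + 1)]
  rw [intervalIntegral.integral_add (by simp) (Continuous.intervalIntegrable (by fun_prop) _ _)]
    at h2
  have h3 := intervalIntegral_le_of_le_integrable (f := fun s ↦ deriv η s ^ 2) (by fun_prop) hG hηG
    (fun s ↦ (sq_nonneg _).trans (hηG s)) hE hab
  simp only [intervalIntegral.integral_const, smul_eq_mul, mul_one] at h2
  linarith

end RealLemmas

/-! ### The Laplacian of a composition and a smooth square-root profile -/

section PlaneLaplacian

open Filter

variable {r : ℝ × ℝ → ℝ} {p : ℝ × ℝ}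

theorem planeLaplacian_congr {f g : ℝ × ℝ → ℝ} (h : f =ᶠ[𝓝 p] g) :
    planeLaplacian f p = planeLaplacian g p := by
  rw [planeLaplacian, planeLaplacian, h.fderiv.fderiv_eq]

theorem fderiv_fderiv_apply (hr : ContDiffAt ℝ 2 r p) (v w : ℝ × ℝ) :
    fderiv ℝ (fderiv ℝ r) p v w = fderiv ℝ (fun x ↦ fderiv ℝ r x w) p v := by
  have h1 : DifferentiableAt ℝ (fderiv ℝ r) p :=
    (hr.fderiv_right (m := 1) (by norm_num)).differentiableAt (by norm_num)
  have h2 := (h1.hasFDerivAt.clm_apply (hasFDerivAt_const w p)).fderiv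
  rw [h2]
  simp

theorem planeLaplacian_comp (hr : ContDiffAt ℝ 2 r p) {ψ ψ' : ℝ → ℝ} {ψ'' : ℝ}
    (hψ : ∀ x, HasDerivAt ψ (ψ' x) x) (hψ' : HasDerivAt ψ' ψ'' (r p)) :
    planeLaplacian (fun x ↦ ψ (r x)) p =
      ψ'' * (fderiv ℝ r p (1, 0) ^ 2 + fderiv ℝ r p (0, 1) ^ 2) + ψ' (r p) * planeLaplacian r p := by
  have hev : ∀ᶠ x in 𝓝 p, DifferentiableAt ℝ r x := by
    filter_upwards [hr.eventually (by simp)] with x hx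
    exact hx.differentiableAt (by norm_num)
  have h1 : fderiv ℝ (fun x ↦ ψ (r x)) =ᶠ[𝓝 p] fun x ↦ ψ' (r x) • fderiv ℝ r x := by
    filter_upwards [hev] with x hx
    exact ((hψ (r x)).comp_hasFDerivAt x hx.hasFDerivAt).fderiv
  have h2 : DifferentiableAt ℝ (fderiv ℝ r) p :=
    (hr.fderiv_right (m := 1) (by norm_num)).differentiableAt (by norm_num)
  have h3 : HasFDerivAt (fun x ↦ ψ' (r x)) (ψ'' • fderiv ℝ r p) p :=
    hψ'.comp_hasFDerivAt p hev.self_of_nhds.hasFDerivAt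
  have h4 : HasFDerivAt (fun x ↦ ψ' (r x) • fderiv ℝ r x) _ p := h3.smul h2.hasFDerivAt
  rw [planeLaplacian, h1.fderiv_eq, h4.fderiv, planeLaplacian]
  simp
  ring

/-- Only the kink at 0 needs care: an exponent of at least 2 makes the truncated power o(x) there.
-/
theorem hasDerivAt_max_zero_pow (k : ℕ) (x : ℝ) :
    HasDerivAt (fun x : ℝ ↦ max 0 x ^ (k + 2)) ((k + 2) * max 0 x ^ (k + 1)) x := by
  rcases lt_trichotomy x 0 with hx | rfl | hx
  · rw [max_eq_left hx.le]
    have : (fun x : ℝ ↦ max 0 x ^ (k + 2)) =ᶠ[𝓝 x] fun _ ↦ 0 := by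
      filter_upwards [Iio_mem_nhds hx] with y hy
      rw [max_eq_left (le_of_lt hy)]; simp
    simpa using (hasDerivAt_const x (0 : ℝ)).congr_of_eventuallyEq this
  · simp only [max_self, ne_eq, Nat.add_eq_zero_iff, one_ne_zero, and_false, not_false_eq_true,
      zero_pow, mul_zero]
    rw [hasDerivAt_iff_isLittleO]
    simp only [max_self, sub_zero, smul_zero, ne_eq, Nat.add_eq_zero_iff, OfNat.ofNat_ne_zero,
      and_false, not_false_eq_true, zero_pow]
    have h1 : (fun x : ℝ ↦ max 0 x ^ (k + 2)) =O[𝓝 0] fun x : ℝ ↦ x ^ (k + 2) := by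
      refine Asymptotics.isBigO_of_le _ fun x ↦ ?_
      rw [norm_pow, norm_pow]
      refine pow_le_pow_left₀ (norm_nonneg _) ?_ _
      rw [Real.norm_eq_abs, Real.norm_eq_abs, abs_of_nonneg (le_max_left _ _)]
      exact max_le (abs_nonneg _) (le_abs_self _)
    have h2 := Asymptotics.isLittleO_pow_id (𝕜 := ℝ) (n := k + 2) (by lia)
    exact h1.trans_isLittleO h2
  · rw [max_eq_right hx.le]
    have : (fun x : ℝ ↦ max 0 x ^ (k + 2)) =ᶠ[𝓝 x] fun x ↦ x ^ (k + 2) := by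
      filter_upwards [Ioi_mem_nhds hx] with y hy
      rw [max_eq_right (le_of_lt hy)]
    have h := (hasDerivAt_pow (k + 2) x).congr_of_eventuallyEq this
    exact h.congr_deriv (by push_cast; rfl)

theorem contDiff_max_zero_pow_four : ContDiff ℝ 2 fun x : ℝ ↦ max 0 x ^ 4 := by
  have e1 : deriv (fun x : ℝ ↦ max 0 x ^ 4) = fun x ↦ 4 * max 0 x ^ 3 := by
    ext x
    rw [(hasDerivAt_max_zero_pow 2 x).deriv]
    norm_num
  have e2 : deriv (fun x : ℝ ↦ 4 * max 0 x ^ 3) = fun x ↦ 4 * (3 * max 0 x ^ 2) := by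
    ext x
    rw [((hasDerivAt_max_zero_pow 1 x).const_mul 4).deriv]
    norm_num
  rw [show (2 : WithTop ℕ∞) = 1 + 1 by norm_num, contDiff_succ_iff_deriv]
  refine ⟨fun x ↦ (hasDerivAt_max_zero_pow 2 x).differentiableAt, by simp, ?_⟩
  rw [e1, contDiff_one_iff_deriv]
  refine ⟨fun x ↦ ((hasDerivAt_max_zero_pow 1 x).const_mul 4).differentiableAt, ?_⟩
  rw [e2]
  fun_prop

/-- A twice continuously differentiable function which grows like `√x`, and is constant for
negative `x`. -/
def rootProfile (x : ℝ) : ℝ := (1 + max 0 x ^ 4) ^ (1 / 8 : ℝ)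

/-- The eighth power undoes the root and leaves a truncated fourth power, which is C² and convex.
This is why the mean value inequality is applied to the eighth power of the profile and not to the
profile itself. -/
theorem rootProfile_pow (x : ℝ) : rootProfile x ^ 8 = 1 + max 0 x ^ 4 := by
  have h : (0 : ℝ) ≤ 1 + max 0 x ^ 4 := by positivity
  rw [rootProfile, ← Real.rpow_natCast, ← Real.rpow_mul h]
  norm_num

theorem one_le_rootProfile (x : ℝ) : 1 ≤ rootProfile x :=
  Real.one_le_rpow (by have : 0 ≤ max 0 x ^ 4 := by positivity
                       linarith) (by norm_num)

theorem max_zero_le_rootProfile_sq (x : ℝ) : max 0 x ≤ rootProfile x ^ 2 := by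
  refine le_of_pow_le_pow_left₀ (n := 4) (by norm_num) (by positivity) ?_
  rw [← pow_mul, rootProfile_pow]
  linarith

theorem rootProfile_sq_le (x : ℝ) : rootProfile x ^ 2 ≤ 1 + max 0 x := by
  have h : 0 ≤ max 0 x := le_max_left _ _
  refine le_of_pow_le_pow_left₀ (n := 4) (by norm_num) (by positivity) ?_
  rw [← pow_mul, rootProfile_pow]
  have : (1 + max 0 x) ^ 4 = 1 + max 0 x ^ 4 + (4 * max 0 x + 6 * max 0 x ^ 2 + 4 * max 0 x ^ 3) := by
    ring
  rw [this]
  have : 0 ≤ 4 * max 0 x + 6 * max 0 x ^ 2 + 4 * max 0 x ^ 3 := by positivity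
  linarith

theorem contDiff_rootProfile : ContDiff ℝ 2 rootProfile := by
  refine (contDiff_const.add contDiff_max_zero_pow_four).rpow_const_of_ne fun x ↦ ?_
  have : 0 ≤ max 0 x ^ 4 := by positivity
  positivity

theorem hasDerivAt_rootProfile (x : ℝ) :
    HasDerivAt rootProfile (max 0 x ^ 3 / (2 * rootProfile x ^ 7)) x := by
  have h1 : HasDerivAt rootProfile (deriv rootProfile x) x :=
    (contDiff_rootProfile.differentiable (by norm_num) x).hasDerivAt
  -- Differentiating the eighth power in two ways and comparing avoids the derivative of a real
  -- power.
  have h2 := h1.pow 8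
  have h3 : HasDerivAt (rootProfile ^ 8) ((2 + 2 : ℝ) * max 0 x ^ 3) x := by
    have h4 := (hasDerivAt_max_zero_pow 2 x).const_add 1
    have e : rootProfile ^ 8 = fun x ↦ 1 + max 0 x ^ 4 := by ext x; exact rootProfile_pow x
    rw [e]
    simpa using h4
  have h5 := h2.unique h3
  have h6 : 0 < rootProfile x := one_pos.trans_le (one_le_rootProfile x)
  have h7 : max 0 x ^ 3 / (2 * rootProfile x ^ 7) = deriv rootProfile x := by
    rw [div_eq_iff (by positivity)]
    norm_num at h5
    linarith
  rw [h7]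
  exact h1

end PlaneLaplacian

/-! ### One-forms in charts and naturality of the exterior derivative -/

section Pullback

open Filter

variable {m : ℕ} {M : Type*} [TopologicalSpace M] [ChartedSpace (EuclideanSpace ℝ (Fin m)) M]
  [IsManifold (𝓡 m) ∞ M]
  {F : Type*} [NormedAddCommGroup F] [NormedSpace ℝ F]
  {lam : ∀ w : M, TangentSpace (𝓡 m) w →L[ℝ] ℝ}

/-- Smoothness of a section is smoothness in the trivialization at `x₀`, and the tangent
trivialization there is inverted by the derivative of the inverse chart, so the local representative
is the chart expression. -/
theorem contDiffAt_oneFormInChart (hlam : IsSmoothOneForm (𝓡 m) lam) (x₀ : M) :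
    ContDiffAt ℝ ∞ (oneFormInChart (𝓡 m) lam x₀) (extChartAt (𝓡 m) x₀ x₀) := by
  have h1 := ((contMDiffAt_hom_bundle _).1 (hlam x₀)).2
  have h2 : ContMDiffAt 𝓘(ℝ, EuclideanSpace ℝ (Fin m)) (𝓡 m) ∞ (extChartAt (𝓡 m) x₀).symm
      (extChartAt (𝓡 m) x₀ x₀) :=
    (contMDiffOn_extChartAt_symm x₀).contMDiffAt (extChartAt_target_mem_nhds x₀)
  have h3 : ContMDiffAt 𝓘(ℝ, EuclideanSpace ℝ (Fin m)) _ ∞ _ (extChartAt (𝓡 m) x₀ x₀) :=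
    ContMDiffAt.comp (extChartAt (𝓡 m) x₀ x₀) (by
      simp only [extChartAt_to_inv]; exact h1) h2
  refine h3.contDiffAt.congr_of_eventuallyEq ?_
  filter_upwards [extChartAt_target_mem_nhds (I := 𝓡 m) x₀] with y hy
  have hy' : (extChartAt (𝓡 m) x₀).symm y ∈ (chartAt (EuclideanSpace ℝ (Fin m)) x₀).source := by
    rw [← extChartAt_source (𝓡 m)]
    exact (extChartAt (𝓡 m) x₀).map_target hy
  simp only [oneFormInChart, Function.comp, ContinuousLinearMap.inCoordinates]
  rw [TangentBundle.symmL_trivializationAt hy', (extChartAt (𝓡 m) x₀).right_inv hy]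
  ext v
  simp

/-- The chain rule for u = φ⁻¹ ∘ (φ ∘ u) with one fixed chart φ near `p₀`. It must hold on a
neighbourhood because the resulting formulas are differentiated again. -/
theorem mfderiv_eventually_eq {u : F → M} {p₀ : F}
    (hu : ContMDiffAt 𝓘(ℝ, F) (𝓡 m) ∞ u p₀) (x₁ : M)
    (hx₁ : u p₀ ∈ (chartAt (EuclideanSpace ℝ (Fin m)) x₁).source) :
    ∀ᶠ p in 𝓝 p₀, u p ∈ (extChartAt (𝓡 m) x₁).source ∧
      ContDiffAt ℝ 1 (extChartAt (𝓡 m) x₁ ∘ u) p ∧ ∀ v : F,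
      mfderiv 𝓘(ℝ, F) (𝓡 m) u p v =
        mfderivWithin 𝓘(ℝ, EuclideanSpace ℝ (Fin m)) (𝓡 m) (extChartAt (𝓡 m) x₁).symm
          (range (𝓡 m)) (extChartAt (𝓡 m) x₁ (u p))
          (fderiv ℝ (extChartAt (𝓡 m) x₁ ∘ u) p v) := by
  have hu1 : ContMDiffAt 𝓘(ℝ, F) (𝓡 m) 1 u p₀ := hu.of_le (by norm_num)
  have hsrc : ∀ᶠ p in 𝓝 p₀, u p ∈ (extChartAt (𝓡 m) x₁).source := by
    refine hu.continuousAt.eventually ?_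
    exact (isOpen_extChartAt_source x₁).mem_nhds (by rwa [extChartAt_source])
  filter_upwards [hsrc, hsrc.eventually_nhds, contMDiffAt_iff_contMDiffAt_nhds (by simp) |>.1 hu1] with p hp hpn hup
  have hup' : MDifferentiableAt 𝓘(ℝ, F) (𝓡 m) u p := hup.mdifferentiableAt (by simp)
  have hp' : u p ∈ (chartAt (EuclideanSpace ℝ (Fin m)) x₁).source := by
    rwa [extChartAt_source] at hp
  have hcomp : ContMDiffAt 𝓘(ℝ, F) 𝓘(ℝ, EuclideanSpace ℝ (Fin m)) 1
      (extChartAt (𝓡 m) x₁ ∘ u) p :=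
    (contMDiffAt_extChartAt' hp').comp p hup
  refine ⟨hp, hcomp.contDiffAt, fun v ↦ ?_⟩
  have hmd : MDifferentiableAt 𝓘(ℝ, F) 𝓘(ℝ, EuclideanSpace ℝ (Fin m))
      (extChartAt (𝓡 m) x₁ ∘ u) p := hcomp.mdifferentiableAt (by simp)
  have hsymm := mdifferentiableWithinAt_extChartAt_symm (I := 𝓡 m)
    ((extChartAt (𝓡 m) x₁).map_source hp)
  have e : u =ᶠ[𝓝 p] (extChartAt (𝓡 m) x₁).symm ∘ (extChartAt (𝓡 m) x₁ ∘ u) := by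
    filter_upwards [hpn] with q hq
    exact ((extChartAt (𝓡 m) x₁).left_inv hq).symm
  have hc := mfderiv_comp_of_eq (y := (extChartAt (𝓡 m) x₁ ∘ u) p) (x := p)
    (g := (extChartAt (𝓡 m) x₁).symm) (I'' := 𝓡 m)
    (by simpa [mdifferentiableWithinAt_univ] using hsymm) hmd rfl
  rw [e.mfderiv_eq, hc, mfderiv_eq_fderiv]
  simp only [modelWithCornersSelf_coe, range_id, mfderivWithin_univ]
  rfl

end Pullback

section Pullback

theorem extDerivOneForm_neg_swap {m : ℕ} {M : Type*} [TopologicalSpace M]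
    [ChartedSpace (EuclideanSpace ℝ (Fin m)) M]
    {lam : ∀ w : M, TangentSpace (𝓡 m) w →L[ℝ] ℝ} (w : M) (v v' : TangentSpace (𝓡 m) w) :
    extDerivOneForm (𝓡 m) lam w v v' = -extDerivOneForm (𝓡 m) lam w v' v := by
  have h : ∀ (B : EuclideanSpace ℝ (Fin m) →L[ℝ] EuclideanSpace ℝ (Fin m) →L[ℝ] ℝ) (a b),
      (B - B.flip) a b = -(B - B.flip) b a := fun B a b ↦ by simp
  exact h _ v v'

open Filter

variable {m : ℕ} {M : Type*} [TopologicalSpace M] [ChartedSpace (EuclideanSpace ℝ (Fin m)) M]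
  [IsManifold (𝓡 m) ∞ M]
  {F : Type*} [NormedAddCommGroup F] [NormedSpace ℝ F]
  {lam : ∀ w : M, TangentSpace (𝓡 m) w →L[ℝ] ℝ}

theorem pullback_eventually_eq {u : F → M} {p₀ : F}
    (hu : ContMDiffAt 𝓘(ℝ, F) (𝓡 m) ∞ u p₀) (x₁ : M)
    (hx₁ : u p₀ ∈ (chartAt (EuclideanSpace ℝ (Fin m)) x₁).source)
    (lam : ∀ w : M, TangentSpace (𝓡 m) w →L[ℝ] ℝ) :
    ∀ᶠ p in 𝓝 p₀, ∀ v : F, lam (u p) (mfderiv 𝓘(ℝ, F) (𝓡 m) u p v) =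
      oneFormInChart (𝓡 m) lam x₁ (extChartAt (𝓡 m) x₁ (u p))
        (fderiv ℝ (extChartAt (𝓡 m) x₁ ∘ u) p v) := by
  filter_upwards [mfderiv_eventually_eq hu x₁ hx₁] with p hp v
  rw [hp.2.2]
  have h1 := (extChartAt (𝓡 m) x₁).left_inv hp.1
  -- The two base points are equal only propositionally, while every tangent space is the model
  -- space. Quantifying over the point lets the equality be eliminated.
  have h2 : ∀ x : M, x = u p → ∀ z : EuclideanSpace ℝ (Fin m), lam (u p) z = lam x z := by
    rintro x rfl z; rfl
  exact h2 _ h1 _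

theorem mfderiv_eq_fderiv_chart {u : F → M} {p₀ : F}
    (hu : ContMDiffAt 𝓘(ℝ, F) (𝓡 m) ∞ u p₀) (v : F) :
    mfderiv 𝓘(ℝ, F) (𝓡 m) u p₀ v = fderiv ℝ (extChartAt (𝓡 m) (u p₀) ∘ u) p₀ v := by
  have h := (mfderiv_eventually_eq hu (u p₀) (mem_chart_source _ _)).self_of_nhds.2.2 v
  rw [h, mfderivWithin_range_extChartAt_symm]
  rfl

theorem contDiffAt_chart_comp {u : F → M} {p₀ : F} (hu : ContMDiffAt 𝓘(ℝ, F) (𝓡 m) ∞ u p₀)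
    (x₁ : M) (hx₁ : u p₀ ∈ (chartAt (EuclideanSpace ℝ (Fin m)) x₁).source) :
    ContDiffAt ℝ ∞ (extChartAt (𝓡 m) x₁ ∘ u) p₀ :=
  ((contMDiffAt_extChartAt' hx₁).comp p₀ hu).contDiffAt

theorem contDiffAt_pullback (hlam : IsSmoothOneForm (𝓡 m) lam) {u : F → M} {p₀ : F}
    (hu : ContMDiffAt 𝓘(ℝ, F) (𝓡 m) ∞ u p₀) (v : F) :
    ContDiffAt ℝ ∞ (fun p ↦ lam (u p) (mfderiv 𝓘(ℝ, F) (𝓡 m) u p v)) p₀ := by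
  have hc := contDiffAt_chart_comp hu (u p₀) (mem_chart_source _ _)
  have hθ := (contDiffAt_oneFormInChart hlam (u p₀)).comp p₀ (g := oneFormInChart (𝓡 m) lam (u p₀))
    (f := extChartAt (𝓡 m) (u p₀) ∘ u) hc
  have hd : ContDiffAt ℝ ∞ (fun p ↦ fderiv ℝ (extChartAt (𝓡 m) (u p₀) ∘ u) p v) p₀ :=
    (hc.fderiv_right (m := ∞) (by simp)).clm_apply contDiffAt_const
  refine (hθ.clm_apply hd).congr_of_eventuallyEq ?_
  filter_upwards [pullback_eventually_eq hu (u p₀) (mem_chart_source _ _) lam] with p hp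
  exact hp v

/-- The exterior derivative commutes with the pull-back by a smooth map from a vector space. -/
theorem fderiv_pullback_sub (hlam : IsSmoothOneForm (𝓡 m) lam) {u : F → M} {p₀ : F}
    (hu : ContMDiffAt 𝓘(ℝ, F) (𝓡 m) ∞ u p₀) (v w : F) :
    fderiv ℝ (fun p ↦ lam (u p) (mfderiv 𝓘(ℝ, F) (𝓡 m) u p w)) p₀ v -
      fderiv ℝ (fun p ↦ lam (u p) (mfderiv 𝓘(ℝ, F) (𝓡 m) u p v)) p₀ w =
    extDerivOneForm (𝓡 m) lam (u p₀) (mfderiv 𝓘(ℝ, F) (𝓡 m) u p₀ v)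
      (mfderiv 𝓘(ℝ, F) (𝓡 m) u p₀ w) := by
  have hc := contDiffAt_chart_comp hu (u p₀) (mem_chart_source _ _)
  set U := extChartAt (𝓡 m) (u p₀) ∘ u with hU
  set θ := oneFormInChart (𝓡 m) lam (u p₀) with hθ
  have hθd : HasFDerivAt θ (fderiv ℝ θ (U p₀)) (U p₀) :=
    ((contDiffAt_oneFormInChart hlam (u p₀)).differentiableAt (by simp)).hasFDerivAt
  have hUd : HasFDerivAt U (fderiv ℝ U p₀) p₀ := (hc.differentiableAt (by simp)).hasFDerivAt
  have hU2 : HasFDerivAt (fderiv ℝ U) (fderiv ℝ (fderiv ℝ U) p₀) p₀ :=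
    ((hc.fderiv_right (m := ∞) (by simp)).differentiableAt (by simp)).hasFDerivAt
  have key : ∀ a b : F, fderiv ℝ (fun p ↦ lam (u p) (mfderiv 𝓘(ℝ, F) (𝓡 m) u p b)) p₀ a =
      fderiv ℝ θ (U p₀) (fderiv ℝ U p₀ a) (fderiv ℝ U p₀ b) +
        θ (U p₀) (fderiv ℝ (fderiv ℝ U) p₀ a b) := by
    intro a b
    have e : (fun p ↦ lam (u p) (mfderiv 𝓘(ℝ, F) (𝓡 m) u p b)) =ᶠ[𝓝 p₀]
        fun p ↦ θ (U p) (fderiv ℝ U p b) := by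
      filter_upwards [pullback_eventually_eq hu (u p₀) (mem_chart_source _ _) lam] with p hp
      exact hp b
    rw [e.fderiv_eq]
    have h1 := (hθd.comp p₀ hUd).clm_apply (hU2.clm_apply (hasFDerivAt_const b p₀))
    have h2 := h1.fderiv
    simp only [Function.comp_def] at h2
    rw [h2]
    simp [add_comm]
  -- The second derivatives of u enter both terms through θ(D²U) and cancel by symmetry; only the
  -- antisymmetrized derivative of θ survives.
  have hsymm : fderiv ℝ (fderiv ℝ U) p₀ v w = fderiv ℝ (fderiv ℝ U) p₀ w v :=
    (hc.isSymmSndFDerivAt (by simpa using ENat.LEInfty.out)) v w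
  rw [key, key, hsymm, mfderiv_eq_fderiv_chart hu, mfderiv_eq_fderiv_chart hu, extDerivOneForm]
  simp only [modelWithCornersSelf_coe, range_id, fderivWithin_univ]
  rw [add_sub_add_right_eq_sub]
  rfl

/-- The exterior derivative in a chart centred at another point. -/
theorem extDerivOneForm_eq_in_chart (hlam : IsSmoothOneForm (𝓡 m) lam) (x₁ : M) :
    ∀ᶠ x in 𝓝 x₁, ∀ v v' : TangentSpace (𝓡 m) x,
      extDerivOneForm (𝓡 m) lam x v v' =
        fderiv ℝ (oneFormInChart (𝓡 m) lam x₁) (extChartAt (𝓡 m) x₁ x)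
          (mfderiv (𝓡 m) 𝓘(ℝ, EuclideanSpace ℝ (Fin m)) (extChartAt (𝓡 m) x₁) x v)
          (mfderiv (𝓡 m) 𝓘(ℝ, EuclideanSpace ℝ (Fin m)) (extChartAt (𝓡 m) x₁) x v') -
        fderiv ℝ (oneFormInChart (𝓡 m) lam x₁) (extChartAt (𝓡 m) x₁ x)
          (mfderiv (𝓡 m) 𝓘(ℝ, EuclideanSpace ℝ (Fin m)) (extChartAt (𝓡 m) x₁) x v')
          (mfderiv (𝓡 m) 𝓘(ℝ, EuclideanSpace ℝ (Fin m)) (extChartAt (𝓡 m) x₁) x v) := by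
  set φ := extChartAt (𝓡 m) x₁ with hφ
  set θ := oneFormInChart (𝓡 m) lam x₁ with hθ
  have hd1 : ∀ᶠ y in 𝓝 (φ x₁), ContDiffAt ℝ 1 θ y :=
    ((contDiffAt_oneFormInChart hlam x₁).of_le (by norm_num)).eventually (by simp)
  have hd : ∀ᶠ x in 𝓝 x₁, ContDiffAt ℝ 1 θ (φ x) :=
    (continuousAt_extChartAt x₁).eventually hd1
  filter_upwards [hd, extChartAt_source_mem_nhds (I := 𝓡 m) x₁] with x hx hxs v v'
  have hxs' : x ∈ (chartAt (EuclideanSpace ℝ (Fin m)) x₁).source := by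
    rwa [← extChartAt_source (𝓡 m)]
  set A := mfderiv (𝓡 m) 𝓘(ℝ, EuclideanSpace ℝ (Fin m)) φ x with hA
  obtain ⟨ℓ, hℓ1, hℓ2⟩ : ∃ ℓ : ℝ × ℝ →L[ℝ] EuclideanSpace ℝ (Fin m),
      ℓ (1, 0) = A v ∧ ℓ (0, 1) = A v' := by
    have h : ∀ a b : EuclideanSpace ℝ (Fin m), ∃ ℓ : ℝ × ℝ →L[ℝ] EuclideanSpace ℝ (Fin m),
        ℓ (1, 0) = a ∧ ℓ (0, 1) = b := fun a b ↦
      ⟨(ContinuousLinearMap.fst ℝ ℝ ℝ).smulRight a + (ContinuousLinearMap.snd ℝ ℝ ℝ).smulRight b,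
        by simp, by simp⟩
    exact h _ _
  -- An affine plane in the chart at `x₁`, with partial derivatives v and v' at x. Computing the
  -- exterior derivative of the pull-back both intrinsically and in this chart shows that the
  -- formula does not depend on the chart.
  let u : ℝ × ℝ → M := fun p ↦ φ.symm (φ x + ℓ p)
  have hu0 : u 0 = x := by simp only [u, map_zero, add_zero]; exact φ.left_inv hxs
  have hsm : ContMDiffAt 𝓘(ℝ, EuclideanSpace ℝ (Fin m)) (𝓡 m) ∞ φ.symm (φ x + ℓ 0) := by
    refine (contMDiffOn_extChartAt_symm x₁).contMDiffAt ?_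
    simp only [map_zero, add_zero]
    exact (isOpen_extChartAt_target x₁).mem_nhds (φ.map_source hxs)
  have hu : ContMDiffAt 𝓘(ℝ, ℝ × ℝ) (𝓡 m) ∞ u 0 := by
    refine hsm.comp (0 : ℝ × ℝ) ?_
    exact ((contDiff_const.add ℓ.contDiff).contDiffAt).contMDiffAt
  have hux : u 0 ∈ (chartAt (EuclideanSpace ℝ (Fin m)) x₁).source := by rwa [hu0]
  have hφu : φ ∘ u =ᶠ[𝓝 0] fun p ↦ φ x + ℓ p := by
    have : ∀ᶠ p : ℝ × ℝ in 𝓝 0, φ x + ℓ p ∈ φ.target := by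
      have hc : ContinuousAt (fun p ↦ φ x + ℓ p) (0 : ℝ × ℝ) := by fun_prop
      refine hc.eventually ((isOpen_extChartAt_target x₁).mem_nhds ?_)
      simp only [map_zero, add_zero]
      exact φ.map_source hxs
    filter_upwards [this] with p hp
    exact φ.right_inv hp
  have hfd : ∀ᶠ p : ℝ × ℝ in 𝓝 0, fderiv ℝ (φ ∘ u) p = ℓ := by
    filter_upwards [hφu.eventuallyEq_nhds] with p hp
    rw [hp.fderiv_eq]
    exact (ℓ.hasFDerivAt.const_add _).fderiv
  have hpull := pullback_eventually_eq hu x₁ hux lam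
  have key : ∀ a b : ℝ × ℝ,
      fderiv ℝ (fun p ↦ lam (u p) (mfderiv 𝓘(ℝ, ℝ × ℝ) (𝓡 m) u p b)) 0 a =
        fderiv ℝ θ (φ x) (ℓ a) (ℓ b) := by
    intro a b
    have e : (fun p ↦ lam (u p) (mfderiv 𝓘(ℝ, ℝ × ℝ) (𝓡 m) u p b)) =ᶠ[𝓝 0]
        fun p ↦ θ (φ x + ℓ p) (ℓ b) := by
      filter_upwards [hpull, hfd, hφu] with p h1 h2 h3
      rw [h1, h2, ← h3]
      rfl
    rw [e.fderiv_eq]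
    have h1 : HasFDerivAt (fun p ↦ φ x + ℓ p) ℓ 0 := ℓ.hasFDerivAt.const_add _
    have h2 : HasFDerivAt θ (fderiv ℝ θ (φ x)) (φ x + ℓ 0) := by
      simpa using (hx.differentiableAt (by simp)).hasFDerivAt
    have h3 := (h2.comp (0 : ℝ × ℝ) h1).clm_apply (hasFDerivAt_const (ℓ b) (0 : ℝ × ℝ))
    have h4 := h3.fderiv
    simp only [Function.comp_def] at h4
    rw [h4]
    simp
  have hmu : ∀ a : ℝ × ℝ, ∀ z : TangentSpace (𝓡 m) x, ℓ a = A z →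
      HEq (mfderiv 𝓘(ℝ, ℝ × ℝ) (𝓡 m) u 0 a) z := by
    intro a z haz
    have h1 := (mfderiv_eventually_eq hu x₁ hux).self_of_nhds.2.2 a
    rw [hfd.self_of_nhds, haz, ← hφ, hu0] at h1
    have h2 := congrArg (fun L ↦ L z) (mfderivWithin_extChartAt_symm_comp_mfderiv_extChartAt' hxs)
    have h3 : mfderiv 𝓘(ℝ, ℝ × ℝ) (𝓡 m) u 0 a = z := h1.trans h2
    exact heq_of_eq h3
  have hmain := fderiv_pullback_sub hlam hu (1, 0) (0, 1)
  rw [key, key, hℓ1, hℓ2] at hmain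
  rw [hmain]
  have g1 := hmu (1, 0) v hℓ1
  have g2 := hmu (0, 1) v' hℓ2
  clear hmain hmu key hpull hfd hφu
  -- The derivatives are replaced by free vectors so that `u 0 = x` can be substituted despite the
  -- dependence of the tangent spaces on the point.
  generalize mfderiv 𝓘(ℝ, ℝ × ℝ) (𝓡 m) u 0 (1, 0) = z₁ at g1 ⊢
  generalize mfderiv 𝓘(ℝ, ℝ × ℝ) (𝓡 m) u 0 (0, 1) = z₂ at g2 ⊢
  clear hux
  clear_value u
  subst hu0
  rw [eq_of_heq g1, eq_of_heq g2]

end Pullback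

/-! ### Dual vectors in coordinates -/

section DualInCoordinates

variable {V : Type*} [AddCommGroup V] [Module ℝ V] [TopologicalSpace V] [FiniteDimensional ℝ V]
  {E : Type*} [NormedAddCommGroup E] [NormedSpace ℝ E] [FiniteDimensional ℝ E]

theorem isInvertible_of_nondegenerate (B : E →L[ℝ] E →L[ℝ] ℝ)
    (hB : ∀ v, (∀ w, B v w = 0) → v = 0) : B.IsInvertible := by
  have hinj : Function.Injective B := by
    rw [injective_iff_map_eq_zero]
    intro v hv
    exact hB v fun w ↦ by rw [hv]; rfl
  have hfr : Module.finrank ℝ E = Module.finrank ℝ (E →L[ℝ] ℝ) := by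
    rw [← (LinearMap.toContinuousLinearMap (𝕜 := ℝ) (E := E) (F' := ℝ)).finrank_eq]
    exact (Subspace.dual_finrank_eq (K := ℝ) (V := E)).symm
  let e := LinearEquiv.ofInjectiveOfFinrankEq (B : E →ₗ[ℝ] (E →L[ℝ] ℝ)) hinj hfr
  exact ⟨e.toContinuousLinearEquiv, by ext; rfl⟩

/-- The chosen vector becomes the value of an inverse operator in coordinates, and inversion is
continuous. This is how continuity of the vector fields Y and X_H becomes accessible. -/
theorem dualVector_in_coordinates {Ω : V →L[ℝ] V →L[ℝ] ℝ}
    (hΩ : ∀ v, (∀ w, Ω v w = 0) → v = 0) {A : V →L[ℝ] E} (hA : Function.Bijective A)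
    {B : E →L[ℝ] E →L[ℝ] ℝ} (hB : ∀ v w, Ω v w = B (A v) (A w)) {ℓ : V →L[ℝ] ℝ}
    {k : E →L[ℝ] ℝ} (hk : ∀ v, ℓ v = k (A v)) :
    B.IsInvertible ∧ A (dualVector Ω ℓ) = B.inverse k := by
  have hinv : B.IsInvertible := by
    refine isInvertible_of_nondegenerate B fun x hx ↦ ?_
    obtain ⟨v, rfl⟩ := hA.2 x
    have := hΩ v fun w ↦ by rw [hB, hx]
    rw [this, map_zero]
  refine ⟨hinv, ?_⟩
  have h1 : B (A (dualVector Ω ℓ)) = k := by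
    ext y
    obtain ⟨w, rfl⟩ := hA.2 y
    rw [← hB, dualVector_spec Ω hΩ, hk]
  rw [← h1, hinv.inverse_apply_self]

theorem eq_dualVector {Ω : V →L[ℝ] V →L[ℝ] ℝ} (hΩ : ∀ v, (∀ w, Ω v w = 0) → v = 0)
    {ℓ : V →L[ℝ] ℝ} {X : V} (hX : ∀ v, Ω X v = ℓ v) : X = dualVector Ω ℓ := by
  rw [← sub_eq_zero]
  refine hΩ _ fun w ↦ ?_
  rw [map_sub]
  show Ω X w - Ω (dualVector Ω ℓ) w = 0
  rw [hX, dualVector_spec Ω hΩ, sub_self]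

theorem continuous_sub_flip : Continuous fun B : E →L[ℝ] E →L[ℝ] ℝ ↦ B - B.flip := by
  refine continuous_clm_apply.2 fun v ↦ continuous_clm_apply.2 fun w ↦ ?_
  show Continuous fun B : E →L[ℝ] E →L[ℝ] ℝ ↦ B v w - B w v
  fun_prop

end DualInCoordinates

/-! ### Continuity of λ(X_H), λ(JY) and dH(J X_H) -/

section Continuity

open Filter

variable {m : ℕ} {M : Type*} [TopologicalSpace M] [ChartedSpace (EuclideanSpace ℝ (Fin m)) M]
  {lam : ∀ w : M, TangentSpace (𝓡 m) w →L[ℝ] ℝ}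

instance (w : M) : FiniteDimensional ℝ (TangentSpace (𝓡 m) w) :=
  inferInstanceAs (FiniteDimensional ℝ (EuclideanSpace ℝ (Fin m)))

/-- The Liouville vector field `Y`, given by `ω (Y, ·) = λ`. -/
def liouvilleVF (lam : ∀ w : M, TangentSpace (𝓡 m) w →L[ℝ] ℝ) (w : M) : TangentSpace (𝓡 m) w :=
  dualVector (extDerivOneForm (𝓡 m) lam w) (lam w)

/-- The differential of the preferred chart at `x₁`. -/
def chartDeriv (x₁ x : M) : TangentSpace (𝓡 m) x →L[ℝ] EuclideanSpace ℝ (Fin m) :=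
  mfderiv (𝓡 m) 𝓘(ℝ, EuclideanSpace ℝ (Fin m)) (extChartAt (𝓡 m) x₁) x

/-- The exterior derivative of a one-form in the preferred chart at `x₁`. -/
def extDerivInChart (lam : ∀ w : M, TangentSpace (𝓡 m) w →L[ℝ] ℝ) (x₁ : M)
    (y : EuclideanSpace ℝ (Fin m)) :
    EuclideanSpace ℝ (Fin m) →L[ℝ] EuclideanSpace ℝ (Fin m) →L[ℝ] ℝ :=
  fderiv ℝ (oneFormInChart (𝓡 m) lam x₁) y - (fderiv ℝ (oneFormInChart (𝓡 m) lam x₁) y).flip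

variable [IsManifold (𝓡 m) ∞ M]

theorem extDerivOneForm_eventually_eq (hlam : IsSmoothOneForm (𝓡 m) lam) (x₁ : M) :
    ∀ᶠ x in 𝓝 x₁, ∀ v v' : TangentSpace (𝓡 m) x, extDerivOneForm (𝓡 m) lam x v v' =
      extDerivInChart lam x₁ (extChartAt (𝓡 m) x₁ x) (chartDeriv x₁ x v) (chartDeriv x₁ x v') := by
  filter_upwards [extDerivOneForm_eq_in_chart hlam x₁] with x hx v v'
  exact hx v v'

theorem chartDeriv_bijective {x₁ x : M} (hx : x ∈ (extChartAt (𝓡 m) x₁).source) :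
    Function.Bijective (chartDeriv (m := m) x₁ x) :=
  (isInvertible_mfderiv_extChartAt hx).bijective

theorem lam_eq_oneFormInChart {x₁ x : M} (hx : x ∈ (extChartAt (𝓡 m) x₁).source)
    (v : TangentSpace (𝓡 m) x) :
    lam x v = oneFormInChart (𝓡 m) lam x₁ (extChartAt (𝓡 m) x₁ x) (chartDeriv x₁ x v) := by
  have h1 := (extChartAt (𝓡 m) x₁).left_inv hx
  have h2 : ∀ y : M, y = x → ∀ z : EuclideanSpace ℝ (Fin m), lam x z = lam y z := by
    rintro y rfl z; rfl
  have h3 := congrArg (fun L ↦ L v) (mfderivWithin_extChartAt_symm_comp_mfderiv_extChartAt' hx)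
  have h4 : lam x v = lam x (mfderivWithin 𝓘(ℝ, EuclideanSpace ℝ (Fin m)) (𝓡 m)
      (extChartAt (𝓡 m) x₁).symm (range (𝓡 m)) (extChartAt (𝓡 m) x₁ x) (chartDeriv x₁ x v)) :=
    congrArg (lam x) h3.symm
  rw [h4]
  exact h2 _ h1 _

theorem continuousAt_oneFormInChart (hlam : IsSmoothOneForm (𝓡 m) lam) (x₁ : M) :
    ContinuousAt (fun x ↦ oneFormInChart (𝓡 m) lam x₁ (extChartAt (𝓡 m) x₁ x)) x₁ :=
  (contDiffAt_oneFormInChart hlam x₁).continuousAt.comp (continuousAt_extChartAt x₁)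

theorem continuousAt_extDerivInChart (hlam : IsSmoothOneForm (𝓡 m) lam) (x₁ : M) :
    ContinuousAt (fun x ↦ extDerivInChart lam x₁ (extChartAt (𝓡 m) x₁ x)) x₁ := by
  have h1 : ContinuousAt (fderiv ℝ (oneFormInChart (𝓡 m) lam x₁)) (extChartAt (𝓡 m) x₁ x₁) :=
    ((contDiffAt_oneFormInChart hlam x₁).fderiv_right (m := ∞) (by simp)).continuousAt
  have h2 : ContinuousAt (extDerivInChart lam x₁) (extChartAt (𝓡 m) x₁ x₁) := by
    exact continuous_sub_flip.continuousAt.comp h1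
  exact h2.comp (continuousAt_extChartAt x₁)

theorem continuousAt_inverse_extDerivInChart (hlam : IsSmoothOneForm (𝓡 m) lam)
    (hnd : HasNondegenerateDeriv (𝓡 m) lam) (x₁ : M) :
    ContinuousAt (fun x ↦ (extDerivInChart lam x₁ (extChartAt (𝓡 m) x₁ x)).inverse) x₁ := by
  have h1 := (dualVector_in_coordinates (hnd x₁)
    (chartDeriv_bijective (mem_extChartAt_source (I := 𝓡 m) x₁))
    (extDerivOneForm_eventually_eq hlam x₁).self_of_nhds
    (lam_eq_oneFormInChart (lam := lam) (mem_extChartAt_source (I := 𝓡 m) x₁))).1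
  have h2 := (h1.contDiffAt_map_inverse (n := 0)).continuousAt
  exact ContinuousAt.comp (f := fun x ↦ extDerivInChart lam x₁ (extChartAt (𝓡 m) x₁ x)) h2
    (continuousAt_extDerivInChart hlam x₁)

theorem chartDeriv_dualVector (hlam : IsSmoothOneForm (𝓡 m) lam)
    (hnd : HasNondegenerateDeriv (𝓡 m) lam) (x₁ : M) :
    ∀ᶠ x in 𝓝 x₁, ∀ (ℓ : TangentSpace (𝓡 m) x →L[ℝ] ℝ) (k : EuclideanSpace ℝ (Fin m) →L[ℝ] ℝ),
      (∀ v, ℓ v = k (chartDeriv x₁ x v)) →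
      chartDeriv x₁ x (dualVector (extDerivOneForm (𝓡 m) lam x) ℓ) =
        (extDerivInChart lam x₁ (extChartAt (𝓡 m) x₁ x)).inverse k := by
  filter_upwards [extDerivOneForm_eventually_eq hlam x₁,
    extChartAt_source_mem_nhds (I := 𝓡 m) x₁] with x h1 h2 ℓ k hk
  exact (dualVector_in_coordinates (hnd x) (chartDeriv_bijective h2) h1 hk).2

/-- The differential of `H s` in the preferred chart at `x₁`. -/
def derivInChart (H : ℝ → M → ℝ) (x₁ : M) (q : ℝ × M) : EuclideanSpace ℝ (Fin m) →L[ℝ] ℝ :=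
  (fderiv ℝ (fun p : ℝ × EuclideanSpace ℝ (Fin m) ↦ H p.1 ((extChartAt (𝓡 m) x₁).symm p.2))
    (q.1, extChartAt (𝓡 m) x₁ q.2)).comp (ContinuousLinearMap.inr ℝ ℝ (EuclideanSpace ℝ (Fin m)))

theorem contDiffAt_in_chart {H : ℝ → M → ℝ}
    (hH : ContMDiff (𝓘(ℝ, ℝ).prod (𝓡 m)) 𝓘(ℝ, ℝ) ∞ (fun p : ℝ × M ↦ H p.1 p.2)) (s : ℝ) (x₁ : M) :
    ContDiffAt ℝ ∞ (fun p : ℝ × EuclideanSpace ℝ (Fin m) ↦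
      H p.1 ((extChartAt (𝓡 m) x₁).symm p.2)) (s, extChartAt (𝓡 m) x₁ x₁) := by
  have h2 : ContMDiffAt 𝓘(ℝ, EuclideanSpace ℝ (Fin m)) (𝓡 m) ∞ (extChartAt (𝓡 m) x₁).symm
      (extChartAt (𝓡 m) x₁ x₁) :=
    (contMDiffOn_extChartAt_symm x₁).contMDiffAt (extChartAt_target_mem_nhds x₁)
  have h1 : ContMDiffAt 𝓘(ℝ, ℝ × EuclideanSpace ℝ (Fin m)) (𝓘(ℝ, ℝ).prod (𝓡 m)) ∞
      (fun p : ℝ × EuclideanSpace ℝ (Fin m) ↦ (p.1, (extChartAt (𝓡 m) x₁).symm p.2))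
      (s, extChartAt (𝓡 m) x₁ x₁) := by
    refine ContMDiffAt.prodMk ?_ ?_
    · exact contDiff_fst.contMDiff.contMDiffAt
    · exact ContMDiffAt.comp (s, extChartAt (𝓡 m) x₁ x₁) h2 contDiff_snd.contMDiff.contMDiffAt
  exact ((hH _).comp _ h1).contDiffAt

theorem continuousAt_derivInChart {H : ℝ → M → ℝ}
    (hH : ContMDiff (𝓘(ℝ, ℝ).prod (𝓡 m)) 𝓘(ℝ, ℝ) ∞ (fun p : ℝ × M ↦ H p.1 p.2)) (s : ℝ) (x₁ : M) :
    ContinuousAt (derivInChart (m := m) H x₁) (s, x₁) := by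
  have h1 := ((contDiffAt_in_chart hH s x₁).fderiv_right (m := ∞) (by simp)).continuousAt
  have h2 : ContinuousAt (fun q : ℝ × M ↦ (q.1, extChartAt (𝓡 m) x₁ q.2)) (s, x₁) :=
    continuousAt_fst.prodMk (ContinuousAt.comp (continuousAt_extChartAt x₁) continuousAt_snd)
  have h3 := ContinuousAt.comp (f := fun q : ℝ × M ↦ (q.1, extChartAt (𝓡 m) x₁ q.2)) h1 h2
  exact h3.clm_comp continuousAt_const

theorem mfderiv_eq_derivInChart {H : ℝ → M → ℝ}
    (hH : ContMDiff (𝓘(ℝ, ℝ).prod (𝓡 m)) 𝓘(ℝ, ℝ) ∞ (fun p : ℝ × M ↦ H p.1 p.2)) (s : ℝ) (x₁ : M) :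
    ∀ᶠ q in 𝓝 (s, x₁), ∀ v : TangentSpace (𝓡 m) q.2,
      mfderiv (𝓡 m) 𝓘(ℝ, ℝ) (H q.1) q.2 v = derivInChart H x₁ q (chartDeriv x₁ q.2 v) := by
  have h0 : ∀ᶠ p in 𝓝 (s, extChartAt (𝓡 m) x₁ x₁), ContDiffAt ℝ 1
      (fun p : ℝ × EuclideanSpace ℝ (Fin m) ↦ H p.1 ((extChartAt (𝓡 m) x₁).symm p.2)) p :=
    ((contDiffAt_in_chart hH s x₁).of_le (by norm_num)).eventually (by simp)
  have h2 : ContinuousAt (fun q : ℝ × M ↦ (q.1, extChartAt (𝓡 m) x₁ q.2)) (s, x₁) :=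
    continuousAt_fst.prodMk (ContinuousAt.comp (continuousAt_extChartAt x₁) continuousAt_snd)
  have h3 : ∀ᶠ q : ℝ × M in 𝓝 (s, x₁), q.2 ∈ (extChartAt (𝓡 m) x₁).source :=
    continuousAt_snd.eventually (extChartAt_source_mem_nhds (I := 𝓡 m) x₁)
  filter_upwards [h2.eventually h0, h3] with q hq hs v
  have hs' : q.2 ∈ (chartAt (EuclideanSpace ℝ (Fin m)) x₁).source := by
    rwa [← extChartAt_source (𝓡 m)]
  have hd : HasFDerivAt (fun y ↦ H q.1 ((extChartAt (𝓡 m) x₁).symm y)) (derivInChart H x₁ q)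
      (extChartAt (𝓡 m) x₁ q.2) := by
    have := (hq.differentiableAt (by simp)).hasFDerivAt
    exact this.comp (extChartAt (𝓡 m) x₁ q.2) (hasFDerivAt_prodMk_right q.1 _)
  have e : H q.1 =ᶠ[𝓝 q.2] (fun y ↦ H q.1 ((extChartAt (𝓡 m) x₁).symm y)) ∘
      extChartAt (𝓡 m) x₁ := by
    filter_upwards [(isOpen_extChartAt_source x₁).mem_nhds hs] with x hx
    exact congrArg (H q.1) ((extChartAt (𝓡 m) x₁).left_inv hx).symm
  have hc := (hd.hasMFDerivAt.comp q.2
    (mdifferentiableAt_extChartAt hs').hasMFDerivAt).mfderiv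
  rw [e.mfderiv_eq, hc]
  rfl

variable {J : ℝ → ∀ w : M, TangentSpace (𝓡 m) w →L[ℝ] TangentSpace (𝓡 m) w}

/-- K is the coordinate matrix of J in the trivializations at `x₁`; its continuity is all that is
needed of the smoothness of J. -/
theorem exists_continuousAt_in_chart (hJ : IsCompatibleLoop lam J) (t : ℝ) (x₁ : M) :
    ∃ K : ℝ × M → EuclideanSpace ℝ (Fin m) →L[ℝ] EuclideanSpace ℝ (Fin m),
      ContinuousAt K (t, x₁) ∧ ∀ᶠ q in 𝓝 (t, x₁), ∀ v : TangentSpace (𝓡 m) q.2,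
        chartDeriv x₁ q.2 (J q.1 q.2 v) = K q (chartDeriv x₁ q.2 v) := by
  have h1 := ((contMDiffAt_hom_bundle _).1 (hJ.smooth (t, x₁))).2.continuousAt
  refine ⟨_, h1, ?_⟩
  have h3 : ∀ᶠ q : ℝ × M in 𝓝 (t, x₁), q.2 ∈ (extChartAt (𝓡 m) x₁).source :=
    continuousAt_snd.eventually (extChartAt_source_mem_nhds (I := 𝓡 m) x₁)
  filter_upwards [h3] with q hs v
  have hs' : q.2 ∈ (chartAt (EuclideanSpace ℝ (Fin m)) x₁).source := by
    rwa [← extChartAt_source (𝓡 m)]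
  simp only [ContinuousLinearMap.inCoordinates]
  rw [TangentBundle.symmL_trivializationAt hs',
    TangentBundle.continuousLinearMapAt_trivializationAt hs']
  have h4 := congrArg (fun L ↦ L v) (mfderivWithin_extChartAt_symm_comp_mfderiv_extChartAt' hs)
  exact congrArg (fun z ↦ chartDeriv x₁ q.2 (J q.1 q.2 z)) h4.symm

theorem continuous_lam_hamiltonianVF (hlam : IsSmoothOneForm (𝓡 m) lam)
    (hnd : HasNondegenerateDeriv (𝓡 m) lam) {H : ℝ → M → ℝ}
    (hH : ContMDiff (𝓘(ℝ, ℝ).prod (𝓡 m)) 𝓘(ℝ, ℝ) ∞ (fun p : ℝ × M ↦ H p.1 p.2)) :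
    Continuous fun q : ℝ × M ↦ lam q.2 (hamiltonianVF lam (H q.1) q.2) := by
  refine continuous_iff_continuousAt.2 fun ⟨s, x₁⟩ ↦ ?_
  have hsnd : Tendsto (fun q : ℝ × M ↦ q.2) (𝓝 (s, x₁)) (𝓝 x₁) := continuousAt_snd
  have c1 := ContinuousAt.comp (f := fun q : ℝ × M ↦ q.2) (x := (s, x₁))
    (continuousAt_oneFormInChart hlam x₁) continuousAt_snd
  have c2 := ContinuousAt.comp (f := fun q : ℝ × M ↦ q.2) (x := (s, x₁))
    (continuousAt_inverse_extDerivInChart hlam hnd x₁) continuousAt_snd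
  have c3 := continuousAt_derivInChart hH s x₁
  refine (c1.clm_apply (c2.clm_apply c3.neg)).congr_of_eventuallyEq ?_
  filter_upwards [hsnd.eventually (chartDeriv_dualVector hlam hnd x₁),
    mfderiv_eq_derivInChart hH s x₁,
    hsnd.eventually (extChartAt_source_mem_nhds (I := 𝓡 m) x₁)] with q h1 h2 h3
  rw [lam_eq_oneFormInChart h3, hamiltonianVF, h1 _ (-derivInChart H x₁ q)]
  · rfl
  · intro v
    exact congrArg Neg.neg (h2 v)

/-- Up to sign this function is |Y|², the squared norm of λ, so continuity makes the comparison of λ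
with the metric uniform on compact sets. -/
theorem continuous_lam_liouvilleVF (hlam : IsSmoothOneForm (𝓡 m) lam)
    (hnd : HasNondegenerateDeriv (𝓡 m) lam) (hJ : IsCompatibleLoop lam J) :
    Continuous fun q : ℝ × M ↦ lam q.2 (J q.1 q.2 (liouvilleVF lam q.2)) := by
  refine continuous_iff_continuousAt.2 fun ⟨t, x₁⟩ ↦ ?_
  have hsnd : Tendsto (fun q : ℝ × M ↦ q.2) (𝓝 (t, x₁)) (𝓝 x₁) := continuousAt_snd
  have c1 := ContinuousAt.comp (f := fun q : ℝ × M ↦ q.2) (x := (t, x₁))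
    (continuousAt_oneFormInChart hlam x₁) continuousAt_snd
  have c2 := ContinuousAt.comp (f := fun q : ℝ × M ↦ q.2) (x := (t, x₁))
    (continuousAt_inverse_extDerivInChart hlam hnd x₁) continuousAt_snd
  obtain ⟨K, c3, hK⟩ := exists_continuousAt_in_chart hJ t x₁
  refine (c1.clm_apply (c3.clm_apply (c2.clm_apply c1))).congr_of_eventuallyEq ?_
  filter_upwards [hsnd.eventually (chartDeriv_dualVector hlam hnd x₁), hK,
    hsnd.eventually (extChartAt_source_mem_nhds (I := 𝓡 m) x₁)] with q h1 h2 h3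
  rw [lam_eq_oneFormInChart h3, h2, liouvilleVF, h1 _ _ (lam_eq_oneFormInChart h3)]
  rfl

/-- This function is |X_H|², the squared norm of dH, jointly continuous in both time parameters and
the point. -/
theorem continuous_mfderiv_hamiltonianVF (hlam : IsSmoothOneForm (𝓡 m) lam)
    (hnd : HasNondegenerateDeriv (𝓡 m) lam) (hJ : IsCompatibleLoop lam J) {H : ℝ → M → ℝ}
    (hH : ContMDiff (𝓘(ℝ, ℝ).prod (𝓡 m)) 𝓘(ℝ, ℝ) ∞ (fun p : ℝ × M ↦ H p.1 p.2)) :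
    Continuous fun q : ℝ × ℝ × M ↦ (mfderiv (𝓡 m) 𝓘(ℝ, ℝ) (H q.2.1) q.2.2
      (J q.1 q.2.2 (hamiltonianVF lam (H q.2.1) q.2.2)) : ℝ) := by
  refine continuous_iff_continuousAt.2 fun ⟨t, s, x₁⟩ ↦ ?_
  have hsnd : ContinuousAt (fun q : ℝ × ℝ × M ↦ q.2) (t, s, x₁) := continuousAt_snd
  have hss : ContinuousAt (fun q : ℝ × ℝ × M ↦ q.2.2) (t, s, x₁) := by fun_prop
  have hts : ContinuousAt (fun q : ℝ × ℝ × M ↦ (q.1, q.2.2)) (t, s, x₁) := by fun_prop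
  have c1 := ContinuousAt.comp (f := fun q : ℝ × ℝ × M ↦ q.2) (x := (t, s, x₁))
    (continuousAt_derivInChart hH s x₁) hsnd
  have c2 := ContinuousAt.comp (f := fun q : ℝ × ℝ × M ↦ q.2.2) (x := (t, s, x₁))
    (continuousAt_inverse_extDerivInChart hlam hnd x₁) hss
  obtain ⟨K, c3, hK⟩ := exists_continuousAt_in_chart hJ t x₁
  have c4 := ContinuousAt.comp (f := fun q : ℝ × ℝ × M ↦ (q.1, q.2.2)) (x := (t, s, x₁)) c3 hts
  refine (c1.clm_apply (c4.clm_apply (c2.clm_apply c1.neg))).congr_of_eventuallyEq ?_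
  filter_upwards [hss.eventually (chartDeriv_dualVector hlam hnd x₁), hts.eventually hK,
    hsnd.eventually (mfderiv_eq_derivInChart hH s x₁)] with q h1 h2 h3
  have e1 : chartDeriv x₁ q.2.2 (hamiltonianVF lam (H q.2.1) q.2.2) =
      (extDerivInChart lam x₁ (extChartAt (𝓡 m) x₁ q.2.2)).inverse (-derivInChart H x₁ q.2) := by
    rw [hamiltonianVF, h1 _ (-derivInChart H x₁ q.2)]
    intro v
    exact congrArg Neg.neg (h3 v)
  exact (h3 _).trans (by rw [h2, e1]; rfl)

end Continuity

/-! ### Linear algebra of a compatible complex structure -/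

section CompatibleForm

variable {V : Type*} [AddCommGroup V] [Module ℝ V] [TopologicalSpace V]
  {Ω : V →L[ℝ] V →L[ℝ] ℝ} {j : V →L[ℝ] V}

theorem compatible_nonneg (hpos : ∀ v, v ≠ 0 → 0 < Ω (j v) v) (v : V) : 0 ≤ Ω (j v) v := by
  rcases eq_or_ne v 0 with rfl | hv
  · simp
  · exact (hpos v hv).le

/-- The usual discriminant argument for the quadratic polynomial x ↦ |x v + v'|². -/
theorem compatible_cauchySchwarz (hsymm : ∀ v v', Ω (j v) v' = Ω (j v') v)
    (hpos : ∀ v, v ≠ 0 → 0 < Ω (j v) v) (v v' : V) :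
    Ω (j v) v' ^ 2 ≤ Ω (j v) v * Ω (j v') v' := by
  have h : ∀ x : ℝ, 0 ≤ Ω (j v) v * (x * x) + (2 * Ω (j v) v') * x + Ω (j v') v' := by
    intro x
    have h1 := compatible_nonneg hpos (x • v + v')
    have h2 : Ω (j (x • v + v')) (x • v + v') =
        Ω (j v) v * (x * x) + (Ω (j v) v' + Ω (j v') v) * x + Ω (j v') v' := by
      have e1 : j (x • v + v') = x • j v + j v' := by rw [map_add, map_smul]
      have e2 : Ω (x • j v + j v') = x • Ω (j v) + Ω (j v') := by rw [map_add, map_smul]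
      rw [e1, e2, map_add, map_smul]
      show x • (x * Ω (j v) v + Ω (j v') v) + (x * Ω (j v) v' + Ω (j v') v') = _
      rw [smul_eq_mul]
      ring
    rw [h2, ← hsymm v v'] at h1
    linarith
  have := discrim_le_zero h
  rw [discrim] at this
  linarith

/-- The bound of a linear form by the norm of its dual vector. -/
theorem sq_le_of_dual (hsq : ∀ v, j (j v) = -v) (hsymm : ∀ v v', Ω (j v) v' = Ω (j v') v)
    (hpos : ∀ v, v ≠ 0 → 0 < Ω (j v) v) (Z v : V) :
    Ω Z v ^ 2 ≤ (-Ω Z (j Z)) * Ω (j v) v := by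
  have h1 := compatible_cauchySchwarz hsymm hpos (j Z) v
  rw [hsq, map_neg] at h1
  have h2 : ∀ w, (-Ω Z) w = -Ω Z w := fun w ↦ rfl
  rw [h2, h2] at h1
  linarith

end CompatibleForm

/-! ### The Liouville and Hamiltonian vector fields -/

section LiouvilleGeometry

variable {m : ℕ} {M : Type*} [TopologicalSpace M] [ChartedSpace (EuclideanSpace ℝ (Fin m)) M]
  {lam : ∀ w : M, TangentSpace (𝓡 m) w →L[ℝ] ℝ}
  {J : ℝ → ∀ w : M, TangentSpace (𝓡 m) w →L[ℝ] TangentSpace (𝓡 m) w}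

/-- The differential of a real function, as a one-form. -/
def differential (F : M → ℝ) (w : M) : TangentSpace (𝓡 m) w →L[ℝ] ℝ :=
  mfderiv (𝓡 m) 𝓘(ℝ, ℝ) F w

theorem liouvilleVF_spec (hnd : HasNondegenerateDeriv (𝓡 m) lam) (w : M)
    (v : TangentSpace (𝓡 m) w) :
    extDerivOneForm (𝓡 m) lam w (liouvilleVF lam w) v = lam w v :=
  dualVector_spec _ (hnd w) _ v

theorem hamiltonianVF_spec (hnd : HasNondegenerateDeriv (𝓡 m) lam) (F : M → ℝ) (w : M)
    (v : TangentSpace (𝓡 m) w) :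
    extDerivOneForm (𝓡 m) lam w (hamiltonianVF lam F w) v = -differential F w v :=
  dualVector_spec _ (hnd w) _ v

theorem differential_hamiltonianVF_self (hnd : HasNondegenerateDeriv (𝓡 m) lam) (F : M → ℝ) (w : M) :
    differential F w (hamiltonianVF lam F w) = 0 := by
  have h1 := hamiltonianVF_spec hnd F w (hamiltonianVF lam F w)
  have h2 := extDerivOneForm_neg_swap (lam := lam) w (hamiltonianVF lam F w)
    (hamiltonianVF lam F w)
  linarith

theorem lam_hamiltonianVF (hnd : HasNondegenerateDeriv (𝓡 m) lam) (F : M → ℝ) (w : M) :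
    lam w (hamiltonianVF lam F w) = differential F w (liouvilleVF lam w) := by
  rw [← liouvilleVF_spec hnd, extDerivOneForm_neg_swap, hamiltonianVF_spec hnd, neg_neg]

variable [IsManifold (𝓡 m) ∞ M]

theorem IsCompatibleLoop.nonneg (hJ : IsCompatibleLoop lam J) (t : ℝ) (w : M)
    (v : TangentSpace (𝓡 m) w) : 0 ≤ extDerivOneForm (𝓡 m) lam w (J t w v) v :=
  compatible_nonneg (hJ.pos t w) v

/-- J is an isometry of its own metric, so J ∂_s u may be exchanged for ∂_s u in every norm. -/
theorem IsCompatibleLoop.map_map (hJ : IsCompatibleLoop lam J) (t : ℝ) (w : M)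
    (v : TangentSpace (𝓡 m) w) : extDerivOneForm (𝓡 m) lam w (J t w (J t w v)) (J t w v) =
      extDerivOneForm (𝓡 m) lam w (J t w v) v := by
  rw [hJ.symm, hJ.sq, extDerivOneForm_neg_swap, map_neg, neg_neg]

theorem IsCompatibleLoop.lam_sq_le (hJ : IsCompatibleLoop lam J)
    (hnd : HasNondegenerateDeriv (𝓡 m) lam) (t : ℝ) (w : M) (v : TangentSpace (𝓡 m) w) :
    lam w v ^ 2 ≤ (-lam w (J t w (liouvilleVF lam w))) *
      extDerivOneForm (𝓡 m) lam w (J t w v) v := by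
  have := sq_le_of_dual (hJ.sq t w) (hJ.symm t w) (hJ.pos t w) (liouvilleVF lam w) v
  rwa [liouvilleVF_spec hnd, liouvilleVF_spec hnd] at this

theorem IsCompatibleLoop.differential_sq_le (hJ : IsCompatibleLoop lam J)
    (hnd : HasNondegenerateDeriv (𝓡 m) lam) (F : M → ℝ) (t : ℝ) (w : M)
    (v : TangentSpace (𝓡 m) w) :
    differential F w v ^ 2 ≤
      differential F w (J t w (hamiltonianVF lam F w)) *
      extDerivOneForm (𝓡 m) lam w (J t w v) v := by
  have := sq_le_of_dual (hJ.sq t w) (hJ.symm t w) (hJ.pos t w) (hamiltonianVF lam F w) v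
  rw [hamiltonianVF_spec hnd, hamiltonianVF_spec hnd] at this
  rwa [neg_sq, neg_neg] at this

end LiouvilleGeometry

/-! ### The symplectization: Y = ρ ∂_ρ -/

section Collar

open Filter

variable {n : ℕ} [NeZero n] {W : Type*} [TopologicalSpace W]
  [ChartedSpace (EuclideanHalfSpace (2 * n)) W] [IsManifold (𝓡∂ (2 * n)) ∞ W]
  [T2Space W] [CompactSpace W] [ConnectedSpace W] {D : LiouvilleDomain n W}
  {N : Type*} [TopologicalSpace N] [ChartedSpace (EuclideanSpace ℝ (Fin (2 * n - 1))) N]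
  [IsManifold (𝓡 (2 * n - 1)) ∞ N]
  {What : Type*} [TopologicalSpace What] [ChartedSpace (EuclideanSpace ℝ (Fin (2 * n))) What]
  [IsManifold (𝓡 (2 * n)) ∞ What] [T2Space What]

namespace LiouvilleCompletion

variable (C : LiouvilleCompletion D N What)

theorem mem_source {q : N × ℝ} (hq : 0 < q.2) : q ∈ C.collar.source := by
  rw [C.collar_source]; exact ⟨mem_univ _, hq⟩

theorem radius_collar {q : N × ℝ} (hq : 0 < q.2) : C.radius (C.collar q) = q.2 := by
  rw [radius, C.collar.left_inv (C.mem_source hq)]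

theorem contMDiffAt_collar {q : N × ℝ} (hq : 0 < q.2) :
    ContMDiffAt ((𝓡 (2 * n - 1)).prod 𝓘(ℝ, ℝ)) (𝓡 (2 * n)) ∞ C.collar q :=
  C.collar_smooth.contMDiffAt (C.collar.open_source.mem_nhds (C.mem_source hq))

theorem contMDiffAt_collar_symm {w : What} (hw : w ∈ C.collar.target) :
    ContMDiffAt (𝓡 (2 * n)) ((𝓡 (2 * n - 1)).prod 𝓘(ℝ, ℝ)) ∞ C.collar.symm w :=
  C.collar_symm_smooth.contMDiffAt (C.collar.open_target.mem_nhds hw)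

theorem contMDiffAt_radius {w : What} (hw : w ∈ C.collar.target) :
    ContMDiffAt (𝓡 (2 * n)) 𝓘(ℝ, ℝ) ∞ C.radius w :=
  contMDiffAt_snd.comp w (C.contMDiffAt_collar_symm hw)

/-- The derivative of the collar has a right inverse, the derivative of its smooth inverse. -/
theorem exists_mfderiv_collar_eq {q : N × ℝ} (hq : 0 < q.2)
    (v : TangentSpace (𝓡 (2 * n)) (C.collar q)) :
    ∃ a : TangentSpace ((𝓡 (2 * n - 1)).prod 𝓘(ℝ, ℝ)) q,
      mfderiv ((𝓡 (2 * n - 1)).prod 𝓘(ℝ, ℝ)) (𝓡 (2 * n)) C.collar q a = v := by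
  have hw : C.collar q ∈ C.collar.target := C.collar.map_source (C.mem_source hq)
  have h1 := (C.contMDiffAt_collar_symm hw).mdifferentiableAt (by simp)
  have hqe : C.collar.symm (C.collar q) = q := C.collar.left_inv (C.mem_source hq)
  have e : (C.collar ∘ C.collar.symm) =ᶠ[𝓝 (C.collar q)] id := by
    filter_upwards [C.collar.open_target.mem_nhds hw] with w hw
    exact C.collar.right_inv hw
  have h2 : MDifferentiableAt ((𝓡 (2 * n - 1)).prod 𝓘(ℝ, ℝ)) (𝓡 (2 * n)) C.collar
      (C.collar.symm (C.collar q)) := by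
    rw [hqe]; exact (C.contMDiffAt_collar hq).mdifferentiableAt (by simp)
  have h3 := mfderiv_comp (C.collar q) h2 h1
  rw [e.mfderiv_eq, mfderiv_id] at h3
  have h4 := congrArg (fun L ↦ L v) h3
  have h5 : ∀ q' : N × ℝ, q' = q → ∀ z : EuclideanSpace ℝ (Fin (2 * n - 1)) × ℝ,
      (mfderiv ((𝓡 (2 * n - 1)).prod 𝓘(ℝ, ℝ)) (𝓡 (2 * n)) C.collar q' z :
        EuclideanSpace ℝ (Fin (2 * n))) =
      mfderiv ((𝓡 (2 * n - 1)).prod 𝓘(ℝ, ℝ)) (𝓡 (2 * n)) C.collar q z := by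
    rintro q' rfl z; rfl
  exact ⟨_, (h4.trans (h5 _ hqe _)).symm⟩

/-- The radial vector field on the collar. -/
def radial (q : N × ℝ) : TangentSpace (𝓡 (2 * n)) (C.collar q) :=
  mfderiv ((𝓡 (2 * n - 1)).prod 𝓘(ℝ, ℝ)) (𝓡 (2 * n)) C.collar q
    ((0 : EuclideanSpace ℝ (Fin (2 * n - 1))), (1 : ℝ))

theorem differential_radius_radial {q : N × ℝ} (hq : 0 < q.2) :
    differential C.radius (C.collar q) (C.radial q) = 1 := by
  have hw : C.collar q ∈ C.collar.target := C.collar.map_source (C.mem_source hq)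
  have h1 := (C.contMDiffAt_radius hw).mdifferentiableAt (by simp)
  have h2 := (C.contMDiffAt_collar hq).mdifferentiableAt (by simp)
  have e : (C.radius ∘ C.collar) =ᶠ[𝓝 q] Prod.snd := by
    filter_upwards [C.collar.open_source.mem_nhds (C.mem_source hq)] with p hp
    rw [C.collar_source] at hp
    exact C.radius_collar hp.2
  have h3 := mfderiv_comp_of_eq (x := q) h1 h2 rfl
  rw [e.mfderiv_eq, mfderiv_snd] at h3
  have h4 := congrArg (fun L ↦ L ((0 : EuclideanSpace ℝ (Fin (2 * n - 1))), (1 : ℝ))) h3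
  exact h4.symm

/-- On the collar λ = ρ α, hence ω(∂_ρ, ·) = α = λ / ρ. The computation is made on a two-parameter
family through (x, ρ): the coefficient of λ in the first direction, which is radial, is 0, and its
coefficient in the second has derivative α(ξ) in the first. -/
theorem extDerivOneForm_radial {x : N} {ρ : ℝ} (hρ : 0 < ρ)
    (v : TangentSpace (𝓡 (2 * n)) (C.collar (x, ρ))) :
    ρ * extDerivOneForm (𝓡 (2 * n)) C.lam (C.collar (x, ρ)) (C.radial (x, ρ)) v =
      C.lam (C.collar (x, ρ)) v := by
  obtain ⟨a, rfl⟩ := C.exists_mfderiv_collar_eq (q := (x, ρ)) hρ v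
  set ξ : EuclideanSpace ℝ (Fin (2 * n - 1)) := a.1 with hξ
  set r : ℝ := a.2 with hr
  set φ := extChartAt (𝓡 (2 * n - 1)) x with hφ
  set α : ℝ := D.lam (C.bd x) (mfderiv (𝓡 (2 * n - 1)) (𝓡∂ (2 * n)) C.bd x ξ) with hα
  let c : ℝ → N := fun t ↦ φ.symm (φ x + t • ξ)
  have hc0 : c 0 = x := by
    simp only [c, zero_smul, add_zero]; exact φ.left_inv (mem_extChartAt_source x)
  have hcs : ContMDiffAt 𝓘(ℝ, ℝ) (𝓡 (2 * n - 1)) ∞ c 0 := by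
    have h1 : ContMDiffAt 𝓘(ℝ, EuclideanSpace ℝ (Fin (2 * n - 1))) (𝓡 (2 * n - 1)) ∞ φ.symm
        (φ x + (0 : ℝ) • ξ) := by
      refine (contMDiffOn_extChartAt_symm x).contMDiffAt ?_
      simp only [zero_smul, add_zero]
      exact extChartAt_target_mem_nhds x
    refine h1.comp (0 : ℝ) ?_
    exact (contDiff_const.add (contDiff_id.smul contDiff_const)).contDiffAt.contMDiffAt
  have hc' : HEq (mfderiv 𝓘(ℝ, ℝ) (𝓡 (2 * n - 1)) c 0 (1 : ℝ)) ξ := by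
    have h1 := (mfderiv_eventually_eq hcs x (by rw [hc0]; exact mem_chart_source _ _)
      ).self_of_nhds.2.2 1
    rw [hc0, mfderivWithin_range_extChartAt_symm] at h1
    have h2 : φ ∘ c =ᶠ[𝓝 0] fun t ↦ φ x + t • ξ := by
      have hcont : ContinuousAt (fun t : ℝ ↦ φ x + t • ξ) 0 := by fun_prop
      filter_upwards [hcont.eventually (by
        simp only [zero_smul, add_zero]; exact extChartAt_target_mem_nhds x)] with t ht
      exact φ.right_inv ht
    have h3 : HasFDerivAt (fun t : ℝ ↦ φ x + t • ξ)
        ((ContinuousLinearMap.id ℝ ℝ).smulRight ξ) 0 :=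
      ((hasFDerivAt_id (0 : ℝ)).smul_const ξ).const_add _
    have h4 : fderiv ℝ (φ ∘ c) 0 1 = ξ := by
      rw [h2.fderiv_eq, h3.fderiv]; simp
    rw [h4] at h1
    exact heq_of_eq h1
  -- The slope r makes the second partial derivative at the origin equal to (ξ, r), the preimage of
  -- the given vector; the first one is ∂_ρ.
  let g : ℝ × ℝ → N × ℝ := fun p ↦ (c p.2, ρ + p.1 + r * p.2)
  let u : ℝ × ℝ → What := fun p ↦ C.collar (g p)
  have hg0 : g 0 = (x, ρ) := by simp [g, hc0]
  have hcp : ∀ᶠ t in 𝓝 (0 : ℝ), ContMDiffAt 𝓘(ℝ, ℝ) (𝓡 (2 * n - 1)) 1 c t :=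
    (contMDiffAt_iff_contMDiffAt_nhds (by simp)).1 (hcs.of_le (by norm_num))
  have haff : ∀ p : ℝ × ℝ, HasFDerivAt (fun p : ℝ × ℝ ↦ ρ + p.1 + r * p.2)
      (ContinuousLinearMap.fst ℝ ℝ ℝ + r • ContinuousLinearMap.snd ℝ ℝ ℝ) p := fun p ↦
    (hasFDerivAt_fst.const_add ρ).add (hasFDerivAt_snd.const_mul r)
  have hus : ContMDiffAt 𝓘(ℝ, ℝ × ℝ) (𝓡 (2 * n)) ∞ u 0 := by
    have h1 : ContMDiffAt 𝓘(ℝ, ℝ × ℝ) ((𝓡 (2 * n - 1)).prod 𝓘(ℝ, ℝ)) ∞ g 0 := by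
      refine ContMDiffAt.prodMk ?_ ?_
      · exact ContMDiffAt.comp (f := fun p : ℝ × ℝ ↦ p.2) (g := c) (0 : ℝ × ℝ) hcs
          contDiff_snd.contMDiff.contMDiffAt
      · exact ContDiff.contMDiff (by fun_prop) |>.contMDiffAt
    refine ContMDiffAt.comp (0 : ℝ × ℝ) ?_ h1
    rw [hg0]
    exact C.contMDiffAt_collar hρ
  have hmu : ∀ p : ℝ × ℝ, 0 < (g p).2 → ContMDiffAt 𝓘(ℝ, ℝ) (𝓡 (2 * n - 1)) 1 c p.2 →
      ∀ b : ℝ × ℝ, mfderiv 𝓘(ℝ, ℝ × ℝ) (𝓡 (2 * n)) u p b =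
        mfderiv ((𝓡 (2 * n - 1)).prod 𝓘(ℝ, ℝ)) (𝓡 (2 * n)) C.collar (g p)
          (mfderiv 𝓘(ℝ, ℝ) (𝓡 (2 * n - 1)) c p.2 b.2, b.1 + r * b.2) := by
    intro p hp hcp b
    have h1 : HasMFDerivAt 𝓘(ℝ, ℝ × ℝ) (𝓡 (2 * n - 1)) (fun p : ℝ × ℝ ↦ c p.2) p
        ((mfderiv 𝓘(ℝ, ℝ) (𝓡 (2 * n - 1)) c p.2).comp (ContinuousLinearMap.snd ℝ ℝ ℝ)) :=
      (hcp.mdifferentiableAt (by simp)).hasMFDerivAt.comp p hasFDerivAt_snd.hasMFDerivAt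
    have h2 := h1.prodMk (haff p).hasMFDerivAt
    have h3 := ((C.contMDiffAt_collar hp).mdifferentiableAt (by simp)).hasMFDerivAt.comp p h2
    have h4 := congrArg (fun L ↦ L b) h3.mfderiv
    exact h4
  have hgpos : ∀ᶠ p in 𝓝 (0 : ℝ × ℝ), 0 < (g p).2 := by
    have hcont : ContinuousAt (fun p : ℝ × ℝ ↦ ρ + p.1 + r * p.2) 0 := by fun_prop
    refine hcont.eventually_const_lt ?_
    simpa using hρ
  have hdiff : ∀ b, DifferentiableAt ℝ (fun p ↦ C.lam (u p)
      (mfderiv 𝓘(ℝ, ℝ × ℝ) (𝓡 (2 * n)) u p b)) 0 := fun b ↦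
    (contDiffAt_pullback C.smooth hus b).differentiableAt (by simp)
  have hd1 : fderiv ℝ (fun p ↦ C.lam (u p)
      (mfderiv 𝓘(ℝ, ℝ × ℝ) (𝓡 (2 * n)) u p (0, 1))) 0 (1, 0) = α := by
    have h1 : HasDerivAt (fun s : ℝ ↦ ((s, 0) : ℝ × ℝ)) (1, 0) 0 :=
      (hasDerivAt_id 0).prodMk (hasDerivAt_const 0 0)
    have h2 := HasFDerivAt.comp_hasDerivAt_of_eq (0 : ℝ) (hdiff (0, 1)).hasFDerivAt h1 rfl
    have h3 : HasDerivAt (fun s : ℝ ↦ (ρ + s) * α) α 0 := by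
      simpa using ((hasDerivAt_id (0 : ℝ)).const_add ρ).mul_const α
    refine h2.unique (h3.congr_of_eventuallyEq ?_)
    have hcont : ContinuousAt (fun s : ℝ ↦ ((s, 0) : ℝ × ℝ)) 0 := by fun_prop
    filter_upwards [hcont.eventually hgpos] with s hs
    simp only [Function.comp]
    rw [hmu (s, 0) hs hcp.self_of_nhds]
    have hs' : 0 < ρ + s := by simpa [g] using hs
    have e1 : g (s, 0) = (c 0, ρ + s) := by simp [g]
    have h5 := C.collar_pullback (c 0) (ρ + s) hs' (mfderiv 𝓘(ℝ, ℝ) (𝓡 (2 * n - 1)) c 0 (1 : ℝ)) r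
    have h6 : ∀ (q q' : N × ℝ), q = q' → ∀ z : EuclideanSpace ℝ (Fin (2 * n - 1)) × ℝ,
        C.lam (C.collar q) (mfderiv ((𝓡 (2 * n - 1)).prod 𝓘(ℝ, ℝ)) (𝓡 (2 * n)) C.collar q z) =
        C.lam (C.collar q') (mfderiv ((𝓡 (2 * n - 1)).prod 𝓘(ℝ, ℝ)) (𝓡 (2 * n)) C.collar q' z) := by
      rintro q _ rfl z; rfl
    have h7 : ∀ (y : N) (z : TangentSpace (𝓡 (2 * n - 1)) y), y = x → HEq z ξ →
        D.lam (C.bd y) (mfderiv (𝓡 (2 * n - 1)) (𝓡∂ (2 * n)) C.bd y z) = α := by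
      rintro y z rfl hz
      rw [hα, eq_of_heq hz]
    rw [h7 _ _ hc0 hc'] at h5
    refine Eq.trans ?_ h5
    refine (h6 _ _ e1 _).trans ?_
    have e2 : ((0 : ℝ) + r * 1) = r := by ring
    rw [e2]
  have hd2 : fderiv ℝ (fun p ↦ C.lam (u p)
      (mfderiv 𝓘(ℝ, ℝ × ℝ) (𝓡 (2 * n)) u p (1, 0))) 0 (0, 1) = 0 := by
    have h1 : HasDerivAt (fun s : ℝ ↦ ((0, s) : ℝ × ℝ)) (0, 1) 0 :=
      (hasDerivAt_const 0 0).prodMk (hasDerivAt_id 0)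
    have h2 := HasFDerivAt.comp_hasDerivAt_of_eq (0 : ℝ) (hdiff (1, 0)).hasFDerivAt h1 rfl
    have h3 : HasDerivAt (fun _ : ℝ ↦ (0 : ℝ)) 0 0 := hasDerivAt_const 0 0
    refine h2.unique (h3.congr_of_eventuallyEq ?_)
    have hcont : ContinuousAt (fun s : ℝ ↦ ((0, s) : ℝ × ℝ)) 0 := by fun_prop
    filter_upwards [hcont.eventually hgpos, hcp] with t ht hct
    simp only [Function.comp]
    rw [hmu (0, t) ht hct]
    have h5 := C.collar_pullback (c t) _ ht (mfderiv 𝓘(ℝ, ℝ) (𝓡 (2 * n - 1)) c t (0 : ℝ))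
      (1 + r * 0)
    refine Eq.trans h5 ?_
    have h6 : ∀ L : ℝ →L[ℝ] ℝ, (g (0, t)).2 * L 0 = 0 := fun L ↦ by rw [map_zero, mul_zero]
    exact h6 (((D.lam (C.bd (c t))).comp
      (mfderiv (𝓡 (2 * n - 1)) (𝓡∂ (2 * n)) C.bd (c t))).comp
        (mfderiv 𝓘(ℝ, ℝ) (𝓡 (2 * n - 1)) c t))
  have hpull := fderiv_pullback_sub C.smooth hus (1, 0) (0, 1)
  rw [hd1, hd2, sub_zero, hmu 0 hgpos.self_of_nhds hcp.self_of_nhds,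
    hmu 0 hgpos.self_of_nhds hcp.self_of_nhds] at hpull
  have h8 : ∀ (q : N × ℝ) (z z' : EuclideanSpace ℝ (Fin (2 * n - 1)) × ℝ), q = (x, ρ) →
      z = ((0 : EuclideanSpace ℝ (Fin (2 * n - 1))), (1 : ℝ)) → z' = a →
      extDerivOneForm (𝓡 (2 * n)) C.lam (C.collar q)
        (mfderiv ((𝓡 (2 * n - 1)).prod 𝓘(ℝ, ℝ)) (𝓡 (2 * n)) C.collar q z)
        (mfderiv ((𝓡 (2 * n - 1)).prod 𝓘(ℝ, ℝ)) (𝓡 (2 * n)) C.collar q z') =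
      extDerivOneForm (𝓡 (2 * n)) C.lam (C.collar (x, ρ)) (C.radial (x, ρ))
        (mfderiv ((𝓡 (2 * n - 1)).prod 𝓘(ℝ, ℝ)) (𝓡 (2 * n)) C.collar (x, ρ) a) := by
    rintro q z z' rfl rfl rfl; rfl
  have h12 : (1 : ℝ) + r * 0 = 1 := by ring
  have h13 : (0 : ℝ) + r * 1 = a.2 := by rw [zero_add, mul_one]
  have h9 := h8 (g 0) (mfderiv 𝓘(ℝ, ℝ) (𝓡 (2 * n - 1)) c 0 (0 : ℝ), (1 : ℝ) + r * 0)
    (mfderiv 𝓘(ℝ, ℝ) (𝓡 (2 * n - 1)) c 0 (1 : ℝ), (0 : ℝ) + r * 1) hg0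
    (Prod.ext (map_zero (mfderiv 𝓘(ℝ, ℝ) (𝓡 (2 * n - 1)) c 0)) h12)
    (Prod.ext (eq_of_heq hc') h13)
  have h10 : α = _ := hpull.trans h9
  have h11 := C.collar_pullback x ρ hρ ξ r
  rw [← h10]
  exact h11.symm

theorem liouvilleVF_collar {x : N} {ρ : ℝ} (hρ : 0 < ρ) :
    liouvilleVF C.lam (C.collar (x, ρ)) = ρ • C.radial (x, ρ) := by
  refine (eq_dualVector (C.nondegenerate _) fun v ↦ ?_).symm
  rw [map_smul]
  exact C.extDerivOneForm_radial hρ v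

theorem differential_radius_liouvilleVF {x : N} {ρ : ℝ} (hρ : 0 < ρ) :
    differential C.radius (C.collar (x, ρ)) (liouvilleVF C.lam (C.collar (x, ρ))) = ρ := by
  rw [C.liouvilleVF_collar hρ, map_smul]
  have := C.differential_radius_radial (q := (x, ρ)) hρ
  exact (congrArg (fun z : ℝ ↦ ρ * z) this).trans (mul_one ρ)

end LiouvilleCompletion

end Collar

/-! ### Pointwise identities along solutions -/

section Solutions

variable {m : ℕ} {M : Type*} [TopologicalSpace M] [ChartedSpace (EuclideanSpace ℝ (Fin m)) M]
  {lam : ∀ w : M, TangentSpace (𝓡 m) w →L[ℝ] ℝ}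
  {J : ℝ → ∀ w : M, TangentSpace (𝓡 m) w →L[ℝ] TangentSpace (𝓡 m) w}
  {H : ℝ → M → ℝ} {u : ℝ → ℝ → M} {η : ℝ → ℝ}

/-- The derivative of a map from the plane in the direction `v`. -/
def planeDeriv (U : ℝ × ℝ → M) (v p : ℝ × ℝ) : TangentSpace (𝓡 m) (U p) :=
  mfderiv 𝓘(ℝ, ℝ × ℝ) (𝓡 m) U p v

/-- The squared length of the velocity of a curve. -/
def speedSq (lam : ∀ w : M, TangentSpace (𝓡 m) w →L[ℝ] ℝ)
    (j : ∀ w : M, TangentSpace (𝓡 m) w →L[ℝ] TangentSpace (𝓡 m) w) (x : ℝ → M) (s : ℝ) : ℝ :=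
  extDerivOneForm (𝓡 m) lam (x s) (j (x s) (velocity x s)) (velocity x s)

/-- The energy density of a map from the plane. -/
def energyDensity (lam : ∀ w : M, TangentSpace (𝓡 m) w →L[ℝ] ℝ)
    (J : ℝ → ∀ w : M, TangentSpace (𝓡 m) w →L[ℝ] TangentSpace (𝓡 m) w) (u : ℝ → ℝ → M)
    (p : ℝ × ℝ) : ℝ :=
  speedSq lam (J p.2) (fun σ ↦ u σ p.2) p.1

theorem velocity_fst_eq (hu : ContMDiff 𝓘(ℝ, ℝ × ℝ) (𝓡 m) ∞ (fun p : ℝ × ℝ ↦ u p.1 p.2))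
    (p : ℝ × ℝ) : velocity (m := m) (fun σ ↦ u σ p.2) p.1 =
      planeDeriv (fun p : ℝ × ℝ ↦ u p.1 p.2) (1, 0) p := by
  have h1 : HasMFDerivAt 𝓘(ℝ, ℝ) 𝓘(ℝ, ℝ × ℝ) (fun σ : ℝ ↦ (σ, p.2)) p.1
      (ContinuousLinearMap.inl ℝ ℝ ℝ) := (hasFDerivAt_prodMk_left p.1 p.2).hasMFDerivAt
  have h2 := (((hu (p.1, p.2)).mdifferentiableAt (by simp)).hasMFDerivAt.comp p.1 h1).mfderiv
  exact congrArg (fun L ↦ L (1 : ℝ)) h2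

theorem velocity_snd_eq (hu : ContMDiff 𝓘(ℝ, ℝ × ℝ) (𝓡 m) ∞ (fun p : ℝ × ℝ ↦ u p.1 p.2))
    (p : ℝ × ℝ) : velocity (m := m) (u p.1) p.2 = planeDeriv (fun p : ℝ × ℝ ↦ u p.1 p.2) (0, 1) p := by
  have h1 : HasMFDerivAt 𝓘(ℝ, ℝ) 𝓘(ℝ, ℝ × ℝ) (fun σ : ℝ ↦ (p.1, σ)) p.2
      (ContinuousLinearMap.inr ℝ ℝ ℝ) := (hasFDerivAt_prodMk_right p.1 p.2).hasMFDerivAt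
  have h2 := (((hu (p.1, p.2)).mdifferentiableAt (by simp)).hasMFDerivAt.comp p.2 h1).mfderiv
  exact congrArg (fun L ↦ L (1 : ℝ)) h2

theorem hasFDerivAt_comp_planeDeriv {F : M → ℝ} {U : ℝ × ℝ → M} {p : ℝ × ℝ}
    (hF : MDifferentiableAt (𝓡 m) 𝓘(ℝ, ℝ) F (U p))
    (hU : MDifferentiableAt 𝓘(ℝ, ℝ × ℝ) (𝓡 m) U p) :
    ∃ L : ℝ × ℝ →L[ℝ] ℝ, HasFDerivAt (fun p ↦ F (U p)) L p ∧
      ∀ v, L v = differential (m := m) F (U p) (planeDeriv U v p) := by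
  have h := (hF.hasMFDerivAt.comp p hU.hasMFDerivAt)
  exact ⟨_, h.hasFDerivAt, fun v ↦ rfl⟩

theorem contMDiff_hamiltonian
    (hH : ContMDiff (𝓘(ℝ, ℝ).prod (𝓡 m)) 𝓘(ℝ, ℝ) ∞ (fun p : ℝ × M ↦ H p.1 p.2)) (s : ℝ) :
    ContMDiff (𝓡 m) 𝓘(ℝ, ℝ) ∞ (H s) :=
  hH.comp (contMDiff_const.prodMk contMDiff_id)

theorem continuous_hamiltonian_comp
    (hH : ContMDiff (𝓘(ℝ, ℝ).prod (𝓡 m)) 𝓘(ℝ, ℝ) ∞ (fun p : ℝ × M ↦ H p.1 p.2))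
    (hu : ContMDiff 𝓘(ℝ, ℝ × ℝ) (𝓡 m) ∞ (fun p : ℝ × ℝ ↦ u p.1 p.2)) :
    Continuous fun p : ℝ × ℝ ↦ H p.1 (u p.1 p.2) :=
  hH.continuous.comp (continuous_fst.prodMk hu.continuous)

/-- The differential of H is taken at frozen time. Doubling the time variable makes it the partial
derivative of a smooth function on ℝ³, restricted to the diagonal. -/
theorem continuous_differential_planeDeriv
    (hH : ContMDiff (𝓘(ℝ, ℝ).prod (𝓡 m)) 𝓘(ℝ, ℝ) ∞ (fun p : ℝ × M ↦ H p.1 p.2))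
    (hu : ContMDiff 𝓘(ℝ, ℝ × ℝ) (𝓡 m) ∞ (fun p : ℝ × ℝ ↦ u p.1 p.2)) (v : ℝ × ℝ) :
    Continuous fun p : ℝ × ℝ ↦ differential (m := m) (H p.1) (u p.1 p.2)
      (planeDeriv (fun p : ℝ × ℝ ↦ u p.1 p.2) v p) := by
  have h1 : ContDiff ℝ ∞ fun q : ℝ × ℝ × ℝ ↦ H q.1 (u q.2.1 q.2.2) := by
    have h2 : ContMDiff 𝓘(ℝ, ℝ × ℝ × ℝ) (𝓡 m) ∞ fun q : ℝ × ℝ × ℝ ↦ u q.2.1 q.2.2 :=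
      ContMDiff.comp (g := fun p : ℝ × ℝ ↦ u p.1 p.2) hu contDiff_snd.contMDiff
    exact (hH.comp (contDiff_fst.contMDiff.prodMk h2)).contDiff
  have h2 : Continuous fun p : ℝ × ℝ ↦
      fderiv ℝ (fun q : ℝ × ℝ × ℝ ↦ H q.1 (u q.2.1 q.2.2)) (p.1, p) (0, v) := by
    have := h1.continuous_fderiv (by simp)
    fun_prop
  refine h2.congr fun p ↦ ?_
  obtain ⟨L, hL, hLv⟩ := hasFDerivAt_comp_planeDeriv (F := H p.1)
    (U := fun p : ℝ × ℝ ↦ u p.1 p.2) (p := p)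
    ((contMDiff_hamiltonian hH p.1 _).mdifferentiableAt (by simp))
    ((hu p).mdifferentiableAt (by simp))
  have h3 := ((h1.differentiable (by simp) (p.1, p)).hasFDerivAt).comp p
    (hasFDerivAt_prodMk_right p.1 p)
  rw [← hLv]
  exact congrArg (fun L ↦ L v) (h3.unique hL)

variable [IsManifold (𝓡 m) ∞ M]

theorem contDiff_lam_planeDeriv (hlam : IsSmoothOneForm (𝓡 m) lam) {U : ℝ × ℝ → M}
    (hU : ContMDiff 𝓘(ℝ, ℝ × ℝ) (𝓡 m) ∞ U) (v : ℝ × ℝ) :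
    ContDiff ℝ ∞ fun p ↦ lam (U p) (planeDeriv U v p) :=
  contDiff_iff_contDiffAt.2 fun p ↦ contDiffAt_pullback hlam (hU p) v

theorem continuous_extDerivOneForm_planeDeriv (hlam : IsSmoothOneForm (𝓡 m) lam) {U : ℝ × ℝ → M}
    (hU : ContMDiff 𝓘(ℝ, ℝ × ℝ) (𝓡 m) ∞ U) (v w : ℝ × ℝ) :
    Continuous fun p ↦
      extDerivOneForm (𝓡 m) lam (U p) (planeDeriv U v p) (planeDeriv U w p) := by
  have h1 := (contDiff_lam_planeDeriv hlam hU v).continuous_fderiv (by simp)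
  have h2 := (contDiff_lam_planeDeriv hlam hU w).continuous_fderiv (by simp)
  exact ((h2.clm_apply continuous_const).sub (h1.clm_apply continuous_const)).congr fun p ↦
    fderiv_pullback_sub hlam (hU p) v w

namespace IsRFSolution

theorem map_velocity (hJ : IsCompatibleLoop lam J) (sol : IsRFSolution lam J H u η) (s t : ℝ) :
    J t (u s t) (velocity (fun σ ↦ u σ t) s) =
      velocity (u s) t - η s • hamiltonianVF lam (H s) (u s t) := by
  have h := eq_neg_of_add_eq_zero_left (sol.eq_u s t)
  have h2 : J t (u s t) (velocity (fun σ ↦ u σ t) s) = _ := congrArg (J t (u s t)) h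
  rw [h2, map_neg, hJ.sq, neg_neg]

theorem lam_velocity (hJ : IsCompatibleLoop lam J) (sol : IsRFSolution lam J H u η) (s t : ℝ) :
    lam (u s t) (velocity (u s) t) =
      lam (u s t) (J t (u s t) (velocity (fun σ ↦ u σ t) s)) +
        η s * lam (u s t) (hamiltonianVF lam (H s) (u s t)) := by
  have h := congrArg (lam (u s t)) (sol.map_velocity hJ s t)
  rw [map_sub, map_smul, smul_eq_mul] at h
  linarith

/-- Since dH(X_H) = 0, the multiplier drops out: the variation of H along a loop is governed by ∂_s
u alone, whatever the size of η. -/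
theorem differential_velocity (hnd : HasNondegenerateDeriv (𝓡 m) lam)
    (hJ : IsCompatibleLoop lam J) (sol : IsRFSolution lam J H u η) (s t : ℝ) :
    differential (m := m) (H s) (u s t) (velocity (u s) t) =
      differential (m := m) (H s) (u s t) (J t (u s t) (velocity (fun σ ↦ u σ t) s)) := by
  have h := congrArg (differential (m := m) (H s) (u s t)) (sol.map_velocity hJ s t)
  rw [map_sub, map_smul, smul_eq_mul, differential_hamiltonianVF_self hnd] at h
  linarith

theorem energyDensity_nonneg (hJ : IsCompatibleLoop lam J) (p : ℝ × ℝ) :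
    0 ≤ energyDensity lam J u p := hJ.nonneg _ _ _

theorem energyDensity_add_one (hJ : IsCompatibleLoop lam J) (sol : IsRFSolution lam J H u η)
    (s t : ℝ) : energyDensity lam J u (s, t + 1) = energyDensity lam J u (s, t) := by
  have h : (fun σ ↦ u σ (t + 1)) = fun σ ↦ u σ t := funext fun σ ↦ sol.periodic_u σ t
  simp only [energyDensity]
  rw [h, hJ.periodic]

/-- Replacing J ∂_s u by ∂_t u - η X_H eliminates J from |∂_s u|². The right-hand side is visibly
continuous, and it is the form in which the density meets the Laplacian of the radius. -/
theorem energyDensity_eq (hnd : HasNondegenerateDeriv (𝓡 m) lam) (hJ : IsCompatibleLoop lam J)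
    (sol : IsRFSolution lam J H u η) (p : ℝ × ℝ) :
    energyDensity lam J u p =
      -extDerivOneForm (𝓡 m) lam (u p.1 p.2) (planeDeriv (fun p : ℝ × ℝ ↦ u p.1 p.2) (1, 0) p)
        (planeDeriv (fun p : ℝ × ℝ ↦ u p.1 p.2) (0, 1) p) +
      η p.1 * differential (m := m) (H p.1) (u p.1 p.2)
        (planeDeriv (fun p : ℝ × ℝ ↦ u p.1 p.2) (1, 0) p) := by
  have h1 : energyDensity lam J u p = extDerivOneForm (𝓡 m) lam (u p.1 p.2)
      (J p.2 (u p.1 p.2) (velocity (fun σ ↦ u σ p.2) p.1)) (velocity (fun σ ↦ u σ p.2) p.1) := rfl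
  rw [h1, sol.map_velocity hJ, map_sub, map_smul, velocity_fst_eq sol.smooth_u,
    velocity_snd_eq sol.smooth_u]
  have h2 := hamiltonianVF_spec hnd (H p.1) (u p.1 p.2)
    (planeDeriv (fun p : ℝ × ℝ ↦ u p.1 p.2) (1, 0) p)
  have h3 := extDerivOneForm_neg_swap (lam := lam) (u p.1 p.2)
    (planeDeriv (fun p : ℝ × ℝ ↦ u p.1 p.2) (0, 1) p)
    (planeDeriv (fun p : ℝ × ℝ ↦ u p.1 p.2) (1, 0) p)
  refine (congrArg₂ (fun a b : ℝ ↦ a - η p.1 * b) h3 h2).trans ?_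
  ring

theorem continuous_energyDensity (hlam : IsSmoothOneForm (𝓡 m) lam)
    (hnd : HasNondegenerateDeriv (𝓡 m) lam) (hJ : IsCompatibleLoop lam J)
    (hH : ContMDiff (𝓘(ℝ, ℝ).prod (𝓡 m)) 𝓘(ℝ, ℝ) ∞ (fun p : ℝ × M ↦ H p.1 p.2))
    (sol : IsRFSolution lam J H u η) : Continuous (energyDensity lam J u) := by
  have h1 := continuous_extDerivOneForm_planeDeriv hlam sol.smooth_u (1, 0) (0, 1)
  have h2 := continuous_differential_planeDeriv hH sol.smooth_u (1, 0)
  have h3 := sol.smooth_η.continuous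
  exact (h1.neg.add ((h3.comp continuous_fst).mul h2)).congr fun p ↦
    (sol.energyDensity_eq hnd hJ p).symm

/-- A solution is a flow line of the negative gradient, so the loop component of the gradient is J(J
∂_s u) = -∂_s u. -/
theorem gradNormSq_eq (hJ : IsCompatibleLoop lam J) (sol : IsRFSolution lam J H u η) (s : ℝ) :
    gradNormSq lam J (H s) (u s) (η s) =
      (∫ t in (0 : ℝ)..1, energyDensity lam J u (s, t)) + (∫ t in (0 : ℝ)..1, H s (u s t)) ^ 2 := by
  have h1 : ∀ t, extDerivOneForm (𝓡 m) lam (u s t)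
      (J t (u s t) (gradLoop lam J (H s) (u s) (η s) t)) (gradLoop lam J (H s) (u s) (η s) t) =
      energyDensity lam J u (s, t) := by
    intro t
    have h2 : gradLoop lam J (H s) (u s) (η s) t =
        J t (u s t) (J t (u s t) (velocity (fun σ ↦ u σ t) s)) :=
      congrArg (J t (u s t)) (sol.map_velocity hJ s t).symm
    rw [h2, hJ.map_map, hJ.map_map]
    rfl
  rw [gradNormSq, gradReal, neg_sq]
  simp_rw [h1]

theorem hasDerivAt_hamiltonian (hnd : HasNondegenerateDeriv (𝓡 m) lam)
    (hJ : IsCompatibleLoop lam J)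
    (hH : ContMDiff (𝓘(ℝ, ℝ).prod (𝓡 m)) 𝓘(ℝ, ℝ) ∞ (fun p : ℝ × M ↦ H p.1 p.2))
    (sol : IsRFSolution lam J H u η) (s t : ℝ) :
    HasDerivAt (fun t ↦ H s (u s t)) (differential (m := m) (H s) (u s t)
      (J t (u s t) (velocity (fun σ ↦ u σ t) s))) t := by
  obtain ⟨L, hL, hLv⟩ := hasFDerivAt_comp_planeDeriv (F := H s)
    (U := fun p : ℝ × ℝ ↦ u p.1 p.2) (p := (s, t))
    ((contMDiff_hamiltonian hH s _).mdifferentiableAt (by simp))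
    ((sol.smooth_u (s, t)).mdifferentiableAt (by simp))
  have h1 := hL.comp_hasDerivAt t ((hasDerivAt_const t s).prodMk (hasDerivAt_id t))
  rw [hLv, ← velocity_snd_eq sol.smooth_u, sol.differential_velocity hnd hJ] at h1
  exact h1

end IsRFSolution

end Solutions

/-! ### Derivatives of the radial profile in the interior of its domain -/

section Profile

open Filter

variable {h : ℝ → ℝ → ℝ} {ρ₀ : ℝ}

/-- The radial derivative of a family of functions on `[ρ₀, ∞)`. -/
def radialDeriv (h : ℝ → ℝ → ℝ) (ρ₀ s ρ : ℝ) : ℝ := derivWithin (h s) (Ici ρ₀) ρ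

theorem contDiffAt_profile
    (hh : ContDiffOn ℝ ∞ (fun p : ℝ × ℝ ↦ h p.1 p.2) (univ ×ˢ Ici ρ₀)) {p : ℝ × ℝ}
    (hp : ρ₀ < p.2) : ContDiffAt ℝ ∞ (fun p : ℝ × ℝ ↦ h p.1 p.2) p :=
  hh.contDiffAt (prod_mem_nhds univ_mem (Ici_mem_nhds hp))

theorem hasDerivAt_profile
    (hh : ContDiffOn ℝ ∞ (fun p : ℝ × ℝ ↦ h p.1 p.2) (univ ×ˢ Ici ρ₀)) (s : ℝ) {ρ : ℝ}
    (hρ : ρ₀ < ρ) : HasDerivAt (h s) (radialDeriv h ρ₀ s ρ) ρ ∧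
      radialDeriv h ρ₀ s ρ = fderiv ℝ (fun p : ℝ × ℝ ↦ h p.1 p.2) (s, ρ) (0, 1) := by
  have h1 := ((contDiffAt_profile hh (p := (s, ρ)) hρ).differentiableAt (by simp)).hasFDerivAt
  have h2 : HasDerivAt (h s) (fderiv ℝ (fun p : ℝ × ℝ ↦ h p.1 p.2) (s, ρ) (0, 1)) ρ :=
    h1.comp_hasDerivAt ρ ((hasDerivAt_const ρ s).prodMk (hasDerivAt_id ρ))
  have h3 : radialDeriv h ρ₀ s ρ = fderiv ℝ (fun p : ℝ × ℝ ↦ h p.1 p.2) (s, ρ) (0, 1) := by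
    rw [radialDeriv, derivWithin_of_mem_nhds (Ici_mem_nhds hρ), h2.deriv]
  exact ⟨by rwa [h3], h3⟩

theorem contDiffAt_radialDeriv
    (hh : ContDiffOn ℝ ∞ (fun p : ℝ × ℝ ↦ h p.1 p.2) (univ ×ˢ Ici ρ₀)) {p : ℝ × ℝ}
    (hp : ρ₀ < p.2) : ContDiffAt ℝ ∞ (fun p : ℝ × ℝ ↦ radialDeriv h ρ₀ p.1 p.2) p := by
  have h1 : ContDiffAt ℝ ∞ (fun q ↦ fderiv ℝ (fun p : ℝ × ℝ ↦ h p.1 p.2) q (0, 1)) p :=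
    ((contDiffAt_profile hh hp).fderiv_right (m := ∞) (by simp)).clm_apply contDiffAt_const
  refine h1.congr_of_eventuallyEq ?_
  have h2 : ∀ᶠ q : ℝ × ℝ in 𝓝 p, ρ₀ < q.2 := continuousAt_snd.eventually_const_lt hp
  filter_upwards [h2] with q hq
  exact (hasDerivAt_profile hh q.1 hq).2

theorem fderiv_radialDeriv_fst
    (hh : ContDiffOn ℝ ∞ (fun p : ℝ × ℝ ↦ h p.1 p.2) (univ ×ˢ Ici ρ₀)) (s : ℝ) {ρ : ℝ}
    (hρ : ρ₀ < ρ) : HasDerivAt (fun σ ↦ radialDeriv h ρ₀ σ ρ)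
      (fderiv ℝ (fun p : ℝ × ℝ ↦ radialDeriv h ρ₀ p.1 p.2) (s, ρ) (1, 0)) s :=
  HasFDerivAt.comp_hasDerivAt (x := s) (f := fun σ ↦ (σ, ρ))
    (l := fun p : ℝ × ℝ ↦ radialDeriv h ρ₀ p.1 p.2)
    ((contDiffAt_radialDeriv hh (p := (s, ρ)) hρ).differentiableAt (by simp)).hasFDerivAt
    ((hasDerivAt_id s).prodMk (hasDerivAt_const s ρ))

theorem fderiv_radialDeriv_snd
    (hh : ContDiffOn ℝ ∞ (fun p : ℝ × ℝ ↦ h p.1 p.2) (univ ×ˢ Ici ρ₀)) (s : ℝ) {ρ : ℝ}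
    (hρ : ρ₀ < ρ) : HasDerivAt (radialDeriv h ρ₀ s)
      (fderiv ℝ (fun p : ℝ × ℝ ↦ radialDeriv h ρ₀ p.1 p.2) (s, ρ) (0, 1)) ρ :=
  HasFDerivAt.comp_hasDerivAt (x := ρ) (f := fun ρ ↦ (s, ρ))
    (l := fun p : ℝ × ℝ ↦ radialDeriv h ρ₀ p.1 p.2)
    ((contDiffAt_radialDeriv hh (p := (s, ρ)) hρ).differentiableAt (by simp)).hasFDerivAt
    ((hasDerivAt_const ρ s).prodMk (hasDerivAt_id ρ))

end Profile

/-! ### The radius of a solution on the contact end -/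

section ContactEnd

open Filter

variable {n : ℕ} [NeZero n] {W : Type*} [TopologicalSpace W]
  [ChartedSpace (EuclideanHalfSpace (2 * n)) W] [IsManifold (𝓡∂ (2 * n)) ∞ W]
  [T2Space W] [CompactSpace W] [ConnectedSpace W] {D : LiouvilleDomain n W}
  {N : Type*} [TopologicalSpace N] [ChartedSpace (EuclideanSpace ℝ (Fin (2 * n - 1))) N]
  [IsManifold (𝓡 (2 * n - 1)) ∞ N]
  {What : Type*} [TopologicalSpace What] [ChartedSpace (EuclideanSpace ℝ (Fin (2 * n))) What]
  [IsManifold (𝓡 (2 * n)) ∞ What] [T2Space What] {C : LiouvilleCompletion D N What}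
  {ρ₀ : ℝ} {J : ℝ → ∀ w : What, TangentSpace (𝓡 (2 * n)) w →L[ℝ] TangentSpace (𝓡 (2 * n)) w}

/-- The end `N × (R, ∞)` of the completion. -/
def LiouvilleCompletion.endSet (C : LiouvilleCompletion D N What) (R : ℝ) : Set What :=
  C.collar '' (univ ×ˢ Ioi R)

theorem mem_endSet {R : ℝ} (hR : 0 ≤ R) {w : What} (hw : w ∈ C.endSet R) :
    ∃ x : N, C.collar (x, C.radius w) = w ∧ R < C.radius w := by
  obtain ⟨⟨x, ρ⟩, ⟨-, hρ⟩, rfl⟩ := hw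
  have hρ' : R < ρ := hρ
  have h1 : C.radius (C.collar (x, ρ)) = ρ := C.radius_collar (q := (x, ρ)) (hR.trans_lt hρ')
  exact ⟨x, by rw [h1], by rwa [h1]⟩

theorem endSet_subset_target {R : ℝ} (hR : 0 ≤ R) : C.endSet R ⊆ C.collar.target := by
  rintro _ ⟨q, ⟨-, hq⟩, rfl⟩
  exact C.collar.map_source (C.mem_source (hR.trans_lt hq))

theorem isOpen_endSet {R : ℝ} (hR : 0 ≤ R) : IsOpen (C.endSet R) := by
  refine C.collar.isOpen_image_of_subset_source (isOpen_univ.prod isOpen_Ioi) ?_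
  rintro q ⟨-, hq⟩
  exact C.mem_source (hR.trans_lt hq)

theorem differential_radius_map (hJρ₀ : C.IsContactType ρ₀ J) (t : ℝ) {w : What}
    (hw : w ∈ C.endSet ρ₀) (v : TangentSpace (𝓡 (2 * n)) w) :
    differential C.radius w (J t w v) = C.lam w v := by
  obtain ⟨⟨x, ρ⟩, ⟨-, hρ⟩, rfl⟩ := hw
  exact hJρ₀ t x ρ (le_of_lt hρ) v

theorem differential_radius_eq (hJ : IsCompatibleLoop C.lam J)
    (hJρ₀ : C.IsContactType ρ₀ J) (t : ℝ) {w : What}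
    (hw : w ∈ C.endSet ρ₀) (v : TangentSpace (𝓡 (2 * n)) w) :
    differential C.radius w v = -C.lam w (J t w v) := by
  have h := differential_radius_map hJρ₀ t hw (J t w v)
  rw [hJ.sq, map_neg] at h
  linarith

theorem differential_radius_liouville (hρ₀ : 0 < ρ₀) {w : What} (hw : w ∈ C.endSet ρ₀) :
    differential C.radius w (liouvilleVF C.lam w) = C.radius w := by
  obtain ⟨⟨x, ρ⟩, ⟨-, hρ⟩, rfl⟩ := hw
  have hρ' : 0 < ρ := hρ₀.trans hρ
  rw [C.differential_radius_liouvilleVF hρ', C.radius_collar (q := (x, ρ)) hρ']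

/-- The squared norm of λ is -λ(JY), which equals dρ(Y) = ρ by the contact condition; and dρ has the
norm of λ because J is an isometry. -/
theorem differential_radius_sq_le (hρ₀ : 0 < ρ₀) (hJ : IsCompatibleLoop C.lam J)
    (hJρ₀ : C.IsContactType ρ₀ J) (t : ℝ) {w : What}
    (hw : w ∈ C.endSet ρ₀) (v : TangentSpace (𝓡 (2 * n)) w) :
    differential C.radius w v ^ 2 ≤
      C.radius w * extDerivOneForm (𝓡 (2 * n)) C.lam w (J t w v) v := by
  have h := hJ.lam_sq_le C.nondegenerate t w (J t w v)
  rw [hJ.map_map, ← differential_radius_eq hJ hJρ₀ t hw,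
    differential_radius_liouville hρ₀ hw] at h
  rwa [differential_radius_eq hJ hJρ₀ t hw, neg_sq]

variable {H : ℝ → What → ℝ} {h : ℝ → ℝ → ℝ}

theorem differential_hamiltonian_end (hρ₀ : 0 < ρ₀)
    (hh : ContDiffOn ℝ ∞ (fun p : ℝ × ℝ ↦ h p.1 p.2) (univ ×ˢ Ici ρ₀))
    (hHh : ∀ (s : ℝ) (x : N) (ρ : ℝ), ρ₀ ≤ ρ → H s (C.collar (x, ρ)) = h s ρ) (s : ℝ) {w : What}
    (hw : w ∈ C.endSet ρ₀) (v : TangentSpace (𝓡 (2 * n)) w) :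
    differential (H s) w v = radialDeriv h ρ₀ s (C.radius w) * differential C.radius w v := by
  have e : H s =ᶠ[𝓝 w] fun w ↦ h s (C.radius w) := by
    filter_upwards [(isOpen_endSet hρ₀.le).mem_nhds hw] with w' hw'
    obtain ⟨x, hx, hr⟩ := mem_endSet hρ₀.le hw'
    conv_lhs => rw [← hx]
    exact hHh s x _ hr.le
  obtain ⟨x, hx, hr⟩ := mem_endSet hρ₀.le hw
  have h1 := ((hasDerivAt_profile hh s hr).1.hasFDerivAt.hasMFDerivAt).comp w
    ((C.contMDiffAt_radius (endSet_subset_target hρ₀.le hw)).mdifferentiableAt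
      (by simp)).hasMFDerivAt
  have h2 := h1.mfderiv
  rw [differential, e.mfderiv_eq]
  refine (congrArg (fun L ↦ L v) h2).trans ?_
  exact mul_comm (differential C.radius w v) _

theorem lam_hamiltonianVF_end (hρ₀ : 0 < ρ₀)
    (hh : ContDiffOn ℝ ∞ (fun p : ℝ × ℝ ↦ h p.1 p.2) (univ ×ˢ Ici ρ₀))
    (hHh : ∀ (s : ℝ) (x : N) (ρ : ℝ), ρ₀ ≤ ρ → H s (C.collar (x, ρ)) = h s ρ) (s : ℝ) {w : What}
    (hw : w ∈ C.endSet ρ₀) :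
    C.lam w (hamiltonianVF C.lam (H s) w) = C.radius w * radialDeriv h ρ₀ s (C.radius w) := by
  rw [lam_hamiltonianVF C.nondegenerate, differential_hamiltonian_end hρ₀ hh hHh s hw,
    differential_radius_liouville hρ₀ hw, mul_comm]

/-- From h' dρ(X_H) = dH(X_H) = 0 the claim follows unless h' = 0, in which case dH and hence X_H
vanish. -/
theorem differential_radius_hamiltonianVF (hρ₀ : 0 < ρ₀)
    (hh : ContDiffOn ℝ ∞ (fun p : ℝ × ℝ ↦ h p.1 p.2) (univ ×ˢ Ici ρ₀))
    (hHh : ∀ (s : ℝ) (x : N) (ρ : ℝ), ρ₀ ≤ ρ → H s (C.collar (x, ρ)) = h s ρ) (s : ℝ) {w : What}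
    (hw : w ∈ C.endSet ρ₀) : differential C.radius w (hamiltonianVF C.lam (H s) w) = 0 := by
  have h1 := differential_hamiltonianVF_self C.nondegenerate (H s) w
  rw [differential_hamiltonian_end hρ₀ hh hHh s hw] at h1
  rcases mul_eq_zero.1 h1 with h2 | h2
  · have h3 : hamiltonianVF C.lam (H s) w = 0 := by
      refine C.nondegenerate w _ fun v ↦ ?_
      refine (hamiltonianVF_spec C.nondegenerate (H s) w v).trans ?_
      rw [differential_hamiltonian_end hρ₀ hh hHh s hw, h2, zero_mul, neg_zero]
    rw [h3, map_zero]
  · exact h2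

variable {u : ℝ → ℝ → What} {η : ℝ → ℝ}

theorem contDiffAt_radius_comp (hρ₀ : 0 < ρ₀) (sol : IsRFSolution C.lam J H u η) {p : ℝ × ℝ}
    (hp : u p.1 p.2 ∈ C.endSet ρ₀) :
    ContDiffAt ℝ ∞ (fun p : ℝ × ℝ ↦ C.radius (u p.1 p.2)) p :=
  (ContMDiffAt.comp (f := fun p : ℝ × ℝ ↦ u p.1 p.2) p
    (C.contMDiffAt_radius (endSet_subset_target hρ₀.le hp)) (sol.smooth_u p)).contDiffAt

theorem fderiv_radius_comp (hρ₀ : 0 < ρ₀) (sol : IsRFSolution C.lam J H u η) {p : ℝ × ℝ}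
    (hp : u p.1 p.2 ∈ C.endSet ρ₀) (v : ℝ × ℝ) :
    fderiv ℝ (fun p : ℝ × ℝ ↦ C.radius (u p.1 p.2)) p v =
      differential (m := 2 * n) C.radius (u p.1 p.2)
        (planeDeriv (m := 2 * n) (fun p : ℝ × ℝ ↦ u p.1 p.2) v p) := by
  obtain ⟨L, hL, hLv⟩ := hasFDerivAt_comp_planeDeriv (F := C.radius)
    (U := fun p : ℝ × ℝ ↦ u p.1 p.2) (p := p)
    ((C.contMDiffAt_radius (endSet_subset_target hρ₀.le hp)).mdifferentiableAt (by simp))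
    ((sol.smooth_u p).mdifferentiableAt (by simp))
  rw [hL.fderiv, hLv]

/-- Contact type gives dρ(∂_s u) = -λ(J ∂_s u), and the equation rewrites J ∂_s u. Together with
`fderiv_radius_snd` this is a perturbed Cauchy–Riemann system, so that ω is what remains when second
derivatives are added. -/
theorem fderiv_radius_fst (hρ₀ : 0 < ρ₀) (hJ : IsCompatibleLoop C.lam J)
    (hJρ₀ : C.IsContactType ρ₀ J)
    (hh : ContDiffOn ℝ ∞ (fun p : ℝ × ℝ ↦ h p.1 p.2) (univ ×ˢ Ici ρ₀))
    (hHh : ∀ (s : ℝ) (x : N) (ρ : ℝ), ρ₀ ≤ ρ → H s (C.collar (x, ρ)) = h s ρ)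
    (sol : IsRFSolution C.lam J H u η) {p : ℝ × ℝ} (hp : u p.1 p.2 ∈ C.endSet ρ₀) :
    fderiv ℝ (fun p : ℝ × ℝ ↦ C.radius (u p.1 p.2)) p (1, 0) =
      η p.1 * (C.radius (u p.1 p.2) * radialDeriv h ρ₀ p.1 (C.radius (u p.1 p.2))) -
        C.lam (u p.1 p.2) (planeDeriv (fun p : ℝ × ℝ ↦ u p.1 p.2) (0, 1) p) := by
  rw [fderiv_radius_comp hρ₀ sol hp, ← velocity_fst_eq sol.smooth_u,
    ← velocity_snd_eq sol.smooth_u, sol.lam_velocity hJ, differential_radius_eq hJ hJρ₀ p.2 hp,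
    lam_hamiltonianVF_end hρ₀ hh hHh _ hp]
  ring

theorem fderiv_radius_snd (hρ₀ : 0 < ρ₀) (hJ : IsCompatibleLoop C.lam J)
    (hJρ₀ : C.IsContactType ρ₀ J)
    (hh : ContDiffOn ℝ ∞ (fun p : ℝ × ℝ ↦ h p.1 p.2) (univ ×ˢ Ici ρ₀))
    (hHh : ∀ (s : ℝ) (x : N) (ρ : ℝ), ρ₀ ≤ ρ → H s (C.collar (x, ρ)) = h s ρ)
    (sol : IsRFSolution C.lam J H u η) {p : ℝ × ℝ} (hp : u p.1 p.2 ∈ C.endSet ρ₀) :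
    fderiv ℝ (fun p : ℝ × ℝ ↦ C.radius (u p.1 p.2)) p (0, 1) =
      C.lam (u p.1 p.2) (planeDeriv (fun p : ℝ × ℝ ↦ u p.1 p.2) (1, 0) p) := by
  have h1 := congrArg (differential C.radius (u p.1 p.2)) (sol.map_velocity hJ p.1 p.2)
  rw [map_sub, map_smul, differential_radius_hamiltonianVF hρ₀ hh hHh _ hp, smul_zero, sub_zero,
    differential_radius_map hJρ₀ p.2 hp] at h1
  rw [fderiv_radius_comp hρ₀ sol hp, ← velocity_fst_eq sol.smooth_u, h1,
    ← velocity_snd_eq sol.smooth_u]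

theorem fderiv_radius_fst_sq_le (hρ₀ : 0 < ρ₀) (hJ : IsCompatibleLoop C.lam J)
    (hJρ₀ : C.IsContactType ρ₀ J) (sol : IsRFSolution C.lam J H u η) {p : ℝ × ℝ}
    (hp : u p.1 p.2 ∈ C.endSet ρ₀) :
    fderiv ℝ (fun p : ℝ × ℝ ↦ C.radius (u p.1 p.2)) p (1, 0) ^ 2 ≤
      C.radius (u p.1 p.2) * energyDensity C.lam J u p := by
  rw [fderiv_radius_comp hρ₀ sol hp, ← velocity_fst_eq sol.smooth_u]
  exact differential_radius_sq_le hρ₀ hJ hJρ₀ p.2 hp _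

theorem fderiv_radius_snd_sq_le (hρ₀ : 0 < ρ₀) (hJ : IsCompatibleLoop C.lam J)
    (hJρ₀ : C.IsContactType ρ₀ J)
    (hh : ContDiffOn ℝ ∞ (fun p : ℝ × ℝ ↦ h p.1 p.2) (univ ×ˢ Ici ρ₀))
    (hHh : ∀ (s : ℝ) (x : N) (ρ : ℝ), ρ₀ ≤ ρ → H s (C.collar (x, ρ)) = h s ρ)
    (sol : IsRFSolution C.lam J H u η) {p : ℝ × ℝ} (hp : u p.1 p.2 ∈ C.endSet ρ₀) :
    fderiv ℝ (fun p : ℝ × ℝ ↦ C.radius (u p.1 p.2)) p (0, 1) ^ 2 ≤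
      C.radius (u p.1 p.2) * energyDensity C.lam J u p := by
  rw [fderiv_radius_snd hρ₀ hJ hJρ₀ hh hHh sol hp, ← velocity_fst_eq sol.smooth_u,
    ← differential_radius_map hJρ₀ p.2 hp]
  have h1 := differential_radius_sq_le hρ₀ hJ hJρ₀ p.2 hp
    (J p.2 (u p.1 p.2) (velocity (fun σ ↦ u σ p.2) p.1))
  rw [hJ.map_map] at h1
  exact h1

/-- The Laplacian of the radius along a solution of the Rabinowitz-Floer equation. -/
theorem planeLaplacian_radius (hρ₀ : 0 < ρ₀) (hJ : IsCompatibleLoop C.lam J)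
    (hJρ₀ : C.IsContactType ρ₀ J)
    (hh : ContDiffOn ℝ ∞ (fun p : ℝ × ℝ ↦ h p.1 p.2) (univ ×ˢ Ici ρ₀))
    (hHh : ∀ (s : ℝ) (x : N) (ρ : ℝ), ρ₀ ≤ ρ → H s (C.collar (x, ρ)) = h s ρ)
    (sol : IsRFSolution C.lam J H u η) {p : ℝ × ℝ} (hp : u p.1 p.2 ∈ C.endSet ρ₀)
    {r rs : ℝ} (hr : r = C.radius (u p.1 p.2))
    (hrs : rs = fderiv ℝ (fun p : ℝ × ℝ ↦ C.radius (u p.1 p.2)) p (1, 0)) :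
    planeLaplacian (fun p : ℝ × ℝ ↦ C.radius (u p.1 p.2)) p =
      energyDensity C.lam J u p + deriv η p.1 * (r * radialDeriv h ρ₀ p.1 r) +
      η p.1 * r * (fderiv ℝ (fun p : ℝ × ℝ ↦ radialDeriv h ρ₀ p.1 p.2) (p.1, r) (1, 0) +
        rs * fderiv ℝ (fun p : ℝ × ℝ ↦ radialDeriv h ρ₀ p.1 p.2) (p.1, r) (0, 1)) := by
  have hrc := contDiffAt_radius_comp hρ₀ sol hp
  have hU := sol.smooth_u
  set U : ℝ × ℝ → What := fun p ↦ u p.1 p.2 with hUdef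
  set R : ℝ × ℝ → ℝ := fun p ↦ C.radius (u p.1 p.2) with hR
  set P : ℝ × ℝ → ℝ := fun p ↦ radialDeriv h ρ₀ p.1 p.2 with hP
  have hr' : R p = r := hr.symm
  obtain ⟨-, -, hrρ⟩ := mem_endSet hρ₀.le hp
  have hev : ∀ᶠ q in 𝓝 p, U q ∈ C.endSet ρ₀ :=
    hU.continuous.continuousAt.eventually ((isOpen_endSet hρ₀.le).mem_nhds hp)
  have e1 : (fun q ↦ fderiv ℝ R q (1, 0)) =ᶠ[𝓝 p] fun q ↦ η q.1 * (R q * P (q.1, R q)) -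
      C.lam (U q) (planeDeriv U (0, 1) q) := by
    filter_upwards [hev] with q hq
    exact fderiv_radius_fst hρ₀ hJ hJρ₀ hh hHh sol hq
  have e2 : (fun q ↦ fderiv ℝ R q (0, 1)) =ᶠ[𝓝 p]
      fun q ↦ C.lam (U q) (planeDeriv U (1, 0) q) := by
    filter_upwards [hev] with q hq
    exact fderiv_radius_snd hρ₀ hJ hJρ₀ hh hHh sol hq
  have hr2 : ContDiffAt ℝ 2 R p := hrc.of_le ENat.LEInfty.out
  have hd : ∀ v, DifferentiableAt ℝ (fun q ↦ C.lam (U q) (planeDeriv U v q)) p := fun v ↦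
    (contDiff_lam_planeDeriv C.smooth hU v).differentiable (by simp) p
  have hRd : HasFDerivAt R (fderiv ℝ R p) p := (hrc.differentiableAt (by simp)).hasFDerivAt
  have hPd : HasFDerivAt P (fderiv ℝ P (p.1, r)) (p.1, r) :=
    ((contDiffAt_radialDeriv hh (p := (p.1, r)) (by rw [hr]; exact hrρ)).differentiableAt
      (by simp)).hasFDerivAt
  have hηd : HasDerivAt η (deriv η p.1) p.1 :=
    (sol.smooth_η.differentiable (by simp) p.1).hasDerivAt
  have hline : HasDerivAt (fun s : ℝ ↦ (s, p.2)) ((1, 0) : ℝ × ℝ) p.1 :=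
    (hasDerivAt_id p.1).prodMk (hasDerivAt_const p.1 p.2)
  have hRl : HasDerivAt (fun s ↦ R (s, p.2)) rs p.1 := by
    rw [hrs]
    exact HasFDerivAt.comp_hasDerivAt_of_eq p.1 hRd hline rfl
  have hPl : HasDerivAt (fun s ↦ P (s, R (s, p.2))) (fderiv ℝ P (p.1, r) (1, rs)) p.1 :=
    HasFDerivAt.comp_hasDerivAt_of_eq p.1 hPd ((hasDerivAt_id p.1).prodMk hRl)
      (by simp [← hr'])
  have hGl := hηd.mul (hRl.mul hPl)
  have hGd : DifferentiableAt ℝ (fun q ↦ η q.1 * (R q * P (q.1, R q))) p := by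
    have h1 : DifferentiableAt ℝ (fun q : ℝ × ℝ ↦ η q.1) p :=
      hηd.differentiableAt.comp p differentiableAt_fst
    have h2 : DifferentiableAt ℝ (fun q : ℝ × ℝ ↦ P (q.1, R q)) p := by
      have h3 : DifferentiableAt ℝ P (p.1, R p) := by rw [hr']; exact hPd.differentiableAt
      exact h3.comp p (differentiableAt_fst.prodMk hRd.differentiableAt)
    exact h1.mul (hRd.differentiableAt.mul h2)
  have hG : fderiv ℝ (fun q ↦ η q.1 * (R q * P (q.1, R q))) p (1, 0) =
      deriv η p.1 * (r * P (p.1, r)) + η p.1 * (rs * P (p.1, r) +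
        r * fderiv ℝ P (p.1, r) (1, rs)) := by
    have h1 := HasFDerivAt.comp_hasDerivAt_of_eq p.1 hGd.hasFDerivAt hline rfl
    rw [h1.unique hGl]
    simp [← hr']
  have hω := fderiv_pullback_sub C.smooth (hU p) (1, 0) (0, 1)
  have he := sol.energyDensity_eq C.nondegenerate hJ p
  have hH := differential_hamiltonian_end hρ₀ hh hHh p.1 hp (planeDeriv U (1, 0) p)
  rw [hH, ← fderiv_radius_comp hρ₀ sol hp] at he
  replace he : energyDensity C.lam J u p =
      -extDerivOneForm (𝓡 (2 * n)) C.lam (U p) (planeDeriv U (1, 0) p) (planeDeriv U (0, 1) p) +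
        η p.1 * (P (p.1, r) * rs) := by rw [hrs, hr]; exact he
  have hsplit : fderiv ℝ P (p.1, r) (1, rs) =
      fderiv ℝ P (p.1, r) (1, 0) + rs * fderiv ℝ P (p.1, r) (0, 1) := by
    rw [show ((1, rs) : ℝ × ℝ) = (1, 0) + rs • (0, 1) by simp, map_add, map_smul, smul_eq_mul]
  rw [planeLaplacian, fderiv_fderiv_apply hr2, fderiv_fderiv_apply hr2, e1.fderiv_eq, e2.fderiv_eq,
    fderiv_fun_sub hGd (hd _)]
  -- Adding the second derivatives gives Δr = ∂_s(η r h') - ω(∂_s u, ∂_t u). Replacing -ω by e - η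
  -- h' r_s cancels the term η r_s h' of the product rule.
  have hω' : fderiv ℝ (fun q ↦ C.lam (U q) (planeDeriv U (0, 1) q)) p (1, 0) -
      fderiv ℝ (fun q ↦ C.lam (U q) (planeDeriv U (1, 0) q)) p (0, 1) =
      extDerivOneForm (𝓡 (2 * n)) C.lam (U p) (planeDeriv U (1, 0) p) (planeDeriv U (0, 1) p) := hω
  have hsub : ∀ L L' : ℝ × ℝ →L[ℝ] ℝ, (L - L') (1, 0) = L (1, 0) - L' (1, 0) := fun _ _ ↦ rfl
  rw [hsub, hG, he, hsplit, ← hω']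
  change _ = _ + deriv η p.1 * (r * P (p.1, r)) + _
  ring

end ContactEnd

/-! ### Uniform constants by compactness; times are reduced to [0, 1], outside which H is stationary
-/

theorem exists_time_eq {M : Type*} {H : ℝ → M → ℝ} (hH0 : ∀ s ≤ 0, H s = H 0) (hH1 : ∀ s, 1 ≤ s → H s = H 1) (s : ℝ) :
    ∃ s' ∈ Icc (0 : ℝ) 1, H s = H s' := by
  rcases le_total s 0 with hs | hs
  · exact ⟨0, by simp, hH0 s hs⟩
  rcases le_total 1 s with hs' | hs'
  · exact ⟨1, by simp, hH1 s hs'⟩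
  · exact ⟨s, ⟨hs, hs'⟩, rfl⟩

section Bounds

open Filter

variable {n : ℕ} [NeZero n] {W : Type*} [TopologicalSpace W]
  [ChartedSpace (EuclideanHalfSpace (2 * n)) W] [IsManifold (𝓡∂ (2 * n)) ∞ W]
  [T2Space W] [CompactSpace W] [ConnectedSpace W] {D : LiouvilleDomain n W}
  {N : Type*} [TopologicalSpace N] [ChartedSpace (EuclideanSpace ℝ (Fin (2 * n - 1))) N]
  [IsManifold (𝓡 (2 * n - 1)) ∞ N]
  {What : Type*} [TopologicalSpace What] [ChartedSpace (EuclideanSpace ℝ (Fin (2 * n))) What]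
  [IsManifold (𝓡 (2 * n)) ∞ What] [T2Space What] {C : LiouvilleCompletion D N What}
  {ρ₀ : ℝ} {J : ℝ → ∀ w : What, TangentSpace (𝓡 (2 * n)) w →L[ℝ] TangentSpace (𝓡 (2 * n)) w}

variable {H : ℝ → What → ℝ} {h : ℝ → ℝ → ℝ} {κ : ℝ}

namespace LiouvilleCompletion

theorem compactSpace_boundary (C : LiouvilleCompletion D N What) : CompactSpace N := by
  have h : Topology.IsClosedEmbedding C.bd :=
    ⟨C.bd_isEmbedding, by
      rw [C.range_bd]; exact ModelWithCorners.isClosed_boundary (n := ∞) (by simp)⟩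
  exact h.compactSpace

theorem isCompact_collar_image (C : LiouvilleCompletion D N What) {a b : ℝ} (ha : 0 < a) :
    IsCompact (C.collar '' (univ ×ˢ Icc a b)) := by
  have := C.compactSpace_boundary
  refine (isCompact_univ.prod isCompact_Icc).image_of_continuousOn
    (C.collar.continuousOn.mono ?_)
  rintro q ⟨-, hq⟩
  exact C.mem_source (ha.trans_le hq.1)

/-- The complement of an end is covered by the image of W and a compact slab of the collar. -/
theorem isCompact_compl_endSet (C : LiouvilleCompletion D N What) {R : ℝ} (hR : 0 ≤ R) :
    IsCompact (C.endSet R)ᶜ := by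
  refine ((isCompact_range C.incl_smooth.continuous).union
    (C.isCompact_collar_image (b := R) one_pos)).of_isClosed_subset
    (isOpen_endSet hR).isClosed_compl fun w hw ↦ ?_
  by_cases h : w ∈ C.collar '' (univ ×ˢ Ioi 1)
  · obtain ⟨q, ⟨-, hq⟩, rfl⟩ := h
    refine Or.inr ⟨q, ⟨mem_univ _, le_of_lt hq, ?_⟩, rfl⟩
    exact not_lt.1 fun hlt ↦ hw ⟨q, ⟨mem_univ _, hlt⟩, rfl⟩
  · exact Or.inl (by rw [C.range_incl]; exact h)

end LiouvilleCompletion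

theorem radius_div_le_hamiltonian (hρ₀ : 0 < ρ₀)
    (hHh : ∀ (s : ℝ) (x : N) (ρ : ℝ), ρ₀ ≤ ρ → H s (C.collar (x, ρ)) = h s ρ)
    (hb : ∀ s ρ, ρ₀ ≤ ρ → ρ / κ ≤ h s ρ) (s : ℝ) {w : What} (hw : w ∈ C.endSet ρ₀) :
    C.radius w / κ ≤ H s w := by
  obtain ⟨x, hx, hr⟩ := mem_endSet hρ₀.le hw
  have := hb s _ hr.le
  rwa [← hHh s x _ hr.le, hx] at this

/-- Near any point `H 0` is bounded, while it grows at least like ρ/κ on the end. So locally only a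
compact slab of the end matters, and nothing escaping to infinity can accumulate at a point. -/
theorem isClosed_collar_image (hρ₀ : 0 < ρ₀) (hκ : 0 < κ) (hH : Continuous (H 0))
    (hHh : ∀ (s : ℝ) (x : N) (ρ : ℝ), ρ₀ ≤ ρ → H s (C.collar (x, ρ)) = h s ρ)
    (hb : ∀ s ρ, ρ₀ ≤ ρ → ρ / κ ≤ h s ρ) {ρ₁ : ℝ} (hρ₁ : ρ₀ ≤ ρ₁) :
    IsClosed (C.collar '' (univ ×ˢ Ici ρ₁)) := by
  rw [← isOpen_compl_iff, isOpen_iff_mem_nhds]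
  intro w hw
  have h1 := (C.isCompact_collar_image (b := κ * (H 0 w + 1)) (hρ₀.trans_le hρ₁)).isClosed
  have h2 : ∀ᶠ y in 𝓝 w, y ∉ C.collar '' (univ ×ˢ Icc ρ₁ (κ * (H 0 w + 1))) := by
    refine h1.isOpen_compl.mem_nhds fun hw' ↦ hw ?_
    exact image_mono (prod_mono_right Icc_subset_Ici_self) hw'
  filter_upwards [h2, hH.continuousAt.eventually_lt_const (lt_add_one (H 0 w))] with y hy hyH
  rintro ⟨⟨x, ρ⟩, ⟨-, hρ⟩, rfl⟩
  refine hy ⟨(x, ρ), ⟨mem_univ _, hρ, ?_⟩, rfl⟩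
  have hρ' : ρ₀ ≤ ρ := hρ₁.trans hρ
  have h3 := hb 0 ρ hρ'
  rw [hHh 0 x ρ hρ'] at hyH
  have h4 := (div_le_iff₀ hκ).1 (h3.trans hyH.le)
  change ρ ≤ _
  linarith

theorem exists_neg_le_hamiltonian (hρ₀ : 0 < ρ₀) (hκ : 0 < κ)
    (hH : Continuous fun p : ℝ × What ↦ H p.1 p.2)
    (hH0 : ∀ s ≤ 0, H s = H 0) (hH1 : ∀ s, 1 ≤ s → H s = H 1)
    (hHh : ∀ (s : ℝ) (x : N) (ρ : ℝ), ρ₀ ≤ ρ → H s (C.collar (x, ρ)) = h s ρ)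
    (hb : ∀ s ρ, ρ₀ ≤ ρ → ρ / κ ≤ h s ρ) : ∃ c, 0 ≤ c ∧ ∀ s w, -c ≤ H s w := by
  obtain ⟨c, hc⟩ := ((isCompact_Icc (a := (0 : ℝ)) (b := 1)).prod
    (C.isCompact_compl_endSet hρ₀.le)).exists_bound_of_continuousOn hH.continuousOn
  refine ⟨max c 0, le_max_right _ _, fun s w ↦ ?_⟩
  by_cases hw : w ∈ C.endSet ρ₀
  · have h1 := radius_div_le_hamiltonian hρ₀ hHh hb s hw
    obtain ⟨x, -, hr⟩ := mem_endSet hρ₀.le hw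
    have h2 : 0 ≤ C.radius w / κ := div_nonneg (hρ₀.trans hr).le hκ.le
    have := le_max_right c 0
    linarith
  · obtain ⟨s', hs', e⟩ := exists_time_eq hH0 hH1 s
    have h1 := (abs_le.1 (hc (s', w) ⟨hs', hw⟩)).1
    rw [e]
    have := le_max_left c 0
    simp only at h1
    linarith

/-- Compactness spreads the condition on the zero level to a neighbourhood: on the compact set of
times in [0, 1] and points off the end where λ(X_H) - H ≤ θ/2, |H| has a positive minimum. -/
theorem exists_level_bound (hρ₀ : 0 < ρ₀) (hκ : 0 < κ)
    (hH : ContMDiff (𝓘(ℝ, ℝ).prod (𝓡 (2 * n))) 𝓘(ℝ, ℝ) ∞ (fun p : ℝ × What ↦ H p.1 p.2))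
    (hH0 : ∀ s ≤ 0, H s = H 0) (hH1 : ∀ s, 1 ≤ s → H s = H 1) {θ : ℝ} (hθ : 0 < θ)
    (hHθ : ∀ s w, H s w = 0 → θ ≤ C.lam w (hamiltonianVF C.lam (H s) w) - H s w)
    (hHh : ∀ (s : ℝ) (x : N) (ρ : ℝ), ρ₀ ≤ ρ → H s (C.collar (x, ρ)) = h s ρ)
    (hb : ∀ s ρ, ρ₀ ≤ ρ → ρ / κ ≤ h s ρ) :
    ∃ ε > 0, ∀ s w, |H s w| ≤ ε → w ∈ (C.endSet ρ₀)ᶜ ∧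
      θ / 2 ≤ C.lam w (hamiltonianVF C.lam (H s) w) - H s w := by
  set S : Set (ℝ × What) := (Icc 0 1 ×ˢ (C.endSet ρ₀)ᶜ) ∩
    {p | C.lam p.2 (hamiltonianVF C.lam (H p.1) p.2) - H p.1 p.2 ≤ θ / 2} with hS
  have hc := (continuous_lam_hamiltonianVF C.smooth C.nondegenerate hH).sub hH.continuous
  have hSc : IsCompact S := (isCompact_Icc.prod (C.isCompact_compl_endSet hρ₀.le)).inter_right
    (isClosed_le hc continuous_const)
  obtain ⟨δ, hδ, hSδ⟩ : ∃ δ > 0, ∀ p ∈ S, δ ≤ |H p.1 p.2| := by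
    rcases S.eq_empty_or_nonempty with hS0 | hS0
    · exact ⟨1, one_pos, by simp [hS0]⟩
    · obtain ⟨p, hp, hmin⟩ := hSc.exists_isMinOn hS0 hH.continuous.abs.continuousOn
      refine ⟨|H p.1 p.2|, abs_pos.2 fun h0 ↦ ?_, fun q hq ↦ hmin hq⟩
      have h1 := hHθ p.1 p.2 h0
      have h2 : _ ≤ θ / 2 := hp.2
      linarith
  -- Halving δ gives the strict inequality for the contradiction; ρ₀/κ excludes the end, where H >
  -- ρ₀/κ.
  refine ⟨min (δ / 2) (ρ₀ / κ), lt_min (by positivity) (by positivity), fun s w hw ↦ ?_⟩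
  have hw1 := hw.trans (min_le_left _ _)
  have hw2 := hw.trans (min_le_right _ _)
  have hwK : w ∈ (C.endSet ρ₀)ᶜ := by
    intro hwe
    have h1 := radius_div_le_hamiltonian hρ₀ hHh hb s hwe
    obtain ⟨x, -, hr⟩ := mem_endSet hρ₀.le hwe
    have h2 : ρ₀ / κ < C.radius w / κ := div_lt_div_of_pos_right hr hκ
    have := le_abs_self (H s w)
    linarith
  refine ⟨hwK, ?_⟩
  by_contra! hcon
  obtain ⟨s', hs', e⟩ := exists_time_eq hH0 hH1 s
  rw [e] at hcon hw1
  have h1 := hSδ (s', w) ⟨⟨hs', hwK⟩, hcon.le⟩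
  simp only at h1
  linarith

/-- The optimal constants are |Y|² and |X_H|². Periodicity in t and stationarity in s reduce their
boundedness to a compact set of parameters. -/
theorem exists_comparison_bound (hJ : IsCompatibleLoop C.lam J)
    (hH : ContMDiff (𝓘(ℝ, ℝ).prod (𝓡 (2 * n))) 𝓘(ℝ, ℝ) ∞ (fun p : ℝ × What ↦ H p.1 p.2))
    (hH0 : ∀ s ≤ 0, H s = H 0) (hH1 : ∀ s, 1 ≤ s → H s = H 1) {K : Set What}
    (hK : IsCompact K) :
    ∃ c > 0, ∀ s t, ∀ w ∈ K, ∀ v : TangentSpace (𝓡 (2 * n)) w,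
      C.lam w v ^ 2 ≤ c ^ 2 * extDerivOneForm (𝓡 (2 * n)) C.lam w (J t w v) v ∧
      differential (m := 2 * n) (H s) w v ^ 2 ≤
        c ^ 2 * extDerivOneForm (𝓡 (2 * n)) C.lam w (J t w v) v := by
  obtain ⟨a, ha⟩ := ((isCompact_Icc (a := (0 : ℝ)) (b := 1)).prod hK).exists_bound_of_continuousOn
    (continuous_lam_liouvilleVF C.smooth C.nondegenerate hJ).continuousOn
  obtain ⟨b, hb⟩ := ((isCompact_Icc (a := (0 : ℝ)) (b := 1)).prod
    ((isCompact_Icc (a := (0 : ℝ)) (b := 1)).prod hK)).exists_bound_of_continuousOn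
    (continuous_mfderiv_hamiltonianVF C.smooth C.nondegenerate hJ hH).continuousOn
  have hc : (1 : ℝ) ≤ max 1 (max a b) := le_max_left _ _
  have hcc : max 1 (max a b) ≤ max 1 (max a b) ^ 2 := le_self_pow₀ hc (by norm_num)
  have hac : a ≤ max 1 (max a b) ^ 2 := ((le_max_left a b).trans (le_max_right _ _)).trans hcc
  have hbc : b ≤ max 1 (max a b) ^ 2 := ((le_max_right a b).trans (le_max_right _ _)).trans hcc
  refine ⟨max 1 (max a b), by linarith, fun s t w hw v ↦ ?_⟩
  obtain ⟨s', hs', es⟩ := exists_time_eq hH0 hH1 s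
  obtain ⟨t', ht', et⟩ := Function.Periodic.exists_mem_Ico₀ (f := J) (c := 1) hJ.periodic one_pos t
  have ht'' : t' ∈ Icc (0 : ℝ) 1 := Ico_subset_Icc_self ht'
  rw [es, et]
  have hv := hJ.nonneg t' w v
  have h1 := (abs_le.1 (ha (t', w) ⟨ht'', hw⟩)).1
  have h2 := (abs_le.1 (hb (t', s', w) ⟨ht'', hs', hw⟩)).2
  exact ⟨(hJ.lam_sq_le C.nondegenerate t' w v).trans
      (mul_le_mul_of_nonneg_right (by simp only at h1; linarith) hv),
    (hJ.differential_sq_le C.nondegenerate (H s') t' w v).trans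
      (mul_le_mul_of_nonneg_right (h2.trans hbc) hv)⟩

end Bounds

/-! ### The bound on the multiplier η -/

section Multiplier

variable {m : ℕ} {M : Type*} [TopologicalSpace M] [ChartedSpace (EuclideanSpace ℝ (Fin m)) M]
  [IsManifold (𝓡 m) ∞ M]
  {lam : ∀ w : M, TangentSpace (𝓡 m) w →L[ℝ] ℝ}
  {J : ℝ → ∀ w : M, TangentSpace (𝓡 m) w →L[ℝ] TangentSpace (𝓡 m) w}
  {H : ℝ → M → ℝ} {u : ℝ → ℝ → M} {η : ℝ → ℝ} {K : Set M} {ε c δ : ℝ}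

namespace IsRFSolution

theorem integral_energyDensity_nonneg (hJ : IsCompatibleLoop lam J) (s : ℝ) :
    0 ≤ ∫ t in (0 : ℝ)..1, energyDensity lam J u (s, t) :=
  intervalIntegral.integral_nonneg zero_le_one fun t _ ↦ energyDensity_nonneg hJ (s, t)

theorem gradNormSq_nonneg (hJ : IsCompatibleLoop lam J) (sol : IsRFSolution lam J H u η) (s : ℝ) :
    0 ≤ gradNormSq lam J (H s) (u s) (η s) := by
  rw [sol.gradNormSq_eq hJ]
  have := integral_energyDensity_nonneg (u := u) hJ s
  positivity

theorem integral_energyDensity_le (hJ : IsCompatibleLoop lam J) (sol : IsRFSolution lam J H u η)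
    (s : ℝ) : ∫ t in (0 : ℝ)..1, energyDensity lam J u (s, t) ≤
      gradNormSq lam J (H s) (u s) (η s) := by
  rw [sol.gradNormSq_eq hJ]
  nlinarith [sq_nonneg (∫ t in (0 : ℝ)..1, H s (u s t))]

theorem deriv_sq_le (hJ : IsCompatibleLoop lam J) (sol : IsRFSolution lam J H u η) (s : ℝ) :
    deriv η s ^ 2 ≤ gradNormSq lam J (H s) (u s) (η s) := by
  rw [sol.gradNormSq_eq hJ, sol.eq_η]
  linarith [integral_energyDensity_nonneg (u := u) hJ s]

/-- A loop with small gradient stays close to the zero level of the Hamiltonian. -/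
theorem abs_hamiltonian_le (hlam : IsSmoothOneForm (𝓡 m) lam)
    (hnd : HasNondegenerateDeriv (𝓡 m) lam) (hJ : IsCompatibleLoop lam J)
    (hH : ContMDiff (𝓘(ℝ, ℝ).prod (𝓡 m)) 𝓘(ℝ, ℝ) ∞ (fun p : ℝ × M ↦ H p.1 p.2))
    (sol : IsRFSolution lam J H u η) (hε : 0 < ε) (hK : ∀ s w, |H s w| ≤ ε → w ∈ K) (hc : 0 < c)
    (hcH : ∀ s t, ∀ w ∈ K, ∀ v : TangentSpace (𝓡 m) w, differential (m := m) (H s) w v ^ 2 ≤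
      c ^ 2 * extDerivOneForm (𝓡 m) lam w (J t w v) v) (hδ : 0 < δ) (hδε : δ ≤ ε / 2)
    (hδc : δ ≤ ε / (4 * c)) {s : ℝ} (hs : gradNormSq lam J (H s) (u s) (η s) ≤ δ ^ 2) (t : ℝ) :
    |H s (u s t)| ≤ ε := by
  have hHs : Continuous fun t ↦ H s (u s t) :=
    (continuous_hamiltonian_comp hH sol.smooth_u).comp (Continuous.prodMk_right s)
  have hes : Continuous fun t ↦ energyDensity lam J u (s, t) :=
    (sol.continuous_energyDensity hlam hnd hJ hH).comp (Continuous.prodMk_right s)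
  have h1 := (sol.integral_energyDensity_le hJ s).trans hs
  have h2 := (sol.deriv_sq_le hJ s).trans hs
  rw [sol.eq_η] at h2
  -- The mean of H is at most ε/2 in absolute value, hence so is |H| at some `t₀`. The continuity
  -- argument is run over the period starting at `t₀`.
  obtain ⟨t₀, -, ht₀⟩ := exists_abs_le_of_abs_integral_le hHs ((abs_le_of_sq_le_sq h2 hδ.le).trans hδε)
  have h3 : Function.Periodic (fun t ↦ energyDensity lam J u (s, t)) 1 := fun t ↦
    sol.energyDensity_add_one hJ s t
  have h4 := abs_le_of_sq_deriv_le hε hc (sol.hasDerivAt_hamiltonian hnd hJ hH s) hes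
    (fun t ↦ energyDensity_nonneg hJ _) (a := t₀) (fun t _ ht ↦ by
      have := hcH s t (u s t) (hK _ _ ht) (J t (u s t) (velocity (fun σ ↦ u σ t) s))
      rw [hJ.map_map] at this
      exact this) ht₀ (by
      rw [h3.intervalIntegral_add_eq t₀ 0, zero_add]
      exact h1.trans (pow_le_pow_left₀ hδ.le hδc 2))
  have h5 : Function.Periodic (fun t ↦ H s (u s t)) 1 := fun t ↦ congrArg (H s) (sol.periodic_u s t)
  obtain ⟨t', ht', e⟩ := h5.exists_mem_Ico one_pos t t₀
  rw [e]
  exact h4 t' (Ico_subset_Icc_self ht')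

/-- The action equals ∫ λ(J ∂_s u) + η ∫ (λ(X_H) - H). The loop lies in K, so the first integral is
controlled by the energy of the loop, while the coefficient of η is at least θ/2. -/
theorem abs_multiplier_le (hlam : IsSmoothOneForm (𝓡 m) lam)
    (hnd : HasNondegenerateDeriv (𝓡 m) lam) (hJ : IsCompatibleLoop lam J)
    (hH : ContMDiff (𝓘(ℝ, ℝ).prod (𝓡 m)) 𝓘(ℝ, ℝ) ∞ (fun p : ℝ × M ↦ H p.1 p.2))
    (sol : IsRFSolution lam J H u η) (hε : 0 < ε) {θ : ℝ} (hθ : 0 < θ)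
    (hK : ∀ s w, |H s w| ≤ ε → w ∈ K ∧ θ / 2 ≤ lam w (hamiltonianVF lam (H s) w) - H s w)
    (hc : 0 < c)
    (hcH : ∀ s t, ∀ w ∈ K, ∀ v : TangentSpace (𝓡 m) w,
      lam w v ^ 2 ≤ c ^ 2 * extDerivOneForm (𝓡 m) lam w (J t w v) v ∧
      differential (m := m) (H s) w v ^ 2 ≤
        c ^ 2 * extDerivOneForm (𝓡 m) lam w (J t w v) v) (hδ : 0 < δ) (hδε : δ ≤ ε / 2)
    (hδc : δ ≤ ε / (4 * c)) {s A : ℝ} (hs : gradNormSq lam J (H s) (u s) (η s) ≤ δ ^ 2)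
    (hA : |action lam (H s) (u s) (η s)| ≤ A) :
    |η s| ≤ 2 * (A + c * (1 + δ ^ 2)) / θ := by
  have hHε := sol.abs_hamiltonian_le hlam hnd hJ hH hε (fun s w hw ↦ (hK s w hw).1) hc
    (fun s t w hw v ↦ (hcH s t w hw v).2) hδ hδε hδc hs
  have hHs : Continuous fun t ↦ H s (u s t) :=
    (continuous_hamiltonian_comp hH sol.smooth_u).comp (Continuous.prodMk_right s)
  have hes : Continuous fun t ↦ energyDensity lam J u (s, t) :=
    (sol.continuous_energyDensity hlam hnd hJ hH).comp (Continuous.prodMk_right s)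
  have hX : Continuous fun t ↦ lam (u s t) (hamiltonianVF lam (H s) (u s t)) :=
    (continuous_lam_hamiltonianVF hlam hnd hH).comp (continuous_const.prodMk
      (sol.smooth_u.continuous.comp (Continuous.prodMk_right s)))
  have hV : Continuous fun t ↦ lam (u s t) (velocity (u s) t) := by
    have h1 := (contDiff_lam_planeDeriv hlam sol.smooth_u (0, 1)).continuous.comp
      (Continuous.prodMk_right s)
    refine h1.congr fun t ↦ ?_
    exact congrArg (lam (u s t)) (velocity_snd_eq sol.smooth_u (s, t)).symm
  set a : ℝ → ℝ := fun t ↦ lam (u s t) (J t (u s t) (velocity (fun σ ↦ u σ t) s)) with ha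
  set b : ℝ → ℝ := fun t ↦ lam (u s t) (hamiltonianVF lam (H s) (u s t)) - H s (u s t) with hb
  have hbc : Continuous b := hX.sub hHs
  have hVa : ∀ t, lam (u s t) (velocity (u s) t) - η s * H s (u s t) = a t + η s * b t := by
    intro t
    rw [sol.lam_velocity hJ s t]
    simp only [ha, hb]
    ring
  have hac : Continuous a := by
    have h1 : a = fun t ↦ lam (u s t) (velocity (u s) t) - η s * H s (u s t) - η s * b t :=
      funext fun t ↦ by linarith [hVa t]
    rw [h1]
    exact (hV.sub (hHs.const_mul (η s))).sub (hbc.const_mul (η s))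
  have haction : action lam (H s) (u s) (η s) =
      (∫ t in (0 : ℝ)..1, a t) + η s * ∫ t in (0 : ℝ)..1, b t := by
    rw [action, ← intervalIntegral.integral_const_mul, ← intervalIntegral.integral_const_mul,
      ← intervalIntegral.integral_sub (hV.intervalIntegrable _ _)
        ((hHs.const_mul (η s)).intervalIntegrable _ _),
      ← intervalIntegral.integral_add (hac.intervalIntegrable _ _)
        ((hbc.const_mul (η s)).intervalIntegrable _ _)]
    simp_rw [hVa]
  have hI : |∫ t in (0 : ℝ)..1, a t| ≤ c * (1 + δ ^ 2) := by
    have h1 : ∀ t, |a t| ≤ c * (1 + energyDensity lam J u (s, t)) := by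
      intro t
      have h2 := (hcH s t (u s t) (hK _ _ (hHε t)).1 (J t (u s t) (velocity (fun σ ↦ u σ t) s))).1
      rw [hJ.map_map] at h2
      have he0 := energyDensity_nonneg (u := u) hJ (s, t)
      have h3 : a t ^ 2 ≤ c ^ 2 * energyDensity lam J u (s, t) := h2
      refine abs_le_of_sq_le_sq (h3.trans ?_) (by positivity)
      rw [mul_pow]
      exact mul_le_mul_of_nonneg_left (by nlinarith) (by positivity)
    refine (intervalIntegral.abs_integral_le_integral_abs zero_le_one).trans ?_
    refine (intervalIntegral.integral_mono_on zero_le_one (hac.abs.intervalIntegrable _ _)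
      (((hes.const_add 1).const_mul c).intervalIntegrable _ _) fun t _ ↦ h1 t).trans ?_
    rw [intervalIntegral.integral_const_mul, intervalIntegral.integral_add
      intervalIntegrable_const (hes.intervalIntegrable _ _)]
    refine mul_le_mul_of_nonneg_left ?_ hc.le
    have h2 := (sol.integral_energyDensity_le hJ s).trans hs
    simp only [intervalIntegral.integral_const, sub_zero, smul_eq_mul, mul_one]
    linarith
  have hB : θ / 2 ≤ ∫ t in (0 : ℝ)..1, b t := by
    have h1 := intervalIntegral.integral_mono_on (a := (0 : ℝ)) (b := 1) (μ := volume) (f := fun _ ↦ θ / 2)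
      zero_le_one
      intervalIntegrable_const
      (hbc.intervalIntegrable _ _) fun t _ ↦ (hK _ _ (hHε t)).2
    simpa using h1
  have h5 : |η s| * (∫ t in (0 : ℝ)..1, b t) ≤ A + c * (1 + δ ^ 2) := by
    rw [← abs_of_nonneg ((half_pos hθ).le.trans hB), ← abs_mul]
    have h6 : η s * ∫ t in (0 : ℝ)..1, b t =
        action lam (H s) (u s) (η s) - ∫ t in (0 : ℝ)..1, a t := by rw [haction]; ring
    rw [h6]
    exact (abs_sub _ _).trans (add_le_add hA hI)
  rw [le_div_iff₀ hθ]
  have h7 := mul_le_mul_of_nonneg_left hB (abs_nonneg (η s))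
  linarith

end IsRFSolution

/-- The Lagrange multiplier is bounded along solutions with bounded action and energy. -/
theorem exists_forall_abs_multiplier_le (hlam : IsSmoothOneForm (𝓡 m) lam)
    (hnd : HasNondegenerateDeriv (𝓡 m) lam) (hJ : IsCompatibleLoop lam J)
    (hH : ContMDiff (𝓘(ℝ, ℝ).prod (𝓡 m)) 𝓘(ℝ, ℝ) ∞ (fun p : ℝ × M ↦ H p.1 p.2))
    (hε : 0 < ε) {θ : ℝ} (hθ : 0 < θ)
    (hK : ∀ s w, |H s w| ≤ ε → w ∈ K ∧ θ / 2 ≤ lam w (hamiltonianVF lam (H s) w) - H s w)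
    (hc : 0 < c)
    (hcH : ∀ s t, ∀ w ∈ K, ∀ v : TangentSpace (𝓡 m) w,
      lam w v ^ 2 ≤ c ^ 2 * extDerivOneForm (𝓡 m) lam w (J t w v) v ∧
      differential (m := m) (H s) w v ^ 2 ≤
        c ^ 2 * extDerivOneForm (𝓡 m) lam w (J t w v) v) (A E : ℝ) :
    ∃ B, ∀ (u : ℝ → ℝ → M) (η : ℝ → ℝ), IsRFSolution lam J H u η →
      (∀ s, |action lam (H s) (u s) (η s)| ≤ A) →
      Integrable (fun s ↦ gradNormSq lam J (H s) (u s) (η s)) →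
      (∫ s, gradNormSq lam J (H s) (u s) (η s)) ≤ E → ∀ s, |η s| ≤ B := by
  obtain ⟨δ, hδ, hδ'⟩ : ∃ δ > 0, δ ≤ min (ε / 2) (ε / (4 * c)) :=
    ⟨_, lt_min (by positivity) (by positivity), le_rfl⟩
  -- Chosen so that δ² L > E: every window of length L contains a time at which the squared gradient
  -- is below δ².
  set L := (|E| + 1) / δ ^ 2 with hL
  have hL0 : 0 < L := by positivity
  -- The bound at a good time, plus the variation of η over at most one window.
  refine ⟨2 * (A + c * (1 + δ ^ 2)) / θ + (L + E), fun u η sol hA hG hE s ↦ ?_⟩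
  have hEL : E < δ ^ 2 * L := by
    rw [hL, mul_div_cancel₀ _ (by positivity)]
    linarith [le_abs_self E]
  obtain ⟨s', hs', hlt⟩ := exists_lt_of_integral_le hG (sol.gradNormSq_nonneg hJ) hE hL0.le hEL s
  have h1 := sol.abs_multiplier_le hlam hnd hJ hH hε hθ hK hc hcH hδ
    (hδ'.trans (min_le_left _ _)) (hδ'.trans (min_le_right _ _)) hlt.le (hA s')
  have h2 := abs_sub_le_of_sq_deriv_le (sol.smooth_η.of_le (by norm_num)) hG
    (sol.deriv_sq_le hJ) hE hs'.1
  have h3 := abs_sub_abs_le_abs_sub (η s) (η s')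
  rw [abs_sub_comm] at h3
  linarith [hs'.2]

end Multiplier

/-! ### Polynomial bounds for the terms of the Laplacian -/

section ProfileBounds

variable {h : ℝ → ℝ → ℝ} {ρ₀ κ γ : ℝ}

theorem abs_fderiv_radialDeriv_le
    (hh : ContDiffOn ℝ ∞ (fun p : ℝ × ℝ ↦ h p.1 p.2) (univ ×ˢ Ici ρ₀))
    (hc : ∀ s ρ, ρ₀ ≤ ρ →
      |derivWithin (derivWithin (h s) (Ici ρ₀)) (Ici ρ₀) ρ| ≤ κ * ρ ^ γ ∧
      |deriv (fun σ ↦ derivWithin (h σ) (Ici ρ₀) ρ) s| ≤ κ * ρ ^ γ) (s : ℝ) {ρ : ℝ} (hρ : ρ₀ < ρ) :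
    |fderiv ℝ (fun p : ℝ × ℝ ↦ radialDeriv h ρ₀ p.1 p.2) (s, ρ) (0, 1)| ≤ κ * ρ ^ γ ∧
      |fderiv ℝ (fun p : ℝ × ℝ ↦ radialDeriv h ρ₀ p.1 p.2) (s, ρ) (1, 0)| ≤ κ * ρ ^ γ := by
  obtain ⟨h1, h2⟩ := hc s ρ hρ.le
  rw [derivWithin_of_mem_nhds (Ici_mem_nhds hρ)] at h1
  exact ⟨by rw [← (fderiv_radialDeriv_snd hh s hρ).deriv]; exact h1,
    by rw [← (fderiv_radialDeriv_fst hh s hρ).deriv]; exact h2⟩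

/-- The mean value inequality from `ρ₁`, taken strictly inside the domain so that the one-sided
second derivatives in the hypothesis are genuine ones. -/
theorem radialDeriv_le (hκ : 0 < κ)
    (hh : ContDiffOn ℝ ∞ (fun p : ℝ × ℝ ↦ h p.1 p.2) (univ ×ˢ Ici ρ₀))
    (hc : ∀ s ρ, ρ₀ ≤ ρ →
      |derivWithin (derivWithin (h s) (Ici ρ₀)) (Ici ρ₀) ρ| ≤ κ * ρ ^ γ ∧
      |deriv (fun σ ↦ derivWithin (h σ) (Ici ρ₀) ρ) s| ≤ κ * ρ ^ γ) (hγ : 0 ≤ γ) {ρ₁ ρ : ℝ}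
    (hρ₀ : 0 < ρ₀) (hρ₁ : ρ₀ < ρ₁) (hρ : ρ₁ ≤ ρ) (s : ℝ) :
    radialDeriv h ρ₀ s ρ ≤ radialDeriv h ρ₀ s ρ₁ + κ * ρ ^ γ * (ρ - ρ₁) := by
  have h1 := (convex_Icc ρ₁ ρ).norm_image_sub_le_of_norm_hasDerivWithin_le
    (f := radialDeriv h ρ₀ s) (C := κ * ρ ^ γ)
    (fun x hx ↦ (fderiv_radialDeriv_snd hh s (hρ₁.trans_le hx.1)).hasDerivWithinAt)
    (fun x hx ↦ ((abs_fderiv_radialDeriv_le hh hc s (hρ₁.trans_le hx.1)).1).trans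
      (mul_le_mul_of_nonneg_left (Real.rpow_le_rpow (by linarith [hx.1]) hx.2 hγ) hκ.le))
    (left_mem_Icc.2 hρ) (right_mem_Icc.2 hρ)
  rw [Real.norm_eq_abs, Real.norm_eq_abs, abs_of_nonneg (sub_nonneg.2 hρ)] at h1
  linarith [le_abs_self (radialDeriv h ρ₀ s ρ - radialDeriv h ρ₀ s ρ₁)]

/-- The algebra behind the lower bound on the Laplacian of the fourth power of the radius. -/
theorem neg_mul_pow_le_of_bounds {z r b e P Ps Pr rs η η' c B M κ : ℝ} {g : ℕ} (hb : 1 ≤ b)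
    (hz0 : 0 ≤ z) (hzb : z ≤ b) (hr0 : 0 ≤ r) (hrb : r ≤ b) (he : 0 ≤ e) (hrs : rs ^ 2 ≤ r * e)
    (hκ : 0 ≤ κ) (hc : 0 ≤ c) (hM : 0 ≤ M) (hη' : -c ≤ η') (hη : |η| ≤ B) (hP0 : 0 ≤ P)
    (hP : P ≤ M + κ * b ^ (g + 1)) (hPs : |Ps| ≤ κ * b ^ g) (hPr : |Pr| ≤ κ * b ^ g) :
    -(4 * (B ^ 2 * κ ^ 2 + c * (M + κ) + B * κ) * b ^ (2 * g + 6)) ≤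
      4 * z ^ 3 * (e + η' * (r * P) + η * r * (Ps + rs * Pr)) := by
  have hb0 : 0 < b := by linarith
  have hB : 0 ≤ B := (abs_nonneg η).trans hη
  have hpow : ∀ k l : ℕ, k ≤ l → b ^ k ≤ b ^ l := fun k l hkl ↦ pow_le_pow_right₀ hb hkl
  -- Only a lower bound for η' is available; it suffices because r P ≥ 0. This is where monotonicity
  -- of h in ρ enters.
  have h1 : -(c * (M + κ) * b ^ (2 * g + 3)) ≤ η' * (r * P) := by
    have hP' : P ≤ (M + κ) * b ^ (g + 1) := by
      have : 1 ≤ b ^ (g + 1) := one_le_pow₀ hb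
      nlinarith
    have h2 : r * P ≤ b * ((M + κ) * b ^ (g + 1)) := mul_le_mul hrb hP' hP0 hb0.le
    have h3 : b * ((M + κ) * b ^ (g + 1)) = (M + κ) * b ^ (g + 2) := by ring
    have h4 : (M + κ) * b ^ (g + 2) ≤ (M + κ) * b ^ (2 * g + 3) :=
      mul_le_mul_of_nonneg_left (hpow _ _ (by omega)) (by positivity)
    have h5 : c * (r * P) ≤ c * ((M + κ) * b ^ (2 * g + 3)) :=
      mul_le_mul_of_nonneg_left (by linarith) hc
    nlinarith [mul_nonneg hr0 hP0]
  have h2 : |η * r * Ps| ≤ B * κ * b ^ (2 * g + 3) := by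
    rw [abs_mul, abs_mul, abs_of_nonneg hr0]
    have h3 : |η| * r * |Ps| ≤ B * b * (κ * b ^ g) := by gcongr
    have h4 : B * b * (κ * b ^ g) = B * κ * b ^ (g + 1) := by ring
    have h5 : B * κ * b ^ (g + 1) ≤ B * κ * b ^ (2 * g + 3) :=
      mul_le_mul_of_nonneg_left (hpow _ _ (by omega)) (by positivity)
    linarith
  -- The only term containing the gradient. As rs² ≤ b e, Young's inequality gives X |rs| ≤ e + X²
  -- b, and the e in the Laplacian absorbs it. The remainder has the largest exponent, 2g + 3; the
  -- cube of z raises it to 2g + 6.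
  have h3 : -(B ^ 2 * κ ^ 2 * b ^ (2 * g + 3)) ≤ e + η * r * (rs * Pr) := by
    set X := B * κ * b ^ (g + 1) with hX
    have hX0 : 0 ≤ X := by positivity
    have h4 : |η * r * (rs * Pr)| ≤ X * |rs| := by
      rw [abs_mul, abs_mul, abs_mul, abs_of_nonneg hr0]
      have : |η| * r * (|rs| * |Pr|) ≤ B * b * (|rs| * (κ * b ^ g)) := by gcongr
      refine this.trans (le_of_eq ?_)
      rw [hX]; ring
    have h5 : |rs| ^ 2 ≤ b * e := by
      rw [sq_abs]
      exact hrs.trans (mul_le_mul_of_nonneg_right hrb he)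
    have h6 : X ^ 2 * b = B ^ 2 * κ ^ 2 * b ^ (2 * g + 3) := by rw [hX]; ring
    have h7 : X * |rs| ≤ e + X ^ 2 * b := by
      have h8 : b * (X * |rs|) ≤ b * (e + X ^ 2 * b) := by
        nlinarith [sq_nonneg (|rs| - X * b), mul_nonneg hX0 (abs_nonneg rs), sq_nonneg (X * b)]
      exact le_of_mul_le_mul_left h8 hb0
    have := neg_abs_le (η * r * (rs * Pr))
    rw [← h6]
    linarith
  set T := B ^ 2 * κ ^ 2 + c * (M + κ) + B * κ with hT
  have hT0 : 0 ≤ T := by positivity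
  have h4 : -(T * b ^ (2 * g + 3)) ≤ e + η' * (r * P) + η * r * (Ps + rs * Pr) := by
    have := neg_abs_le (η * r * Ps)
    have e1 : T * b ^ (2 * g + 3) = B ^ 2 * κ ^ 2 * b ^ (2 * g + 3) +
      c * (M + κ) * b ^ (2 * g + 3) + B * κ * b ^ (2 * g + 3) := by rw [hT]; ring
    rw [e1, mul_add]
    linarith
  have h5 : z ^ 3 ≤ b ^ 3 := pow_le_pow_left₀ hz0 hzb 3
  have h6 : 4 * z ^ 3 * (T * b ^ (2 * g + 3)) ≤ 4 * b ^ 3 * (T * b ^ (2 * g + 3)) := by gcongr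
  have h7 : 4 * b ^ 3 * (T * b ^ (2 * g + 3)) = 4 * T * b ^ (2 * g + 6) := by ring
  have h8 := mul_le_mul_of_nonneg_left h4 (by positivity : 0 ≤ 4 * z ^ 3)
  linarith

end ProfileBounds

/-! ### The barrier, a smoothed square root of the radius -/

section Barrier

open Filter

variable {n : ℕ} [NeZero n] {W : Type*} [TopologicalSpace W]
  [ChartedSpace (EuclideanHalfSpace (2 * n)) W] [IsManifold (𝓡∂ (2 * n)) ∞ W]
  [T2Space W] [CompactSpace W] [ConnectedSpace W] {D : LiouvilleDomain n W}
  {N : Type*} [TopologicalSpace N] [ChartedSpace (EuclideanSpace ℝ (Fin (2 * n - 1))) N]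
  [IsManifold (𝓡 (2 * n - 1)) ∞ N]
  {What : Type*} [TopologicalSpace What] [ChartedSpace (EuclideanSpace ℝ (Fin (2 * n))) What]
  [IsManifold (𝓡 (2 * n)) ∞ What] [T2Space What] {C : LiouvilleCompletion D N What}
  {ρ₀ : ℝ} {J : ℝ → ∀ w : What, TangentSpace (𝓡 (2 * n)) w →L[ℝ] TangentSpace (𝓡 (2 * n)) w}

variable {H : ℝ → What → ℝ} {h : ℝ → ℝ → ℝ} {κ : ℝ}

variable {γ ρ₁ : ℝ} {u : ℝ → ℝ → What} {η : ℝ → ℝ}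

open Classical in
/-- A function of the radius which is constant away from the end and grows like the square root of
the radius. -/
def LiouvilleCompletion.barrier (C : LiouvilleCompletion D N What) (ρ₀ ρ₁ : ℝ) (w : What) : ℝ :=
  if w ∈ C.endSet ρ₀ then rootProfile (C.radius w - ρ₁) else 1

theorem rootProfile_of_nonpos {x : ℝ} (hx : x ≤ 0) : rootProfile x = 1 := by
  simp [rootProfile, max_eq_left hx]

theorem barrier_of_mem {w : What} (hw : w ∈ C.endSet ρ₀) :
    C.barrier ρ₀ ρ₁ w = rootProfile (C.radius w - ρ₁) := if_pos hw

theorem barrier_of_notMem {w : What} (hw : w ∉ C.endSet ρ₀) : C.barrier ρ₀ ρ₁ w = 1 := if_neg hw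

theorem one_le_barrier (w : What) : 1 ≤ C.barrier ρ₀ ρ₁ w := by
  by_cases hw : w ∈ C.endSet ρ₀
  · rw [barrier_of_mem hw]; exact one_le_rootProfile _
  · rw [barrier_of_notMem hw]

theorem barrier_comp_eventuallyEq (hρ₀ : 0 ≤ ρ₀)
    (hu : Continuous fun p : ℝ × ℝ ↦ u p.1 p.2) {p : ℝ × ℝ} (hp : u p.1 p.2 ∈ C.endSet ρ₀) :
    (fun p : ℝ × ℝ ↦ C.barrier ρ₀ ρ₁ (u p.1 p.2)) =ᶠ[𝓝 p]
      fun p ↦ rootProfile (C.radius (u p.1 p.2) - ρ₁) := by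
  filter_upwards [hu.continuousAt.eventually ((isOpen_endSet hρ₀).mem_nhds hp)] with q hq
  exact barrier_of_mem hq

/-- The open end beyond `ρ₀` and the complement of the closed end from `ρ₁` cover the completion,
and the barrier is 1 on the latter. Every local statement is thus checked on the end or for a
constant. -/
theorem mem_endSet_or_barrier_comp_eventuallyEq (hρ₀ : 0 < ρ₀) (hρ₁ : ρ₀ < ρ₁)
    (hcl : IsClosed (C.collar '' (univ ×ˢ Ici ρ₁)))
    (hu : Continuous fun p : ℝ × ℝ ↦ u p.1 p.2) (p : ℝ × ℝ) :
    u p.1 p.2 ∈ C.endSet ρ₀ ∨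
      (fun p : ℝ × ℝ ↦ C.barrier ρ₀ ρ₁ (u p.1 p.2)) =ᶠ[𝓝 p] fun _ ↦ 1 := by
  by_cases hp : u p.1 p.2 ∈ C.collar '' (univ ×ˢ Ici ρ₁)
  · exact Or.inl (image_mono (prod_mono_right (Ici_subset_Ioi.2 hρ₁)) hp)
  · right
    filter_upwards [hu.continuousAt.eventually (hcl.isOpen_compl.mem_nhds hp)] with q hq
    by_cases hq' : u q.1 q.2 ∈ C.endSet ρ₀
    · rw [barrier_of_mem hq']
      obtain ⟨x, hx, -⟩ := mem_endSet hρ₀.le hq'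
      refine rootProfile_of_nonpos (not_lt.1 fun hlt ↦ hq ⟨_, ⟨mem_univ _, ?_⟩, hx⟩)
      exact le_of_lt (sub_pos.1 hlt)
    · exact barrier_of_notMem hq'

theorem contDiff_barrier_comp (hρ₀ : 0 < ρ₀) (hρ₁ : ρ₀ < ρ₁)
    (hcl : IsClosed (C.collar '' (univ ×ˢ Ici ρ₁))) (sol : IsRFSolution C.lam J H u η) :
    ContDiff ℝ 2 fun p : ℝ × ℝ ↦ C.barrier ρ₀ ρ₁ (u p.1 p.2) := by
  have hu := sol.smooth_u.continuous
  refine contDiff_iff_contDiffAt.2 fun p ↦ ?_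
  rcases mem_endSet_or_barrier_comp_eventuallyEq hρ₀ hρ₁ hcl hu p with hp | hp
  · refine ContDiffAt.congr_of_eventuallyEq ?_ (barrier_comp_eventuallyEq hρ₀.le hu hp)
    exact contDiff_rootProfile.contDiffAt.comp p
      (((contDiffAt_radius_comp hρ₀ sol hp).of_le ENat.LEInfty.out).sub contDiffAt_const)
  · exact contDiffAt_const.congr_of_eventuallyEq hp

/-- The square root is the growth that turns |∂r|² ≤ r e into a gradient bound without the factor r.
In terms of the profile Q, its derivative is at most 1/(2Q), while r ≤ (ρ₁ + 1) Q². -/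
theorem fderiv_barrier_comp_sq_le (hρ₀ : 0 < ρ₀) (hρ₁ : ρ₀ < ρ₁)
    (hcl : IsClosed (C.collar '' (univ ×ˢ Ici ρ₁))) (sol : IsRFSolution C.lam J H u η)
    {p v : ℝ × ℝ} {e : ℝ} (he : 0 ≤ e)
    (hr : u p.1 p.2 ∈ C.endSet ρ₀ →
      fderiv ℝ (fun p : ℝ × ℝ ↦ C.radius (u p.1 p.2)) p v ^ 2 ≤ C.radius (u p.1 p.2) * e) :
    fderiv ℝ (fun p : ℝ × ℝ ↦ C.barrier ρ₀ ρ₁ (u p.1 p.2)) p v ^ 2 ≤ (ρ₁ + 1) * e := by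
  have hu := sol.smooth_u.continuous
  have hρ₁0 : 0 < ρ₁ := hρ₀.trans hρ₁
  rcases mem_endSet_or_barrier_comp_eventuallyEq hρ₀ hρ₁ hcl hu p with hp | hp
  · have h1 := ((contDiffAt_radius_comp hρ₀ sol hp).differentiableAt (by simp)).hasFDerivAt
    set R := fun p : ℝ × ℝ ↦ C.radius (u p.1 p.2) with hR
    have h2 := (hasDerivAt_rootProfile (R p - ρ₁)).comp_hasFDerivAt p (h1.sub_const ρ₁)
    rw [(barrier_comp_eventuallyEq hρ₀.le hu hp).fderiv_eq]
    have h3 : fderiv ℝ (fun p ↦ rootProfile (C.radius (u p.1 p.2) - ρ₁)) p v =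
        max 0 (R p - ρ₁) ^ 3 / (2 * rootProfile (R p - ρ₁) ^ 7) * fderiv ℝ R p v :=
      congrArg (fun L ↦ L v) h2.fderiv
    rw [h3]
    set z := max 0 (R p - ρ₁) with hz
    set Q := rootProfile (R p - ρ₁) with hQ
    have hQ1 : 1 ≤ Q := one_le_rootProfile _
    have hz0 : 0 ≤ z := le_max_left _ _
    have hzQ : z ≤ Q ^ 2 := max_zero_le_rootProfile_sq _
    have hRz : R p ≤ z + ρ₁ := by linarith [le_max_right 0 (R p - ρ₁)]
    have hRQ : R p ≤ (ρ₁ + 1) * Q ^ 2 := by nlinarith [one_le_pow₀ hQ1 (n := 2)]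
    have h4 : fderiv ℝ R p v ^ 2 ≤ (ρ₁ + 1) * Q ^ 2 * e :=
      (hr hp).trans (mul_le_mul_of_nonneg_right hRQ he)
    have h5 : (z ^ 3) ^ 2 ≤ Q ^ 12 := by
      rw [← pow_mul, show Q ^ 12 = (Q ^ 2) ^ 6 by ring]
      exact pow_le_pow_left₀ hz0 hzQ 6
    rw [mul_pow, div_pow, div_mul_eq_mul_div, div_le_iff₀ (by positivity)]
    calc (z ^ 3) ^ 2 * fderiv ℝ R p v ^ 2 ≤ Q ^ 12 * ((ρ₁ + 1) * Q ^ 2 * e) := by gcongr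
      _ = (ρ₁ + 1) * e * Q ^ 14 := by ring
      _ ≤ (ρ₁ + 1) * e * (4 * Q ^ 14) := by
        refine mul_le_mul_of_nonneg_left ?_ (by positivity)
        linarith [show 0 ≤ Q ^ 14 by positivity]
      _ = _ := by ring
  · have h1 : fderiv ℝ (fun p : ℝ × ℝ ↦ C.barrier ρ₀ ρ₁ (u p.1 p.2)) p v = 0 := by
      rw [hp.fderiv_eq, fderiv_fun_const]
      rfl
    rw [h1, zero_pow two_ne_zero]
    positivity

/-- Linear growth of H on the end lets H dominate the square of the barrier, whose integrals are
thereby controlled through η'. -/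
theorem barrier_sq_le (hρ₀ : 0 < ρ₀) (hρ₁ : ρ₀ < ρ₁) (hκ : 0 < κ)
    (hHh : ∀ (s : ℝ) (x : N) (ρ : ℝ), ρ₀ ≤ ρ → H s (C.collar (x, ρ)) = h s ρ)
    (hb : ∀ s ρ, ρ₀ ≤ ρ → ρ / κ ≤ h s ρ) {c : ℝ} (hc0 : 0 ≤ c) (hc : ∀ s w, -c ≤ H s w)
    (s : ℝ) (w : What) : C.barrier ρ₀ ρ₁ w ^ 2 ≤ 1 + κ * (H s w + c) := by
  have h0 : 0 ≤ κ * (H s w + c) := mul_nonneg hκ.le (by linarith [hc s w])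
  by_cases hw : w ∈ C.endSet ρ₀
  · rw [barrier_of_mem hw]
    refine (rootProfile_sq_le _).trans (add_le_add_right ?_ 1)
    refine max_le h0 ?_
    have h1 := (div_le_iff₀ hκ).1 (radius_div_le_hamiltonian hρ₀ hHh hb s hw)
    nlinarith
  · rw [barrier_of_notMem hw]
    linarith

/-- The eighth power of the barrier is 1 + z⁴ with z the positive part of r - ρ₁. Its gradient term
is nonnegative by convexity, and what remains is 4 z³ Δr, estimated by `neg_mul_pow_le_of_bounds`.
-/
theorem planeLaplacian_barrier_comp_ge (hρ₀ : 0 < ρ₀) (hρ₁ : ρ₀ < ρ₁) (hρ₁' : 1 ≤ ρ₁)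
    (hJ : IsCompatibleLoop C.lam J) (hJρ₀ : C.IsContactType ρ₀ J)
    (hcl : IsClosed (C.collar '' (univ ×ˢ Ici ρ₁)))
    (hh : ContDiffOn ℝ ∞ (fun p : ℝ × ℝ ↦ h p.1 p.2) (univ ×ˢ Ici ρ₀))
    (hHh : ∀ (s : ℝ) (x : N) (ρ : ℝ), ρ₀ ≤ ρ → H s (C.collar (x, ρ)) = h s ρ)
    (hκ : 0 < κ) (hγ : 0 < γ) (ha : ∀ s ρ, ρ₀ ≤ ρ → 0 ≤ derivWithin (h s) (Ici ρ₀) ρ)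
    (hc : ∀ s ρ, ρ₀ ≤ ρ →
      |derivWithin (derivWithin (h s) (Ici ρ₀)) (Ici ρ₀) ρ| ≤ κ * ρ ^ γ ∧
      |deriv (fun σ ↦ derivWithin (h σ) (Ici ρ₀) ρ) s| ≤ κ * ρ ^ γ)
    (sol : IsRFSolution C.lam J H u η) {c M B : ℝ} (hc0 : 0 ≤ c) (hM0 : 0 ≤ M)
    (hM : Nonempty N → ∀ s, radialDeriv h ρ₀ s ρ₁ ≤ M) (hη' : ∀ s, -c ≤ deriv η s)
    (hη : ∀ s, |η s| ≤ B) (p : ℝ × ℝ) :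
    -(4 * (B ^ 2 * κ ^ 2 + c * (M + κ) + B * κ) * (ρ₁ + 1) ^ (2 * ⌈γ⌉₊ + 6) *
        C.barrier ρ₀ ρ₁ (u p.1 p.2) ^ (4 * ⌈γ⌉₊ + 12)) ≤
      planeLaplacian (fun p : ℝ × ℝ ↦ C.barrier ρ₀ ρ₁ (u p.1 p.2) ^ 8) p := by
  have hu := sol.smooth_u.continuous
  have hρ₁0 : 0 < ρ₁ := hρ₀.trans hρ₁
  have hB : 0 ≤ B := (abs_nonneg _).trans (hη 0)
  set g := ⌈γ⌉₊ with hg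
  set T := B ^ 2 * κ ^ 2 + c * (M + κ) + B * κ with hT
  have hT0 : 0 ≤ T := by positivity
  have hneg : -(4 * T * (ρ₁ + 1) ^ (2 * g + 6) *
      C.barrier ρ₀ ρ₁ (u p.1 p.2) ^ (4 * g + 12)) ≤ 0 := by
    have := zero_le_one.trans (one_le_barrier (C := C) (ρ₀ := ρ₀) (ρ₁ := ρ₁) (u p.1 p.2))
    have : 0 ≤ 4 * T * (ρ₁ + 1) ^ (2 * g + 6) * C.barrier ρ₀ ρ₁ (u p.1 p.2) ^ (4 * g + 12) := by
      positivity
    linarith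
  rcases mem_endSet_or_barrier_comp_eventuallyEq hρ₀ hρ₁ hcl hu p with hp | hp
  · set R := fun p : ℝ × ℝ ↦ C.radius (u p.1 p.2) with hR
    have hr2 : ContDiffAt ℝ 2 R p := (contDiffAt_radius_comp hρ₀ sol hp).of_le ENat.LEInfty.out
    have hψ : ∀ x, HasDerivAt (fun x : ℝ ↦ 1 + max 0 (x - ρ₁) ^ 4) (4 * max 0 (x - ρ₁) ^ 3) x := by
      intro x
      have h1 := (hasDerivAt_max_zero_pow 2 (x - ρ₁)).comp_sub_const x ρ₁
      norm_num at h1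
      exact h1.const_add 1
    have hψ' : HasDerivAt (fun x : ℝ ↦ 4 * max 0 (x - ρ₁) ^ 3) (4 * (3 * max 0 (R p - ρ₁) ^ 2))
        (R p) := by
      have h1 := ((hasDerivAt_max_zero_pow 1 (R p - ρ₁)).comp_sub_const (R p) ρ₁).const_mul 4
      norm_num at h1
      exact h1
    have hev : (fun p : ℝ × ℝ ↦ C.barrier ρ₀ ρ₁ (u p.1 p.2) ^ 8) =ᶠ[𝓝 p]
        fun p ↦ 1 + max 0 (R p - ρ₁) ^ 4 := by
      filter_upwards [barrier_comp_eventuallyEq hρ₀.le hu hp] with q hq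
      rw [hq, rootProfile_pow]
    rw [planeLaplacian_congr hev, planeLaplacian_comp hr2 hψ hψ']
    obtain ⟨x, -, hpr⟩ := mem_endSet hρ₀.le hp
    have hbar := (barrier_comp_eventuallyEq (ρ₁ := ρ₁) hρ₀.le hu hp).self_of_nhds
    simp only at hbar
    rw [hbar] at hneg ⊢
    set z := max 0 (R p - ρ₁) with hz
    have hz0 : 0 ≤ z := le_max_left _ _
    have hsq : 0 ≤ 4 * (3 * z ^ 2) * (fderiv ℝ R p (1, 0) ^ 2 + fderiv ℝ R p (0, 1) ^ 2) := by
      positivity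
    rcases le_total (R p) ρ₁ with hle | hle
    · have hz00 : z = 0 := max_eq_left (by linarith)
      rw [hz00] at hsq ⊢
      refine hneg.trans ?_
      linarith
    · set Q := rootProfile (C.radius (u p.1 p.2) - ρ₁) with hQ
      have hQ1 : 1 ≤ Q := one_le_rootProfile _
      have hQ2 : 1 ≤ Q ^ 2 := one_le_pow₀ hQ1
      have hzQ : z ≤ Q ^ 2 := max_zero_le_rootProfile_sq _
      have hRz : R p ≤ z + ρ₁ := by linarith [le_max_right 0 (R p - ρ₁)]
      -- A single quantity that is at least 1 and dominates both r and z, so all terms become powers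
      -- of b, hence of the barrier.
      set b := (ρ₁ + 1) * Q ^ 2 with hb
      have hRb : R p ≤ b := by nlinarith
      have hb1 : 1 ≤ b := by nlinarith
      -- With r ≥ 1 the real exponent γ may be rounded up to a natural number.
      have hR1 : 1 ≤ R p := hρ₁'.trans hle
      have hRγ : κ * R p ^ γ ≤ κ * b ^ g := by
        refine mul_le_mul_of_nonneg_left ?_ hκ.le
        calc R p ^ γ ≤ R p ^ (g : ℝ) := Real.rpow_le_rpow_of_exponent_le hR1 (Nat.le_ceil γ)
          _ = R p ^ g := Real.rpow_natCast _ _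
          _ ≤ b ^ g := pow_le_pow_left₀ (by linarith) hRb g
      have hbounds := abs_fderiv_radialDeriv_le hh hc p.1 (ρ := R p) hpr
      have hP : radialDeriv h ρ₀ p.1 (R p) ≤ M + κ * b ^ (g + 1) := by
        have h1 := radialDeriv_le hκ hh hc hγ.le hρ₀ hρ₁ hle p.1
        have h2 := hM ⟨x⟩ p.1
        have h3 : κ * R p ^ γ * (R p - ρ₁) ≤ κ * b ^ g * b :=
          mul_le_mul hRγ (by linarith) (by linarith) (by positivity)
        rw [pow_succ, ← mul_assoc]
        linarith
      have hmain := neg_mul_pow_le_of_bounds (g := g) hb1 hz0 (by nlinarith : z ≤ b)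
        (by linarith : 0 ≤ R p) hRb (IsRFSolution.energyDensity_nonneg hJ p)
        (fderiv_radius_fst_sq_le hρ₀ hJ hJρ₀ sol hp) hκ.le hc0 hM0 (hη' p.1) (hη p.1)
        (ha p.1 (R p) hpr.le) hP (hbounds.2.trans hRγ) (hbounds.1.trans hRγ)
      rw [planeLaplacian_radius hρ₀ hJ hJρ₀ hh hHh sol hp (r := R p) rfl rfl]
      have e1 : 4 * T * (ρ₁ + 1) ^ (2 * g + 6) * Q ^ (4 * g + 12) = 4 * T * b ^ (2 * g + 6) := by
        rw [hb, mul_pow, ← pow_mul, show 2 * (2 * g + 6) = 4 * g + 12 by ring]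
        ring
      rw [e1]
      refine hmain.trans ?_
      exact (le_add_of_nonneg_left hsq)
  · have hev : (fun p : ℝ × ℝ ↦ C.barrier ρ₀ ρ₁ (u p.1 p.2) ^ 8) =ᶠ[𝓝 p] fun _ ↦ 1 := by
      filter_upwards [hp] with q hq
      rw [hq, one_pow]
    rw [planeLaplacian_congr hev]
    refine hneg.trans (le_of_eq ?_)
    simp [planeLaplacian]

end Barrier

/-! ### Integrals over unit squares along a solution -/

theorem intervalIntegral_affine {f : ℝ → ℝ} (hf : Continuous f) (κ c a : ℝ) :
    ∫ x in a..(a + 1), (1 + κ * (f x + c)) = 1 + κ * ((∫ x in a..(a + 1), f x) + c) := by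
  have h1 : Continuous fun x ↦ κ * (f x + c) := (hf.add continuous_const).const_mul κ
  rw [intervalIntegral.integral_add intervalIntegrable_const (h1.intervalIntegrable _ _),
    intervalIntegral.integral_const_mul, intervalIntegral.integral_add (hf.intervalIntegrable _ _)
    intervalIntegrable_const]
  simp

section BoxBounds

variable {m : ℕ} {M : Type*} [TopologicalSpace M] [ChartedSpace (EuclideanSpace ℝ (Fin m)) M]
  {lam : ∀ w : M, TangentSpace (𝓡 m) w →L[ℝ] ℝ}
  {J : ℝ → ∀ w : M, TangentSpace (𝓡 m) w →L[ℝ] TangentSpace (𝓡 m) w}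
  {H : ℝ → M → ℝ} {u : ℝ → ℝ → M} {η : ℝ → ℝ}

namespace IsRFSolution

theorem neg_le_deriv
    (hH : ContMDiff (𝓘(ℝ, ℝ).prod (𝓡 m)) 𝓘(ℝ, ℝ) ∞ (fun p : ℝ × M ↦ H p.1 p.2))
    (sol : IsRFSolution lam J H u η) {c : ℝ} (hc : ∀ s w, -c ≤ H s w) (s : ℝ) :
    -c ≤ deriv η s := by
  have hHs : Continuous fun t ↦ H s (u s t) :=
    (continuous_hamiltonian_comp hH sol.smooth_u).comp (Continuous.prodMk_right s)
  rw [sol.eq_η]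
  have h1 := intervalIntegral.integral_mono_on (a := (0 : ℝ)) (b := 1) (μ := volume)
    (f := fun _ ↦ -c) zero_le_one intervalIntegrable_const (hHs.intervalIntegrable _ _)
    fun t _ ↦ hc s (u s t)
  simpa using h1

variable [IsManifold (𝓡 m) ∞ M]

theorem boxIntegral_energyDensity_le (hlam : IsSmoothOneForm (𝓡 m) lam)
    (hnd : HasNondegenerateDeriv (𝓡 m) lam) (hJ : IsCompatibleLoop lam J)
    (hH : ContMDiff (𝓘(ℝ, ℝ).prod (𝓡 m)) 𝓘(ℝ, ℝ) ∞ (fun p : ℝ × M ↦ H p.1 p.2))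
    (sol : IsRFSolution lam J H u η)
    (hG : Integrable (fun s ↦ gradNormSq lam J (H s) (u s) (η s))) {E : ℝ}
    (hE : (∫ s, gradNormSq lam J (H s) (u s) (η s)) ≤ E) (a b : ℝ) :
    boxIntegral (energyDensity lam J u) a b ≤ E := by
  have he := sol.continuous_energyDensity hlam hnd hJ hH
  have h1 : ∀ s, ∫ t in b..(b + 1), energyDensity lam J u (s, t) =
      ∫ t in (0 : ℝ)..1, energyDensity lam J u (s, t) := by
    intro s
    have h2 : Function.Periodic (fun t ↦ energyDensity lam J u (s, t)) 1 := fun t ↦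
      sol.energyDensity_add_one hJ s t
    rw [h2.intervalIntegral_add_eq b 0, zero_add]
  simp only [boxIntegral, h1]
  exact intervalIntegral_le_of_le_integrable (continuous_intervalIntegral_of_continuous
    (F := fun s t ↦ energyDensity lam J u (s, t)) he 0 1) hG
    (sol.integral_energyDensity_le hJ) (sol.gradNormSq_nonneg hJ) hE (by linarith)

/-- The mean of H over a loop is η', so its integral over a unit square is the increment of η in
unit time, at most 1 + E because η' - 1 ≤ η'². -/
theorem boxIntegral_hamiltonian_le (hJ : IsCompatibleLoop lam J)
    (hH : ContMDiff (𝓘(ℝ, ℝ).prod (𝓡 m)) 𝓘(ℝ, ℝ) ∞ (fun p : ℝ × M ↦ H p.1 p.2))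
    (sol : IsRFSolution lam J H u η)
    (hG : Integrable (fun s ↦ gradNormSq lam J (H s) (u s) (η s))) {E : ℝ}
    (hE : (∫ s, gradNormSq lam J (H s) (u s) (η s)) ≤ E) {κ : ℝ} (hκ : 0 ≤ κ) (c a b : ℝ) :
    boxIntegral (fun p ↦ 1 + κ * (H p.1 (u p.1 p.2) + c)) a b ≤ 1 + κ * (1 + E + c) := by
  have hHc := continuous_hamiltonian_comp hH sol.smooth_u
  have hd : Continuous (deriv η) := sol.smooth_η.continuous_deriv (by norm_num)
  have h1 : ∀ s, ∫ t in b..(b + 1), (1 + κ * (H s (u s t) + c)) = 1 + κ * (deriv η s + c) := by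
    intro s
    have hHs : Continuous fun t ↦ H s (u s t) := hHc.comp (Continuous.prodMk_right s)
    have h2 : Function.Periodic (fun t ↦ H s (u s t)) 1 := fun t ↦
      congrArg (H s) (sol.periodic_u s t)
    rw [intervalIntegral_affine hHs, h2.intervalIntegral_add_eq b 0, zero_add, ← sol.eq_η]
  simp only [boxIntegral, h1]
  -- The integrand is η' - 1, written in the shape of `intervalIntegral_affine`.
  have h3 : ∫ s in a..(a + 1), (1 + 1 * (deriv η s + -2)) ≤ E :=
    intervalIntegral_le_of_le_integrable (continuous_const.add
      ((hd.add continuous_const).const_mul 1)) hG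
      (fun s ↦ le_trans (by
        change 1 + 1 * (deriv η s + -2) ≤ deriv η s ^ 2
        nlinarith [sq_nonneg (deriv η s - 1 / 2)]) (sol.deriv_sq_le hJ s))
      (sol.gradNormSq_nonneg hJ) hE (by linarith)
  rw [intervalIntegral_affine hd] at h3 ⊢
  gcongr
  linarith

end IsRFSolution

end BoxBounds

/-! ### The radial derivative at one fixed radius -/

section BoundaryProfile

variable {n : ℕ} [NeZero n] {W : Type*} [TopologicalSpace W]
  [ChartedSpace (EuclideanHalfSpace (2 * n)) W] [IsManifold (𝓡∂ (2 * n)) ∞ W]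
  [T2Space W] [CompactSpace W] [ConnectedSpace W] {D : LiouvilleDomain n W}
  {N : Type*} [TopologicalSpace N] [ChartedSpace (EuclideanSpace ℝ (Fin (2 * n - 1))) N]
  [IsManifold (𝓡 (2 * n - 1)) ∞ N]
  {What : Type*} [TopologicalSpace What] [ChartedSpace (EuclideanSpace ℝ (Fin (2 * n))) What]
  [IsManifold (𝓡 (2 * n)) ∞ What] [T2Space What] {C : LiouvilleCompletion D N What}
  {ρ₀ : ℝ} {J : ℝ → ∀ w : What, TangentSpace (𝓡 (2 * n)) w →L[ℝ] TangentSpace (𝓡 (2 * n)) w}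

variable {H : ℝ → What → ℝ} {h : ℝ → ℝ → ℝ}

/-- For nonempty N the profile h inherits stationarity outside [0, 1] from H, and continuity in s
does the rest. If N is empty, h is not tied to H and no uniform bound need hold, hence the guard. -/
theorem exists_radialDeriv_le
    (hh : ContDiffOn ℝ ∞ (fun p : ℝ × ℝ ↦ h p.1 p.2) (univ ×ˢ Ici ρ₀))
    (hH0 : ∀ s ≤ 0, H s = H 0) (hH1 : ∀ s, 1 ≤ s → H s = H 1)
    (hHh : ∀ (s : ℝ) (x : N) (ρ : ℝ), ρ₀ ≤ ρ → H s (C.collar (x, ρ)) = h s ρ) {ρ₁ : ℝ}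
    (hρ₁ : ρ₀ < ρ₁) :
    ∃ M, 0 ≤ M ∧ (Nonempty N → ∀ s, radialDeriv h ρ₀ s ρ₁ ≤ M) := by
  have hc : Continuous fun s ↦ radialDeriv h ρ₀ s ρ₁ := continuous_iff_continuousAt.2 fun s ↦
    (fderiv_radialDeriv_fst hh s hρ₁).continuousAt
  obtain ⟨M, hM⟩ := (isCompact_Icc (a := (0 : ℝ)) (b := 1)).exists_bound_of_continuousOn
    hc.continuousOn
  refine ⟨max M 0, le_max_right _ _, fun ⟨x⟩ s ↦ ?_⟩
  obtain ⟨s', hs', e⟩ := exists_time_eq hH0 hH1 s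
  have h1 : EqOn (h s) (h s') (Ici ρ₀) := fun ρ hρ ↦ by rw [← hHh s x ρ hρ, ← hHh s' x ρ hρ, e]
  have h2 : radialDeriv h ρ₀ s ρ₁ = radialDeriv h ρ₀ s' ρ₁ := derivWithin_congr h1 (h1 hρ₁.le)
  rw [h2]
  exact ((le_abs_self _).trans (hM s' hs')).trans (le_max_left _ _)

end BoundaryProfile

end RabinowitzFloer

end

/-! ### Assembly of the estimates -/

theorem mainTheorem4
    {n : ℕ} [NeZero n]
    -- the Liouville domain `W`, its boundary `N`, and its completion `What`
    {W : Type*} [TopologicalSpace W]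
    [ChartedSpace (EuclideanHalfSpace (2 * n)) W] [IsManifold (𝓡∂ (2 * n)) ∞ W]
    [T2Space W] [CompactSpace W] [ConnectedSpace W]
    (D : RabinowitzFloer.LiouvilleDomain n W)
    {N : Type*} [TopologicalSpace N] [ChartedSpace (EuclideanSpace ℝ (Fin (2 * n - 1))) N]
    [IsManifold (𝓡 (2 * n - 1)) ∞ N]
    {What : Type*} [TopologicalSpace What]
    [ChartedSpace (EuclideanSpace ℝ (Fin (2 * n))) What]
    [IsManifold (𝓡 (2 * n)) ∞ What] [T2Space What]
    (C : RabinowitzFloer.LiouvilleCompletion D N What)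
    -- the loop of almost complex structures
    (ρ₀ : ℝ) (hρ₀ : 0 < ρ₀)
    (J : ℝ → ∀ w : What, TangentSpace (𝓡 (2 * n)) w →L[ℝ] TangentSpace (𝓡 (2 * n)) w)
    (hJ : RabinowitzFloer.IsCompatibleLoop C.lam J)
    (hJρ₀ : C.IsContactType ρ₀ J)
    -- the family of Hamiltonians
    (H : ℝ → What → ℝ)
    (hH : ContMDiff (𝓘(ℝ, ℝ).prod (𝓡 (2 * n))) 𝓘(ℝ, ℝ) ∞ (fun p : ℝ × What ↦ H p.1 p.2))
    (hH0 : ∀ s ≤ 0, H s = H 0) (hH1 : ∀ s, 1 ≤ s → H s = H 1)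
    (θ : ℝ) (hθ : 0 < θ)
    (hHθ : ∀ s w, H s w = 0 →
      θ ≤ C.lam w (RabinowitzFloer.hamiltonianVF C.lam (H s) w) - H s w)
    (h : ℝ → ℝ → ℝ)
    (hh : ContDiffOn ℝ ∞ (fun p : ℝ × ℝ ↦ h p.1 p.2) (Set.univ ×ˢ Set.Ici ρ₀))
    (hHh : ∀ (s : ℝ) (x : N) (ρ : ℝ), ρ₀ ≤ ρ → H s (C.collar (x, ρ)) = h s ρ)
    (κ γ : ℝ) (hκ : 0 < κ) (hγ : 0 < γ)
    (ha : ∀ s ρ, ρ₀ ≤ ρ → 0 ≤ derivWithin (h s) (Set.Ici ρ₀) ρ)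
    (hb : ∀ s ρ, ρ₀ ≤ ρ → ρ / κ ≤ h s ρ)
    (hc : ∀ s ρ, ρ₀ ≤ ρ →
      |derivWithin (derivWithin (h s) (Set.Ici ρ₀)) (Set.Ici ρ₀) ρ| ≤ κ * ρ ^ γ ∧
      |deriv (fun σ ↦ derivWithin (h σ) (Set.Ici ρ₀) ρ) s| ≤ κ * ρ ^ γ) :
    ∀ A E : ℝ, ∃ K : Set What, IsCompact K ∧
      ∀ (u : ℝ → ℝ → What) (η : ℝ → ℝ), RabinowitzFloer.IsRFSolution C.lam J H u η →
        (∀ s, |RabinowitzFloer.action C.lam (H s) (u s) (η s)| ≤ A) →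
        MeasureTheory.Integrable
          (fun s ↦ RabinowitzFloer.gradNormSq C.lam J (H s) (u s) (η s)) →
        (∫ s, RabinowitzFloer.gradNormSq C.lam J (H s) (u s) (η s)) ≤ E →
        ∀ s t, u s t ∈ K := by
  intro A E
  -- The radius `ρ₁ = ρ₀ + 1` lies strictly inside the end and is at least 1, as the barrier
  -- estimates require.
  have hρ₁ : ρ₀ < ρ₀ + 1 := lt_add_one ρ₀
  have hcl := RabinowitzFloer.isClosed_collar_image hρ₀ hκ
    (RabinowitzFloer.contMDiff_hamiltonian hH 0).continuous hHh hb hρ₁.le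
  obtain ⟨c, hc0, hcH⟩ :=
    RabinowitzFloer.exists_neg_le_hamiltonian hρ₀ hκ hH.continuous hH0 hH1 hHh hb
  obtain ⟨M, hM0, hM⟩ := RabinowitzFloer.exists_radialDeriv_le (C := C) hh hH0 hH1 hHh hρ₁
  obtain ⟨ε, hε, hεK⟩ := RabinowitzFloer.exists_level_bound hρ₀ hκ hH hH0 hH1 hθ hHθ hHh hb
  obtain ⟨c', hc', hcK⟩ := RabinowitzFloer.exists_comparison_bound hJ hH hH0 hH1
    (C.isCompact_compl_endSet hρ₀.le)
  obtain ⟨B, hB⟩ := RabinowitzFloer.exists_forall_abs_multiplier_le C.smooth C.nondegenerate hJ hH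
    hε hθ hεK hc' hcK A E
  set T := 4 * (B ^ 2 * κ ^ 2 + c * (M + κ) + B * κ) * (ρ₀ + 1 + 1) ^ (2 * ⌈γ⌉₊ + 6) with hT
  -- One constant serves the Laplacian bound (T), the gradient energy and the L² bound of the
  -- barrier. All three depend only on the data and on A and E, and so does b.
  obtain ⟨b, hbar⟩ := RabinowitzFloer.exists_forall_le_of_planeLaplacian
    (max T (max ((ρ₀ + 1 + 1) * E) (1 + κ * (1 + E + c)))) (4 * ⌈γ⌉₊ + 12)
  -- A barrier value of at most b forces r - ρ₁ ≤ b².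
  refine ⟨(C.endSet (ρ₀ + 1 + b ^ 2))ᶜ, C.isCompact_compl_endSet (by positivity), ?_⟩
  -- K is a complement, so `hst` places the point in the end beyond radius ρ₀ + 1 + b², to be
  -- contradicted.
  intro u η sol hA hG hE s t hst
  have hη := hB u η sol hA hG hE
  have hpos : 0 ≤ ρ₀ + 1 + 1 := by positivity
  have hq1 : ∀ p : ℝ × ℝ, 1 ≤ C.barrier ρ₀ (ρ₀ + 1) (u p.1 p.2) := fun p ↦
    RabinowitzFloer.one_le_barrier _
  have hq2 := RabinowitzFloer.contDiff_barrier_comp hρ₀ hρ₁ hcl sol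
  have key := hbar (fun p ↦ C.barrier ρ₀ (ρ₀ + 1) (u p.1 p.2))
    (fun p ↦ (ρ₀ + 1 + 1) * RabinowitzFloer.energyDensity C.lam J u p) hq2
    ((sol.continuous_energyDensity C.smooth C.nondegenerate hJ hH).const_mul _) hq1
    (fun p ↦ RabinowitzFloer.fderiv_barrier_comp_sq_le hρ₀ hρ₁ hcl sol
      (RabinowitzFloer.IsRFSolution.energyDensity_nonneg hJ p)
      (RabinowitzFloer.fderiv_radius_fst_sq_le hρ₀ hJ hJρ₀ sol))
    (fun p ↦ RabinowitzFloer.fderiv_barrier_comp_sq_le hρ₀ hρ₁ hcl sol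
      (RabinowitzFloer.IsRFSolution.energyDensity_nonneg hJ p)
      (RabinowitzFloer.fderiv_radius_snd_sq_le hρ₀ hJ hJρ₀ hh hHh sol))
    (fun x y ↦ by
      rw [RabinowitzFloer.boxIntegral_const_mul]
      refine le_trans (mul_le_mul_of_nonneg_left ?_ hpos)
        ((le_max_left _ _).trans (le_max_right _ _))
      exact sol.boxIntegral_energyDensity_le C.smooth C.nondegenerate hJ hH hG hE x y)
    (fun x y ↦ by
      refine le_trans ?_ ((le_max_right _ _).trans (le_max_right _ _))
      refine (RabinowitzFloer.boxIntegral_mono (hq2.continuous.pow 2) (continuous_const.add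
        (((RabinowitzFloer.continuous_hamiltonian_comp hH sol.smooth_u).add
          continuous_const).const_mul κ)) fun p ↦
        RabinowitzFloer.barrier_sq_le hρ₀ hρ₁ hκ hHh hb hc0 hcH p.1 (u p.1 p.2)).trans ?_
      exact sol.boxIntegral_hamiltonian_le hJ hH hG hE hκ.le c x y)
    (fun p ↦ by
      refine le_trans (neg_le_neg (mul_le_mul_of_nonneg_right (le_max_left _ _)
        (pow_nonneg (zero_le_one.trans (hq1 p)) _))) ?_
      exact RabinowitzFloer.planeLaplacian_barrier_comp_ge hρ₀ hρ₁ (by linarith) hJ hJρ₀ hcl hh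
        hHh hκ hγ ha hc sol hc0 hM0 hM (sol.neg_le_deriv hH hcH) hη p)
    (s, t)
  obtain ⟨x, hx, hr⟩ := RabinowitzFloer.mem_endSet (by positivity) hst
  have hmem : u s t ∈ C.endSet ρ₀ :=
    ⟨(x, C.radius (u s t)), ⟨Set.mem_univ _, (by nlinarith [sq_nonneg b] : ρ₀ < C.radius (u s t))⟩, hx⟩
  rw [RabinowitzFloer.barrier_of_mem hmem] at key
  have h1 := (le_max_right 0 _).trans
    (RabinowitzFloer.max_zero_le_rootProfile_sq (C.radius (u s t) - (ρ₀ + 1)))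
  have h2 := pow_le_pow_left₀
    (zero_le_one.trans (RabinowitzFloer.one_le_rootProfile (C.radius (u s t) - (ρ₀ + 1)))) key 2
  linarith
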